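/- Let $R$ be a field and $q\in R^\times$ with $q\neq 1$; put $\mu_q=\{q^k: k\in\mathbb Z\}$. Let $H_n^{\mathrm{aff}}$ be the affine Hecke algebra: the $R$-algebra generated by $T_1,\dots,T_{n-1},X_1^{\pm1},\dots,X_n^{\pm1}$ with the braid relations and $(T_i+1)(T_i-q)=0$ for the $T_i$, with commuting invertible $X_j$, with $T_iX_iT_i=qX_{i+1}$, and $T_iX_j=X_jT_i$ for $j\ne i,i+1$. For a finitely supported $\lambda:\mu_q\to\mathbb Z_{\ge0}$ let $H_n^\lambda$ be the cyclotomic Hecke (Ariki–Koike) algebra: generated by $T_0,T_1,\dots,T_{n-1}$ with $\prod_{a\in\mu_q}(T_0-a)^{\lambda_a}=0$, $T_0T_1T_0T_1=T_1T_0T_1T_0$, $T_0T_j=T_jT_0$ for $j\ge2$, and the braid and quadratic relations for $T_1,\dots,T_{n-1}$ (so $H_0^\lambda=R$). Let $\mathrm{ev}:H_n^{\mathrm{aff}}\to H_n^\lambda$ be the surjection $T_i\mapsto T_i$, $X_1\mapsto T_0$, $X_j\mapsto q^{1-j}T_{j-1}\cdots T_1T_0T_1\cdots T_{j-1}$, and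 let $\mathrm{pr}_\lambda N=N/(\ker\mathrm{ev})N$. We also allow $\lambda=\mathrm{aff}$, with $\mathrm{ev}$ and $\mathrm{pr}_\lambda$ the identity. For $i\in\mu_q$ let $iJ_1$ be the one-dimensional $H_1^{\mathrm{aff}}=R[x^{\pm1}]$-module on which $x$ acts by $i$. For an $H_n^\lambda$-module $M$ put $$\tilde f_iM=\mathrm{pr}_\lambda\,\mathrm{cosoc}\,\mathrm{Ind}_{H_n^{\mathrm{aff}}\otimes H_1^{\mathrm{aff}}}^{H_{n+1}^{\mathrm{aff}}}(\mathrm{ev}^*M\boxtimes iJ_1),\qquad \tilde e_iM=\mathrm{soc}\,\mathrm{Hom}_{R[X_n^{\pm1}]}(iJ_1,\mathrm{Res}\,\mathrm{ev}^*M),$$ which are an $H_{n+1}^\lambda$-module and an $H_{n-1}^\lambda$-module respectively ($\tilde e_iM=0$ if $n=0$). Theorem. Let $\lambda$ be affine or cyclotomic and $i\in\mu_q$. (a) If $M$ is an irreducible $H_n^\lambda$-module, then $\tilde e_iM$ and $\tilde f_iM$ are each irreducible or zero. (b) If $M$ is an irreducible $H_{n+1}^\lambda$-module and $N$ is an irreducible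 $H_n^\lambda$-module, then $\tilde e_iM\cong N$ if and only if $M\cong\tilde f_iN$. (c) Call an $H_n^{\mathrm{aff}}$-module $q$-integral if it is finite dimensional and annihilated by some $\prod_{a\in\mu_q}(X_1-a)^{k_a}$ (no condition on $X_1$ if $n=0$). If $M$ is irreducible and $\mathrm{ev}^*M$ is $q$-integral, then so are $\mathrm{ev}^*\tilde e_iM$ and $\mathrm{ev}^*\tilde f_iM$. (d) Hence $(B_\lambda,\tilde e_i,\tilde f_i)$ is a well-defined crystal graph: if $B_\lambda$ is the disjoint union over $n\ge0$ of the sets of isomorphism classes of irreducible $H_n^\lambda$-modules, then there are unique maps $\tilde e_i,\tilde f_i:B_\lambda\to B_\lambda\sqcup\{0\}$ ($i\in\mu_q$) which send the class of $M$ to the class of $\tilde e_iM$, respectively $\tilde f_iM$, and satisfy $\tilde e_ib=b'\iff\tilde f_ib'=b$ for all $b,b'\in B_\lambda$. -/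

import Mathlib

open scoped TensorProduct

universe u

noncomputable section

namespace HeckeCrystal

/-! ### Socle, cosocle, induction, external tensor product, quotients by kernels -/

section General

/-- The socle: the sum of all simple submodules, i.e. the largest semisimple submodule. -/
def soc (A : Type u) [Ring A] (M : Type u) [AddCommGroup M] [Module A M] : Submodule A M :=
  sSup {S : Submodule A M | IsSimpleModule A S}

/-- The cosocle: the quotient by the intersection of all maximal submodules.  For modules of finite
length this is the largest semisimple quotient. -/
def cosoc {A : Type u} [Ring A] (M : ModuleCat.{u} A) : ModuleCat.{u} A :=
  ModuleCat.of A (M ⧸ Module.jacobson A M)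

/-- The relations `b φ(a) ⊗ v = b ⊗ a v` which turn `B ⊗_ℤ V` into `B ⊗_A V`. -/
def indRel {A B : Type u} [Ring A] [Ring B] (φ : A →+* B) (V : ModuleCat.{u} A) :
    Submodule B (B ⊗[ℤ] V) :=
  Submodule.span B {x | ∃ (b : B) (a : A) (v : V), x = (b * φ a) ⊗ₜ[ℤ] v - b ⊗ₜ[ℤ] (a • v)}

/-- Induction `B ⊗_A V` along a homomorphism `φ : A → B` of (noncommutative) rings. -/
def ind {A B : Type u} [Ring A] [Ring B] (φ : A →+* B) (V : ModuleCat.{u} A) : ModuleCat.{u} B :=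
  ModuleCat.of B ((B ⊗[ℤ] V) ⧸ indRel φ V)

/-- The action of `A ⊗ B` on `V ⊗ W`, `(a ⊗ b) (v ⊗ w) = a v ⊗ b w`. -/
def boxAction {R : Type u} [Field R] {A B : Type u} [Ring A] [Ring B] [Algebra R A] [Algebra R B]
    (V W : Type u) [AddCommGroup V] [AddCommGroup W] [Module R V] [Module R W] [Module A V]
    [Module B W] [IsScalarTower R A V] [IsScalarTower R B W] :
    A ⊗[R] B →ₐ[R] Module.End R (V ⊗[R] W) :=
  (Module.endTensorEndAlgHom (R := R) (S := R) (A := R) (M := V) (N := W)).comp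
    (Algebra.TensorProduct.map (Algebra.lsmul R R V) (Algebra.lsmul R R W))

/-- The external tensor product `V ⊠ W`, a module over `A ⊗_R B`. -/
def box (R : Type u) [Field R] {A B : Type u} [Ring A] [Ring B] [Algebra R A] [Algebra R B]
    (V : ModuleCat.{u} A) (W : ModuleCat.{u} B) : ModuleCat.{u} (A ⊗[R] B) :=
  letI : Module R V := ModuleCat.moduleOfAlgebraModule V
  letI : Module R W := ModuleCat.moduleOfAlgebraModule W
  haveI : IsScalarTower R A V := ModuleCat.isScalarTower_of_algebra_moduleCat V
  haveI : IsScalarTower R B W := ModuleCat.isScalarTower_of_algebra_moduleCat W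
  letI : Module (A ⊗[R] B) (V ⊗[R] W) :=
    Module.compHom (V ⊗[R] W) (boxAction (R := R) (A := A) (B := B) V W).toRingHom
  ModuleCat.of (A ⊗[R] B) (V ⊗[R] W)

/-- The submodule `I N`, where `I = ker f`. -/
def kerSMul {A B : Type u} [Ring A] [Ring B] (f : A →+* B) (N : ModuleCat.{u} A) :
    Submodule A N :=
  RingHom.ker f • (⊤ : Submodule A N)

theorem ker_le_ker_toAddMonoidEnd {A B : Type u} [Ring A] [Ring B] (f : A →+* B)
    (N : ModuleCat.{u} A) :
    RingHom.ker f ≤ RingHom.ker (Module.toAddMonoidEnd A (N ⧸ kerSMul f N)) := by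
  intro a ha
  rw [RingHom.mem_ker]
  ext x
  obtain ⟨y, rfl⟩ := Submodule.Quotient.mk_surjective _ x
  change a • (Submodule.Quotient.mk y : N ⧸ kerSMul f N) = 0
  rw [← Submodule.Quotient.mk_smul, Submodule.Quotient.mk_eq_zero]
  exact Submodule.smul_mem_smul ha Submodule.mem_top

/-- For a surjection `f : A → B` with kernel `I`, the quotient `N / I N` as a module over
`B = A / I`: the element `f a` acts as `a`. -/
def modKer {A B : Type u} [Ring A] [Ring B] (f : A →+* B) (hf : Function.Surjective f)
    (N : ModuleCat.{u} A) : ModuleCat.{u} B :=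
  letI : Module B (N ⧸ kerSMul f N) := Module.compHom (N ⧸ kerSMul f N)
    (f.liftOfSurjective hf
      ⟨Module.toAddMonoidEnd A (N ⧸ kerSMul f N), ker_le_ker_toAddMonoidEnd f N⟩)
  ModuleCat.of B (N ⧸ kerSMul f N)

end General

/-! ### The affine Hecke algebra -/

section Affine

variable {R : Type u} [Field R]

/-- Generators of the affine Hecke algebra, numbered from `0`: `T i` is the generator usually
written `T_{i+1}` (exchanging the places `i` and `i + 1`), and `X j`, `Xinv j` are `X_{j+1}^{±1}`. -/
inductive AffGen (n : ℕ) : Type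
  | T (i : ℕ) (h : i + 1 < n) : AffGen n
  | X (j : ℕ) (h : j < n) : AffGen n
  | Xinv (j : ℕ) (h : j < n) : AffGen n

open AffGen in
/-- The defining relations of the affine Hecke algebra (Bernstein presentation). -/
inductive AffRel (q : Rˣ) (n : ℕ) :
    FreeAlgebra R (AffGen n) → FreeAlgebra R (AffGen n) → Prop
  | braid (i : ℕ) (h : i + 1 < n) (h' : i + 1 + 1 < n) : AffRel q n
      (FreeAlgebra.ι R (T i h) * FreeAlgebra.ι R (T (i + 1) h') * FreeAlgebra.ι R (T i h))
      (FreeAlgebra.ι R (T (i + 1) h') * FreeAlgebra.ι R (T i h) * FreeAlgebra.ι R (T (i + 1) h'))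
  | far (i j : ℕ) (hi : i + 1 < n) (hj : j + 1 < n) (hij : i + 1 < j) : AffRel q n
      (FreeAlgebra.ι R (T i hi) * FreeAlgebra.ι R (T j hj))
      (FreeAlgebra.ι R (T j hj) * FreeAlgebra.ι R (T i hi))
  | quad (i : ℕ) (h : i + 1 < n) : AffRel q n
      ((FreeAlgebra.ι R (T i h) + 1) * (FreeAlgebra.ι R (T i h) - algebraMap R _ (q : R))) 0
  | mul_inv (j : ℕ) (h : j < n) : AffRel q n
      (FreeAlgebra.ι R (X j h) * FreeAlgebra.ι R (Xinv j h)) 1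
  | inv_mul (j : ℕ) (h : j < n) : AffRel q n
      (FreeAlgebra.ι R (Xinv j h) * FreeAlgebra.ι R (X j h)) 1
  | comm (j k : ℕ) (hj : j < n) (hk : k < n) : AffRel q n
      (FreeAlgebra.ι R (X j hj) * FreeAlgebra.ι R (X k hk))
      (FreeAlgebra.ι R (X k hk) * FreeAlgebra.ι R (X j hj))
  | TXT (i : ℕ) (h : i + 1 < n) (h' : i < n) : AffRel q n
      (FreeAlgebra.ι R (T i h) * FreeAlgebra.ι R (X i h') * FreeAlgebra.ι R (T i h))
      ((q : R) • FreeAlgebra.ι R (X (i + 1) h))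
  | TX (i j : ℕ) (hi : i + 1 < n) (hj : j < n) (h : j ≠ i) (h' : j ≠ i + 1) : AffRel q n
      (FreeAlgebra.ι R (T i hi) * FreeAlgebra.ι R (X j hj))
      (FreeAlgebra.ι R (X j hj) * FreeAlgebra.ι R (T i hi))

/-- The affine Hecke algebra `H_n^aff`. -/
def AffHecke (q : Rˣ) (n : ℕ) : Type u := RingQuot (AffRel q n)

instance (q : Rˣ) (n : ℕ) : Ring (AffHecke q n) := inferInstanceAs (Ring (RingQuot (AffRel q n)))

instance (q : Rˣ) (n : ℕ) : Algebra R (AffHecke q n) :=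
  inferInstanceAs (Algebra R (RingQuot (AffRel q n)))

namespace AffHecke

/-- The quotient map from the free algebra. -/
def mk (q : Rˣ) (n : ℕ) : FreeAlgebra R (AffGen n) →ₐ[R] AffHecke q n :=
  RingQuot.mkAlgHom R (AffRel q n)

/-- The image of a generator. -/
def gen (q : Rˣ) {n : ℕ} (g : AffGen n) : AffHecke q n := mk q n (FreeAlgebra.ι R g)

/-- The generator `X_{j+1}` of `H_n^aff`. -/
abbrev X (q : Rˣ) {n : ℕ} (j : ℕ) (h : j < n) : AffHecke q n := gen q (AffGen.X j h)

theorem mk_rel (q : Rˣ) {n : ℕ} {x y : FreeAlgebra R (AffGen n)} (h : AffRel q n x y) :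
    mk q n x = mk q n y :=
  RingQuot.mkAlgHom_rel R h

/-- The homomorphism given by images of the generators that satisfy the relations. -/
def lift (q : Rˣ) {n : ℕ} {A : Type u} [Ring A] [Algebra R A] (f : AffGen n → A)
    (h : ∀ ⦃x y⦄, AffRel q n x y → FreeAlgebra.lift R f x = FreeAlgebra.lift R f y) :
    AffHecke q n →ₐ[R] A :=
  RingQuot.liftAlgHom R ⟨FreeAlgebra.lift R f, h⟩

theorem lift_gen (q : Rˣ) {n : ℕ} {A : Type u} [Ring A] [Algebra R A] (f : AffGen n → A)
    (h : ∀ ⦃x y⦄, AffRel q n x y → FreeAlgebra.lift R f x = FreeAlgebra.lift R f y)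
    (g : AffGen n) : lift q f h (gen q g) = f g := by
  have := RingQuot.liftAlgHom_mkAlgHom_apply R (FreeAlgebra.lift R f) h (FreeAlgebra.ι R g)
  rw [FreeAlgebra.lift_ι_apply] at this
  exact this

theorem eq_top (q : Rˣ) {n : ℕ} (S : Subalgebra R (AffHecke q n)) (h : ∀ g, gen q g ∈ S) :
    S = ⊤ := by
  rw [eq_top_iff]
  intro a _
  obtain ⟨x, rfl⟩ : ∃ x, mk q n x = a := RingQuot.mkAlgHom_surjective R (AffRel q n) a
  induction x using FreeAlgebra.induction with
  | grade0 r => rw [AlgHom.commutes]; exact S.algebraMap_mem r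
  | grade1 g => exact h g
  | mul x y hx hy => rw [map_mul]; exact S.mul_mem (hx trivial) (hy trivial)
  | add x y hx hy => rw [map_add]; exact S.add_mem (hx trivial) (hy trivial)

/-- The embedding `H_n^aff → H_{n+1}^aff` on the first `n` places. -/
def incl (q : Rˣ) (n : ℕ) : AffHecke q n →ₐ[R] AffHecke q (n + 1) :=
  lift q
    (fun g => match g with
      | .T i h => gen q (.T i (h.trans n.lt_succ_self))
      | .X j h => gen q (.X j (h.trans n.lt_succ_self))
      | .Xinv j h => gen q (.Xinv j (h.trans n.lt_succ_self)))
    (by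
      have key : ∀ {x y : FreeAlgebra R (AffGen (n + 1))}, AffRel q (n + 1) x y →
        mk q (n + 1) x = mk q (n + 1) y := fun h => mk_rel q h
      intro x y h
      cases h with
      | braid i h h' =>
        simpa [gen] using key (.braid i (h.trans n.lt_succ_self) (h'.trans n.lt_succ_self))
      | far i j hi hj hij =>
        simpa [gen] using
          key (.far i j (hi.trans n.lt_succ_self) (hj.trans n.lt_succ_self) hij)
      | quad i h => simpa [gen] using key (.quad i (h.trans n.lt_succ_self))
      | mul_inv j h => simpa [gen] using key (.mul_inv j (h.trans n.lt_succ_self))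
      | inv_mul j h => simpa [gen] using key (.inv_mul j (h.trans n.lt_succ_self))
      | comm j k hj hk =>
        simpa [gen] using key (.comm j k (hj.trans n.lt_succ_self) (hk.trans n.lt_succ_self))
      | TXT i h h' =>
        simpa [gen] using key (.TXT i (h.trans n.lt_succ_self) (h'.trans n.lt_succ_self))
      | TX i j hi hj h h' =>
        simpa [gen] using
          key (.TX i j (hi.trans n.lt_succ_self) (hj.trans n.lt_succ_self) h h'))

/-- The embedding `H_1^aff = R[x, x⁻¹] → H_{n+1}^aff` on the last place, `x ↦ X_{n+1}`. -/
def last (q : Rˣ) (n : ℕ) : AffHecke q 1 →ₐ[R] AffHecke q (n + 1) :=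
  lift q
    (fun g => match g with
      | .T _ _ => 0
      | .X _ _ => gen q (.X n n.lt_succ_self)
      | .Xinv _ _ => gen q (.Xinv n n.lt_succ_self))
    (by
      have key : ∀ {x y : FreeAlgebra R (AffGen (n + 1))}, AffRel q (n + 1) x y →
        mk q (n + 1) x = mk q (n + 1) y := fun h => mk_rel q h
      intro x y h
      cases h with
      | mul_inv j h => simpa [gen] using key (.mul_inv n n.lt_succ_self)
      | inv_mul j h => simpa [gen] using key (.inv_mul n n.lt_succ_self)
      | comm j k hj hk => simp
      | _ => omega)

theorem commute_of_inv {A : Type u} [Ring A] {a x y : A} (h : Commute a x) (hxy : x * y = 1)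
    (hyx : y * x = 1) : Commute a y := by
  have : a * y = y * (x * a) * y := by rw [← mul_assoc y, hyx, one_mul]
  rw [Commute, SemiconjBy, this, ← h.eq, mul_assoc, mul_assoc, hxy, mul_one]

theorem incl_last_commute (q : Rˣ) (n : ℕ) (a : AffHecke q n) (b : AffHecke q 1) :
    Commute (incl q n a) (last q n b) := by
  have mi : gen q (.X n n.lt_succ_self) * gen q (.Xinv n n.lt_succ_self) = 1 := by
    simpa [gen] using mk_rel q (AffRel.mul_inv n n.lt_succ_self)
  have im : gen q (.Xinv n n.lt_succ_self) * gen q (.X n n.lt_succ_self) = 1 := by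
    simpa [gen] using mk_rel q (AffRel.inv_mul n n.lt_succ_self)
  have cX : ∀ a : AffHecke q n, Commute (gen q (.X n n.lt_succ_self)) (incl q n a) := by
    intro a
    have : a ∈ (Subalgebra.centralizer R {gen q (.X n n.lt_succ_self)}).comap (incl q n) := by
      rw [eq_top q ((Subalgebra.centralizer R _).comap (incl q n))]
      · trivial
      intro g
      rw [Subalgebra.mem_comap, Subalgebra.mem_centralizer_iff]
      rintro _ rfl
      rw [incl, lift_gen]
      have cx : ∀ (j : ℕ) (h : j < n + 1), Commute (gen q (.X n n.lt_succ_self))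
          (gen q (.X j h)) := by
        intro j h
        simpa [gen, Commute, SemiconjBy] using mk_rel q (AffRel.comm n j n.lt_succ_self h)
      cases g with
      | T i h =>
        have := mk_rel q (AffRel.TX i n (h.trans n.lt_succ_self) n.lt_succ_self
          (by omega) (by omega))
        simpa [gen] using this.symm
      | X j h => exact cx _ _
      | Xinv j h =>
        refine commute_of_inv (cx j (h.trans n.lt_succ_self)) ?_ ?_
        · simpa [gen] using mk_rel q (AffRel.mul_inv j (h.trans n.lt_succ_self))
        · simpa [gen] using mk_rel q (AffRel.inv_mul j (h.trans n.lt_succ_self))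
    rw [Subalgebra.mem_comap, Subalgebra.mem_centralizer_iff] at this
    exact this _ rfl
  have : b ∈ (Subalgebra.centralizer R {incl q n a}).comap (last q n) := by
    rw [eq_top q ((Subalgebra.centralizer R _).comap (last q n))]
    · trivial
    intro g
    rw [Subalgebra.mem_comap, Subalgebra.mem_centralizer_iff]
    rintro _ rfl
    rw [last, lift_gen]
    cases g with
    | T i h => omega
    | X j h => exact (cX a).symm
    | Xinv j h => exact commute_of_inv (cX a).symm mi im
  rw [Subalgebra.mem_comap, Subalgebra.mem_centralizer_iff] at this
  exact this _ rfl

/-- The embedding `H_n^aff ⊗ H_1^aff → H_{n+1}^aff`. -/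
def levi (q : Rˣ) (n : ℕ) : AffHecke q n ⊗[R] AffHecke q 1 →ₐ[R] AffHecke q (n + 1) :=
  Algebra.TensorProduct.lift (incl q n) (last q n) (incl_last_commute q n)

end AffHecke

/-- The set `μ_q` of powers of `q`. -/
abbrev Mu (q : Rˣ) : Type u := ↥(Subgroup.zpowers q)

/-- The character `X_1 ↦ i` of `H_1^aff`. -/
def chi (q : Rˣ) (i : Mu q) : AffHecke q 1 →ₐ[R] R :=
  AffHecke.lift q
    (fun g => match g with
      | .T _ _ => 0
      | .X _ _ => ((i : Rˣ) : R)
      | .Xinv _ _ => (((i : Rˣ)⁻¹ : Rˣ) : R))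
    (by
      intro x y h
      cases h with
      | mul_inv j h => simp
      | inv_mul j h => simp
      | comm j k hj hk => simp
      | _ => omega)

/-- The one-dimensional Jordan block with eigenvalue `i`, an `H_1^aff`-module. -/
def J1 (q : Rˣ) (i : Mu q) : ModuleCat.{u} (AffHecke q 1) :=
  (ModuleCat.restrictScalars (chi q i).toRingHom).obj (ModuleCat.of R R)

end Affine

/-! ### The cyclotomic Hecke algebra -/

section Murphy

variable {R A : Type u} [Field R] [Ring A] [Algebra R A]

/-- The elements `q^{-k} t_{k-1} ⋯ t_0 t₀ t_0 ⋯ t_{k-1}`. -/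
def murphy (q : Rˣ) (t₀ : A) (t : ℕ → A) : ℕ → A
  | 0 => t₀
  | k + 1 => ((q⁻¹ : Rˣ) : R) • (t k * murphy q t₀ t k * t k)

variable {q : Rˣ} {t₀ : A} {t : ℕ → A} {n : ℕ}

theorem murphy_commute_of_lt (hz : ∀ i, 1 ≤ i → i + 1 < n → Commute t₀ (t i))
    (hfar : ∀ i j, i + 1 < j → j + 1 < n → Commute (t i) (t j)) (i : ℕ) (hi : i + 1 < n) :
    ∀ j, j < i → Commute (t i) (murphy q t₀ t j) := by
  intro j
  induction j with
  | zero => intro h; exact (hz i h hi).symm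
  | succ j ih =>
    intro h
    have h1 := (hfar j i h hi).symm
    exact ((h1.mul_right (ih (by omega))).mul_right h1).smul_right _

theorem murphy_commute_of_gt (hz : ∀ i, 1 ≤ i → i + 1 < n → Commute t₀ (t i))
    (hfar : ∀ i j, i + 1 < j → j + 1 < n → Commute (t i) (t j))
    (hbraid : ∀ i, i + 2 < n → t i * t (i + 1) * t i = t (i + 1) * t i * t (i + 1)) (i : ℕ) :
    ∀ j, i + 1 < j → j < n → Commute (t i) (murphy q t₀ t j) := by
  intro j hj
  induction j, hj using Nat.le_induction with
  | base =>
    intro h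
    have hb := hbraid i h
    have hc : Commute (t (i + 1)) (murphy q t₀ t i) :=
      murphy_commute_of_lt hz hfar (i + 1) h i (by omega)
    change Commute (t i) (_ • (t (i + 1) * (_ • (t i * murphy q t₀ t i * t i)) * t (i + 1)))
    rw [mul_smul_comm, smul_mul_assoc]
    refine Commute.smul_right (Commute.smul_right ?_ _) _
    set a := t i
    set b := t (i + 1)
    set x := murphy q t₀ t i
    change a * (b * (a * x * a) * b) = b * (a * x * a) * b * a
    calc a * (b * (a * x * a) * b) = (a * b * a) * x * a * b := by simp only [mul_assoc]
      _ = b * a * (b * x) * a * b := by rw [hb]; simp only [mul_assoc]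
      _ = b * a * x * (b * a * b) := by rw [hc.eq]; simp only [mul_assoc]
      _ = b * (a * x * a) * b * a := by rw [← hb]; simp only [mul_assoc]
  | succ j hj ih =>
    intro h
    have h1 := hfar i j hj h
    exact ((h1.mul_right (ih (by omega))).mul_right h1).smul_right _

theorem murphy_commute_succ (hz : ∀ i, 1 ≤ i → i + 1 < n → Commute t₀ (t i))
    (hfar : ∀ i j, i + 1 < j → j + 1 < n → Commute (t i) (t j))
    (hbraid : ∀ i, i + 2 < n → t i * t (i + 1) * t i = t (i + 1) * t i * t (i + 1))
    (hfour : 1 < n → t₀ * t 0 * t₀ * t 0 = t 0 * t₀ * t 0 * t₀) :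
    ∀ j, j + 1 < n → murphy q t₀ t j * t j * murphy q t₀ t j * t j =
      t j * murphy q t₀ t j * t j * murphy q t₀ t j := by
  intro j
  induction j with
  | zero => exact hfour
  | succ j ih =>
    intro h
    have hI := ih (by omega)
    have hb := hbraid j h
    have hc : t (j + 1) * murphy q t₀ t j = murphy q t₀ t j * t (j + 1) :=
      (murphy_commute_of_lt hz hfar (j + 1) h j (by omega)).eq
    simp only [murphy, mul_smul_comm, smul_mul_assoc]
    congr 2
    set a := t j
    set b := t (j + 1)
    set x := murphy q t₀ t j
    calc a * x * a * b * (a * x * a) * b = a * x * (a * b * a) * x * a * b := by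
          simp only [mul_assoc]
      _ = a * (x * b) * a * (b * x) * a * b := by rw [hb]; simp only [mul_assoc]
      _ = a * b * x * a * x * (b * a * b) := by rw [← hc, hc]; simp only [mul_assoc]; simp only [← mul_assoc, hc]
      _ = a * b * (x * a * x * a) * b * a := by rw [← hb]; simp only [mul_assoc]
      _ = a * b * a * x * a * (x * b) * a := by rw [hI]; simp only [mul_assoc]
      _ = b * a * (b * x) * (a * b * x * a) := by rw [hb, ← hc]; simp only [mul_assoc]
      _ = b * a * x * (b * a * b) * x * a := by rw [hc]; simp only [mul_assoc]
      _ = b * (a * x * a) * b * (a * x * a) := by rw [← hb]; simp only [mul_assoc]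

theorem murphy_commute (hz : ∀ i, 1 ≤ i → i + 1 < n → Commute t₀ (t i))
    (hfar : ∀ i j, i + 1 < j → j + 1 < n → Commute (t i) (t j))
    (hbraid : ∀ i, i + 2 < n → t i * t (i + 1) * t i = t (i + 1) * t i * t (i + 1))
    (hfour : 1 < n → t₀ * t 0 * t₀ * t 0 = t 0 * t₀ * t 0 * t₀) (j : ℕ) :
    ∀ k, j ≤ k → k < n → Commute (murphy q t₀ t j) (murphy q t₀ t k) := by
  intro k hk
  induction k, hk using Nat.le_induction with
  | base => intro _; exact Commute.refl _
  | succ k hk ih =>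
    intro h
    refine Commute.smul_right ?_ _
    rcases hk.eq_or_lt with rfl | hlt
    · have := murphy_commute_succ (q := q) hz hfar hbraid hfour j h
      change _ * (_ * _ * _) = _ * _ * _ * _
      simpa only [mul_assoc] using this
    · have h1 := (murphy_commute_of_lt (q := q) hz hfar k h j hlt).symm
      exact (h1.mul_right (ih (by omega))).mul_right h1

theorem isUnit_murphy (h0 : IsUnit t₀) (ht : ∀ i, i + 1 < n → IsUnit (t i)) :
    ∀ j, j < n → IsUnit (murphy q t₀ t j) := by
  intro j
  induction j with
  | zero => exact fun _ => h0
  | succ j ih =>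
    intro h
    have := ((ht j h).mul (ih (by omega))).mul (ht j h)
    rw [murphy, ← Units.smul_def]
    exact this.smul _

theorem isUnit_of_quad {s : A} (h : (s + 1) * (s - algebraMap R A (q : R)) = 0) : IsUnit s := by
  have hq : algebraMap R A ((q⁻¹ : Rˣ) : R) * algebraMap R A (q : R) = 1 := by
    rw [← map_mul, Units.inv_mul, map_one]
  have hc : s * algebraMap R A (q : R) = algebraMap R A (q : R) * s :=
    (Algebra.commutes _ _).symm
  have hc' : s * algebraMap R A ((q⁻¹ : Rˣ) : R) = algebraMap R A ((q⁻¹ : Rˣ) : R) * s :=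
    (Algebra.commutes _ _).symm
  have h1 : s * (s + 1 - algebraMap R A (q : R)) = algebraMap R A (q : R) := by
    rw [← sub_eq_zero, ← h]; noncomm_ring
  have h2 : (s + 1 - algebraMap R A (q : R)) * s = algebraMap R A (q : R) := by
    refine Eq.trans ?_ h1
    rw [sub_mul, mul_sub, hc, add_mul, mul_add, one_mul, mul_one]
  refine ⟨⟨s, algebraMap R A ((q⁻¹ : Rˣ) : R) * (s + 1 - algebraMap R A (q : R)), ?_, ?_⟩, rfl⟩
  · rw [← mul_assoc, hc', mul_assoc, h1, hq]
  · rw [mul_assoc, h2, hq]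

theorem isUnit_of_aeval {s : A} {p : Polynomial R} (hp : p.coeff 0 ≠ 0)
    (h : Polynomial.aeval s p = 0) : IsUnit s := by
  have h1 := h
  rw [← Polynomial.divX_mul_X_add p] at h1
  have hu : IsUnit (algebraMap R A (-(p.coeff 0))) := (neg_ne_zero.mpr hp).isUnit.map _
  have h2 : Polynomial.aeval s p.divX * s = algebraMap R A (-(p.coeff 0)) := by
    rw [map_neg, ← sub_eq_zero, sub_neg_eq_add, ← h1]
    simp
  have hc : Commute s (Polynomial.aeval s p.divX) := by
    have := Polynomial.X_mul (p := p.divX)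
    have := congrArg (Polynomial.aeval s) this
    rw [map_mul, map_mul, Polynomial.aeval_X] at this
    exact this
  have h3 : IsUnit (s * Polynomial.aeval s p.divX) := by rw [hc.eq, h2]; exact hu
  exact ((Commute.isUnit_mul_iff hc).mp h3).1

end Murphy

section Cyclotomic

variable {R : Type u} [Field R]

/-- The polynomial `∏_{a ∈ μ_q} (x - a)^{λ_a}`. -/
def cycPoly (q : Rˣ) (lam : Mu q →₀ ℕ) : Polynomial R :=
  lam.prod fun a k => (Polynomial.X - Polynomial.C ((a : Rˣ) : R)) ^ k

theorem cycPoly_coeff_zero (q : Rˣ) (lam : Mu q →₀ ℕ) : (cycPoly q lam).coeff 0 ≠ 0 := by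
  rw [Polynomial.coeff_zero_eq_eval_zero, cycPoly, Finsupp.prod, Polynomial.eval_prod]
  refine Finset.prod_ne_zero_iff.mpr fun a _ => ?_
  simp

/-- Generators of the cyclotomic Hecke algebra: `T0` is the generator `T_0`, present as soon as
`n ≥ 1`, and `T i` is the generator usually written `T_{i+1}`. -/
inductive CycGen (n : ℕ) : Type
  | T0 (h : 0 < n) : CycGen n
  | T (i : ℕ) (h : i + 1 < n) : CycGen n

open CycGen in
/-- The Ariki-Koike relations. -/
inductive CycRel (q : Rˣ) (lam : Mu q →₀ ℕ) (n : ℕ) :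
    FreeAlgebra R (CycGen n) → FreeAlgebra R (CycGen n) → Prop
  | poly (h : 0 < n) : CycRel q lam n
      (Polynomial.aeval (FreeAlgebra.ι R (T0 h)) (cycPoly q lam)) 0
  | four (h : 0 < n) (h' : 0 + 1 < n) : CycRel q lam n
      (FreeAlgebra.ι R (T0 h) * FreeAlgebra.ι R (T 0 h') *
        FreeAlgebra.ι R (T0 h) * FreeAlgebra.ι R (T 0 h'))
      (FreeAlgebra.ι R (T 0 h') * FreeAlgebra.ι R (T0 h) *
        FreeAlgebra.ι R (T 0 h') * FreeAlgebra.ι R (T0 h))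
  | far_zero (i : ℕ) (h : 0 < n) (hi : i + 1 < n) (hi' : 1 ≤ i) : CycRel q lam n
      (FreeAlgebra.ι R (T0 h) * FreeAlgebra.ι R (T i hi))
      (FreeAlgebra.ι R (T i hi) * FreeAlgebra.ι R (T0 h))
  | braid (i : ℕ) (h : i + 1 < n) (h' : i + 1 + 1 < n) : CycRel q lam n
      (FreeAlgebra.ι R (T i h) * FreeAlgebra.ι R (T (i + 1) h') * FreeAlgebra.ι R (T i h))
      (FreeAlgebra.ι R (T (i + 1) h') * FreeAlgebra.ι R (T i h) * FreeAlgebra.ι R (T (i + 1) h'))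
  | far (i j : ℕ) (hi : i + 1 < n) (hj : j + 1 < n) (hij : i + 1 < j) : CycRel q lam n
      (FreeAlgebra.ι R (T i hi) * FreeAlgebra.ι R (T j hj))
      (FreeAlgebra.ι R (T j hj) * FreeAlgebra.ι R (T i hi))
  | quad (i : ℕ) (h : i + 1 < n) : CycRel q lam n
      ((FreeAlgebra.ι R (T i h) + 1) * (FreeAlgebra.ι R (T i h) - algebraMap R _ (q : R))) 0

/-- The cyclotomic Hecke algebra (Ariki-Koike algebra) `H_n^λ`; `H_0^λ = R`. -/
def CycHecke (q : Rˣ) (lam : Mu q →₀ ℕ) (n : ℕ) : Type u := RingQuot (CycRel q lam n)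

instance (q : Rˣ) (lam : Mu q →₀ ℕ) (n : ℕ) : Ring (CycHecke q lam n) :=
  inferInstanceAs (Ring (RingQuot (CycRel q lam n)))

instance (q : Rˣ) (lam : Mu q →₀ ℕ) (n : ℕ) : Algebra R (CycHecke q lam n) :=
  inferInstanceAs (Algebra R (RingQuot (CycRel q lam n)))

namespace CycHecke

/-- The quotient map from the free algebra. -/
def mk (q : Rˣ) (lam : Mu q →₀ ℕ) (n : ℕ) : FreeAlgebra R (CycGen n) →ₐ[R] CycHecke q lam n :=
  RingQuot.mkAlgHom R (CycRel q lam n)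

/-- The image of a generator. -/
def gen (q : Rˣ) (lam : Mu q →₀ ℕ) {n : ℕ} (g : CycGen n) : CycHecke q lam n :=
  mk q lam n (FreeAlgebra.ι R g)

theorem mk_rel (q : Rˣ) (lam : Mu q →₀ ℕ) {n : ℕ} {x y : FreeAlgebra R (CycGen n)}
    (h : CycRel q lam n x y) : mk q lam n x = mk q lam n y :=
  RingQuot.mkAlgHom_rel R h

/-- The homomorphism given by images of the generators that satisfy the relations. -/
def lift (q : Rˣ) (lam : Mu q →₀ ℕ) {n : ℕ} {A : Type u} [Ring A] [Algebra R A] (f : CycGen n → A)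
    (h : ∀ ⦃x y⦄, CycRel q lam n x y → FreeAlgebra.lift R f x = FreeAlgebra.lift R f y) :
    CycHecke q lam n →ₐ[R] A :=
  RingQuot.liftAlgHom R ⟨FreeAlgebra.lift R f, h⟩

theorem lift_gen (q : Rˣ) (lam : Mu q →₀ ℕ) {n : ℕ} {A : Type u} [Ring A] [Algebra R A]
    (f : CycGen n → A)
    (h : ∀ ⦃x y⦄, CycRel q lam n x y → FreeAlgebra.lift R f x = FreeAlgebra.lift R f y)
    (g : CycGen n) : lift q lam f h (gen q lam g) = f g := by
  have := RingQuot.liftAlgHom_mkAlgHom_apply R (FreeAlgebra.lift R f) h (FreeAlgebra.ι R g)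
  rw [FreeAlgebra.lift_ι_apply] at this
  exact this

theorem eq_top (q : Rˣ) (lam : Mu q →₀ ℕ) {n : ℕ} (S : Subalgebra R (CycHecke q lam n))
    (h : ∀ g, gen q lam g ∈ S) : S = ⊤ := by
  rw [eq_top_iff]
  intro a _
  obtain ⟨x, rfl⟩ : ∃ x, mk q lam n x = a :=
    RingQuot.mkAlgHom_surjective R (CycRel q lam n) a
  induction x using FreeAlgebra.induction with
  | grade0 r => rw [AlgHom.commutes]; exact S.algebraMap_mem r
  | grade1 g => exact h g
  | mul x y hx hy => rw [map_mul]; exact S.mul_mem (hx trivial) (hy trivial)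
  | add x y hx hy => rw [map_add]; exact S.add_mem (hx trivial) (hy trivial)

/-- The homomorphism `H_n^λ → H_{n+1}^λ`, `T_i ↦ T_i`. -/
def incl (q : Rˣ) (lam : Mu q →₀ ℕ) (n : ℕ) : CycHecke q lam n →ₐ[R] CycHecke q lam (n + 1) :=
  lift q lam
    (fun g => match g with
      | .T0 _ => gen q lam (.T0 n.succ_pos)
      | .T i h => gen q lam (.T i (h.trans n.lt_succ_self)))
    (by
      have key : ∀ {x y : FreeAlgebra R (CycGen (n + 1))}, CycRel q lam (n + 1) x y →
        mk q lam (n + 1) x = mk q lam (n + 1) y := fun h => mk_rel q lam h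
      intro x y h
      cases h with
      | poly h =>
        simpa [gen, ← Polynomial.aeval_algHom_apply]
          using key (.poly n.succ_pos)
      | four h h' =>
        simpa [gen] using key (.four n.succ_pos (h'.trans n.lt_succ_self))
      | far_zero i h hi hi' =>
        simpa [gen] using key (.far_zero i n.succ_pos (hi.trans n.lt_succ_self) hi')
      | braid i h h' =>
        simpa [gen] using key (.braid i (h.trans n.lt_succ_self) (h'.trans n.lt_succ_self))
      | far i j hi hj hij =>
        simpa [gen] using
          key (.far i j (hi.trans n.lt_succ_self) (hj.trans n.lt_succ_self) hij)
      | quad i h => simpa [gen] using key (.quad i (h.trans n.lt_succ_self)))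

/-- `T_0`, with the value `0` if `n = 0`. -/
def t0 (q : Rˣ) (lam : Mu q →₀ ℕ) (n : ℕ) : CycHecke q lam n :=
  if h : 0 < n then gen q lam (.T0 h) else 0

/-- The generator `T i`, with the value `0` out of range. -/
def t (q : Rˣ) (lam : Mu q →₀ ℕ) (n : ℕ) (i : ℕ) : CycHecke q lam n :=
  if h : i + 1 < n then gen q lam (.T i h) else 0

/-- The element `q^{-j} T_j ⋯ T_1 T_0 T_1 ⋯ T_j` (the image of `X_{j+1}`). -/
def jm (q : Rˣ) (lam : Mu q →₀ ℕ) (n : ℕ) (j : ℕ) : CycHecke q lam n :=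
  murphy q (t0 q lam n) (t q lam n) j

section

variable (q : Rˣ) (lam : Mu q →₀ ℕ) (n : ℕ)

theorem t_comm_zero (i : ℕ) (h1 : 1 ≤ i) (hi : i + 1 < n) :
    Commute (t0 q lam n) (t q lam n i) := by
  have h0 : 0 < n := by omega
  have := mk_rel q lam (CycRel.far_zero i h0 hi h1)
  rw [t0, t, dif_pos h0, dif_pos hi]
  rw [map_mul, map_mul] at this
  exact this

theorem t_far (i j : ℕ) (hij : i + 1 < j) (hj : j + 1 < n) :
    Commute (t q lam n i) (t q lam n j) := by
  have hi : i + 1 < n := by omega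
  have := mk_rel q lam (CycRel.far i j hi hj hij)
  rw [t, t, dif_pos hi, dif_pos hj]
  rw [map_mul, map_mul] at this
  exact this

theorem t_braid (i : ℕ) (h : i + 2 < n) :
    t q lam n i * t q lam n (i + 1) * t q lam n i =
      t q lam n (i + 1) * t q lam n i * t q lam n (i + 1) := by
  have hi : i + 1 < n := by omega
  have := mk_rel q lam (CycRel.braid i hi h)
  rw [t, t, dif_pos hi, dif_pos h]
  simpa [gen] using this

theorem t_four (h : 1 < n) :
    t0 q lam n * t q lam n 0 * t0 q lam n * t q lam n 0 =
      t q lam n 0 * t0 q lam n * t q lam n 0 * t0 q lam n := by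
  have h0 : 0 < n := by omega
  have := mk_rel q lam (CycRel.four h0 h)
  rw [t, t0, dif_pos h0, dif_pos h]
  simpa [gen] using this

theorem t_quad (i : ℕ) (h : i + 1 < n) :
    (t q lam n i + 1) * (t q lam n i - algebraMap R _ (q : R)) = 0 := by
  have := mk_rel q lam (CycRel.quad i h)
  rw [t, dif_pos h]
  simpa [gen] using this

theorem isUnit_jm (j : ℕ) (h : j < n) : IsUnit (jm q lam n j) := by
  refine isUnit_murphy (n := n) ?_ (fun i hi => isUnit_of_quad (t_quad q lam n i hi)) j h
  have h0 : 0 < n := by omega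
  refine isUnit_of_aeval (cycPoly_coeff_zero q lam) ?_
  have := mk_rel q lam (CycRel.poly (q := q) (lam := lam) h0)
  rw [t0, dif_pos h0, gen, Polynomial.aeval_algHom_apply, this, map_zero]

theorem jm_commute (j k : ℕ) (hj : j < n) (hk : k < n) :
    Commute (jm q lam n j) (jm q lam n k) := by
  have key := fun j k => murphy_commute (q := q) (n := n) (t_comm_zero q lam n) (t_far q lam n)
    (t_braid q lam n) (t_four q lam n) j k
  rcases le_total j k with h | h
  · exact key j k h hk
  · exact (key k j h hj).symm

theorem t_mul_jm_mul_t (i : ℕ) :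
    t q lam n i * jm q lam n i * t q lam n i = (q : R) • jm q lam n (i + 1) := by
  rw [jm, jm, murphy, smul_smul, Units.mul_inv, one_smul]

theorem t_commute_jm (i j : ℕ) (hi : i + 1 < n) (hj : j < n) (h : j ≠ i) (h' : j ≠ i + 1) :
    Commute (t q lam n i) (jm q lam n j) := by
  rcases lt_or_gt_of_ne h with h | h
  · exact murphy_commute_of_lt (t_comm_zero q lam n) (t_far q lam n) i hi j h
  · exact murphy_commute_of_gt (t_comm_zero q lam n) (t_far q lam n) (t_braid q lam n) i j
      (by omega) hj

end

/-- The evaluation homomorphism `ev : H_n^aff → H_n^λ`, `T_i ↦ T_i`, `X_1 ↦ T_0`,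
`X_i ↦ q^{1-i} T_{i-1} ⋯ T_1 T_0 T_1 ⋯ T_{i-1}`. -/
def ev (q : Rˣ) (lam : Mu q →₀ ℕ) (n : ℕ) : AffHecke q n →ₐ[R] CycHecke q lam n :=
  AffHecke.lift q
    (fun g => match g with
      | .T i _ => t q lam n i
      | .X j _ => jm q lam n j
      | .Xinv j _ => Ring.inverse (jm q lam n j))
    (by
      intro x y h
      cases h with
      | braid i h h' => simpa using t_braid q lam n i h'
      | far i j hi hj hij => simpa using (t_far q lam n i j hij hj).eq
      | quad i h => simpa using t_quad q lam n i h
      | mul_inv j h => simpa using Ring.mul_inverse_cancel _ (isUnit_jm q lam n j h)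
      | inv_mul j h => simpa using Ring.inverse_mul_cancel _ (isUnit_jm q lam n j h)
      | comm j k hj hk => simpa using (jm_commute q lam n j k hj hk).eq
      | TXT i h h' => simpa using t_mul_jm_mul_t q lam n i
      | TX i j hi hj h h' => simpa using (t_commute_jm q lam n i j hi hj h h').eq)

theorem ev_surjective (q : Rˣ) (lam : Mu q →₀ ℕ) (n : ℕ) : Function.Surjective (ev q lam n) := by
  rw [← AlgHom.range_eq_top]
  refine eq_top q lam _ fun g => ?_
  cases g with
  | T0 h =>
    refine ⟨AffHecke.gen q (.X 0 h), ?_⟩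
    change ev q lam n _ = _
    rw [ev, AffHecke.lift_gen]
    simp [jm, murphy, t0, h]
  | T i h =>
    refine ⟨AffHecke.gen q (.T i h), ?_⟩
    change ev q lam n _ = _
    rw [ev, AffHecke.lift_gen]
    simp [t, h]

theorem incl_ev (q : Rˣ) (lam : Mu q →₀ ℕ) (n : ℕ) (a : AffHecke q n) :
    incl q lam n (ev q lam n a) = ev q lam (n + 1) (AffHecke.incl q n a) := by
  have ht : ∀ i, i + 1 < n → incl q lam n (t q lam n i) = t q lam (n + 1) i := by
    intro i h
    rw [t, t, dif_pos h, dif_pos (h.trans n.lt_succ_self), incl, lift_gen]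
  have hj : ∀ j, j < n → incl q lam n (jm q lam n j) = jm q lam (n + 1) j := by
    intro j
    induction j with
    | zero =>
      intro h
      simp only [jm, murphy]
      rw [t0, t0, dif_pos h, dif_pos n.succ_pos, incl, lift_gen]
    | succ j ih =>
      intro h
      have := ih (by omega)
      simp only [jm, murphy] at this ⊢
      rw [map_smul, map_mul, map_mul, this, ht j h]
  have : a ∈ AlgHom.equalizer ((incl q lam n).comp (ev q lam n))
      ((ev q lam (n + 1)).comp (AffHecke.incl q n)) := by
    rw [AffHecke.eq_top q (AlgHom.equalizer _ _)]
    · trivial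
    intro g
    rw [AlgHom.mem_equalizer, AlgHom.comp_apply, AlgHom.comp_apply, AffHecke.incl,
      AffHecke.lift_gen, ev, ev, AffHecke.lift_gen]
    cases g with
    | T i h => rw [AffHecke.lift_gen]; exact ht i h
    | X j h => rw [AffHecke.lift_gen]; exact hj j h
    | Xinv j h =>
      rw [AffHecke.lift_gen]
      change incl q lam n (Ring.inverse (jm q lam n j)) = Ring.inverse (jm q lam (n + 1) j)
      rw [← hj j h]
      have hu := isUnit_jm q lam n j h
      refine (hu.map (incl q lam n)).mul_left_cancel ?_
      rw [← map_mul, Ring.mul_inverse_cancel _ hu, map_one,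
        Ring.mul_inverse_cancel _ (hu.map (incl q lam n))]
  exact this

end CycHecke

end Cyclotomic

/-! ### Affine and cyclotomic Hecke algebras together, and the crystal operators -/

section Crystal

variable {R : Type u} [Field R]

/-- The index `λ`: either the symbol `aff`, or a finitely supported function `λ : μ_q → ℕ`. -/
inductive Level (q : Rˣ) : Type u
  | aff : Level q
  | cyc (lam : Mu q →₀ ℕ) : Level q

/-- `H_n^λ`, where `λ` is affine or cyclotomic. -/
def Hecke (q : Rˣ) : Level q → ℕ → Type u
  | .aff, n => AffHecke q n
  | .cyc lam, n => CycHecke q lam n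

instance (q : Rˣ) : (L : Level q) → (n : ℕ) → Ring (Hecke q L n)
  | .aff, n => inferInstanceAs (Ring (AffHecke q n))
  | .cyc lam, n => inferInstanceAs (Ring (CycHecke q lam n))

instance (q : Rˣ) : (L : Level q) → (n : ℕ) → Algebra R (Hecke q L n)
  | .aff, n => inferInstanceAs (Algebra R (AffHecke q n))
  | .cyc lam, n => inferInstanceAs (Algebra R (CycHecke q lam n))

/-- `ev : H_n^aff → H_n^λ`, the identity if `λ` is affine. -/
def ev (q : Rˣ) : (L : Level q) → (n : ℕ) → AffHecke q n →ₐ[R] Hecke q L n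
  | .aff, n => AlgHom.id R (AffHecke q n)
  | .cyc lam, n => CycHecke.ev q lam n

/-- The homomorphism `H_n^λ → H_{n+1}^λ`. -/
def incl (q : Rˣ) : (L : Level q) → (n : ℕ) → Hecke q L n →ₐ[R] Hecke q L (n + 1)
  | .aff, n => AffHecke.incl q n
  | .cyc lam, n => CycHecke.incl q lam n

theorem ev_surjective (q : Rˣ) : (L : Level q) → (n : ℕ) → Function.Surjective (ev q L n)
  | .aff, _ => Function.surjective_id
  | .cyc lam, n => CycHecke.ev_surjective q lam n

theorem incl_ev (q : Rˣ) : (L : Level q) → (n : ℕ) → (a : AffHecke q n) →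
    incl q L n (ev q L n a) = ev q L (n + 1) (AffHecke.incl q n a)
  | .aff, _, _ => rfl
  | .cyc lam, n, a => CycHecke.incl_ev q lam n a

theorem incl_commute_last (q : Rˣ) (L : Level q) (n : ℕ) (a : Hecke q L n) (b : AffHecke q 1) :
    Commute (incl q L n a) (ev q L (n + 1) (AffHecke.last q n b)) := by
  obtain ⟨a, rfl⟩ := ev_surjective q L n a
  rw [incl_ev]
  exact (AffHecke.incl_last_commute q n a b).map (ev q L (n + 1))

/-- `ev^* M`. -/
def evPull (q : Rˣ) (L : Level q) {n : ℕ} (M : ModuleCat.{u} (Hecke q L n)) :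
    ModuleCat.{u} (AffHecke q n) :=
  (ModuleCat.restrictScalars (ev q L n).toRingHom).obj M

/-- `pr_λ N = N / I_λ N`, where `I_λ = ker ev`, as a module over `H_n^λ = H_n^aff / I_λ`. -/
def pr (q : Rˣ) (L : Level q) {n : ℕ} (N : ModuleCat.{u} (AffHecke q n)) :
    ModuleCat.{u} (Hecke q L n) :=
  modKer (ev q L n).toRingHom (ev_surjective q L n) N

/-- `f̃_i M = pr_λ cosoc Ind_{H_n^aff ⊗ H_1^aff}^{H_{n+1}^aff} (ev^* M ⊠ i J_1)`. -/
def fTilde (q : Rˣ) (L : Level q) {n : ℕ} (i : Mu q) (M : ModuleCat.{u} (Hecke q L n)) :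
    ModuleCat.{u} (Hecke q L (n + 1)) :=
  pr q L (cosoc (ind (AffHecke.levi q n).toRingHom (box R (evPull q L M) (J1 q i))))

/-- The restriction of `M` to the last place `H_1^aff = R[X_{n+1}^{±1}]`; it also carries the
commuting action of `H_n^λ` on the first `n` places. -/
def LastRes (q : Rˣ) (L : Level q) {n : ℕ} (M : ModuleCat.{u} (Hecke q L (n + 1))) : Type u := M

instance (q : Rˣ) (L : Level q) {n : ℕ} (M : ModuleCat.{u} (Hecke q L (n + 1))) :
    AddCommGroup (LastRes q L M) := inferInstanceAs (AddCommGroup M)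

instance (q : Rˣ) (L : Level q) {n : ℕ} (M : ModuleCat.{u} (Hecke q L (n + 1))) :
    Module (AffHecke q 1) (LastRes q L M) :=
  Module.compHom M ((ev q L (n + 1)).comp (AffHecke.last q n)).toRingHom

instance (q : Rˣ) (L : Level q) {n : ℕ} (M : ModuleCat.{u} (Hecke q L (n + 1))) :
    Module (Hecke q L n) (LastRes q L M) :=
  Module.compHom M (incl q L n).toRingHom

instance (q : Rˣ) (L : Level q) {n : ℕ} (M : ModuleCat.{u} (Hecke q L (n + 1))) :
    SMulCommClass (AffHecke q 1) (Hecke q L n) (LastRes q L M) where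
  smul_comm b a m := by
    have key : ∀ m : M, ev q L (n + 1) (AffHecke.last q n b) • (incl q L n a • m) =
        incl q L n a • (ev q L (n + 1) (AffHecke.last q n b) • m) := by
      intro m
      rw [← mul_smul, ← mul_smul, (incl_commute_last q L n a b).eq]
    exact key m

/-- `ẽ_i M = soc Hom_{R[X_{n+1}^{±1}]} (i J_1, Res M)`, for an `H_{n+1}^λ`-module `M`. The action of
`H_n^aff` on the space of homomorphisms factors through the surjection onto `H_n^λ`. -/
def eTilde (q : Rˣ) (L : Level q) {n : ℕ} (i : Mu q) (M : ModuleCat.{u} (Hecke q L (n + 1))) :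
    ModuleCat.{u} (Hecke q L n) :=
  ModuleCat.of (Hecke q L n) (soc (Hecke q L n) (J1 q i →ₗ[AffHecke q 1] LastRes q L M))

/-- The category `Rep_q H_n^aff`: finite-dimensional modules on which the only eigenvalues of `X_1`
are powers of `q`, i.e. which are annihilated by some product `∏ (X_1 - a)^{λ_a}`, `a ∈ μ_q`. -/
def InRepQ (q : Rˣ) {n : ℕ} (N : ModuleCat.{u} (AffHecke q n)) : Prop :=
  (letI : Module R N := ModuleCat.moduleOfAlgebraModule N
   Module.Finite R N) ∧
  ∃ lam : Mu q →₀ ℕ, ∀ (h : 0 < n) (m : N),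
    Polynomial.aeval (AffHecke.X q 0 h) (cycPoly q lam) • m = 0

/-- The irreducible `H_n^λ`-modules. -/
def Irr (q : Rˣ) (L : Level q) (n : ℕ) : Type (u + 1) :=
  {M : ModuleCat.{u} (Hecke q L n) // IsSimpleModule (Hecke q L n) M}

/-- Isomorphism of irreducible modules. -/
instance irrSetoid (q : Rˣ) (L : Level q) (n : ℕ) : Setoid (Irr q L n) where
  r M N := Nonempty (M.1 ≃ₗ[Hecke q L n] N.1)
  iseqv := ⟨fun _ => ⟨.refl _ _⟩, fun ⟨e⟩ => ⟨e.symm⟩, fun ⟨e⟩ ⟨e'⟩ => ⟨e.trans e'⟩⟩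

/-- `B_λ`: the disjoint union over `n ≥ 0` of the sets of isomorphism classes of irreducible
`H_n^λ`-modules. -/
def B (q : Rˣ) (L : Level q) : Type (u + 1) := Σ n : ℕ, Quotient (irrSetoid q L n)

/-- The class of an irreducible module in `B_λ`. -/
def cls (q : Rˣ) (L : Level q) {n : ℕ} (M : Irr q L n) : B q L := ⟨n, Quotient.mk _ M⟩

/-- The element `b` of `B_λ ⊔ {0}` is the class of the module `X`: either `X = 0` and `b = 0`, or
`X` is irreducible and `b` is its isomorphism class. -/
def IsClass (q : Rˣ) (L : Level q) {n : ℕ} (X : ModuleCat.{u} (Hecke q L n))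
    (b : Option (B q L)) : Prop :=
  (Subsingleton X ∧ b = none) ∨
    ∃ hX : IsSimpleModule (Hecke q L n) X, b = some (cls q L ⟨X, hX⟩)

end Crystal

/-- A crystal graph with vertex set `V` and colours `I`: partially defined operators `e i`, `f i`
on `V` (`none` is the value `0`) which are partial inverses of each other, so that the edges
`e i b = some b'` and `f i b' = some b` are the same. -/
@[ext] structure CrystalGraph (I V : Type*) where
  /-- the lowering of `b` along its edge coloured `i`, or `none` -/
  e : I → V → Option V
  /-- the raising of `b` along its edge coloured `i`, or `none` -/
  f : I → V → Option V
  e_eq_some_iff : ∀ i b b', e i b = some b' ↔ f i b' = some b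

end HeckeCrystal
end

noncomputable section

namespace HeckeCrystal

/-! ### Commuting operators -/

section Commuting

variable {R V ι : Type*} [Field R] [AddCommGroup V] [Module R V]

/-! Throughout, generators are numbered from 0, so `x n` is the last polynomial generator of rank `n
+ 1`. Everything reduces to one statement about eigenvectors, `mem_of_forall_eigen`.

Let Q be a module over H_{n+1}^aff generated by a finite-dimensional H_n^aff-stable subspace N on
which x_n acts by a nonzero scalar a. Put c_l = t_l ⋯ t_{n-1} and F_l = ∑_{m ≥ l} c_m N (`cyc` and
`tail`). Then F_0 = Q, F_n = N, and every F_l is stable under all x_j. Modulo F_{l+1}, the operator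
x_l acts on c_l N by a, while the other x_j pass through c_l with their index lowered by one if j >
l and unchanged if j < l. Modulo F_{l+2} a correction survives: (x_{l+1} - a) c_l u ≡ c_l (x_l - a)
u + (q - 1) a c_{l+1} u. Because q ≠ 1 and a ≠ 0, this off-diagonal term behaves like a Jordan block
and prevents new simultaneous eigenvectors from appearing outside N. Precisely, if N contains no
nonzero simultaneous a-eigenvector of the last k + 2 generators, then every simultaneous
a-eigenvector in Q of the last k + 1 generators lies in N. Only the spanning property of the c_m N
is used: the sum need not be direct, and V need not embed in the induced module.

Socle: let M be simple and N₁, N₂ two nonzero H_n^aff-stable subspaces of the a-eigenspace of x_n.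
Each generates M. For each choose k maximal such that it contains a nonzero simultaneous eigenvector
of the last k + 1 generators; such a vector for the larger k lies in both subspaces. So any two
nonzero submodules of Hom(iJ_1, Res M) meet, and its socle is simple or zero.

Cosocle: for V simple, the image N of V generates Ind(V ⊠ iJ_1) and meets every proper submodule in
0. If U₁ ≠ U₂ were maximal, write an extremal eigenvector u of N as b + c with b in U₁ and c in U₂.
The class of c modulo U₁ ∩ U₂ is again an eigenvector, hence lies in the image of N, which forces u
= 0. So there is at most one maximal submodule, and the cosocle is simple or zero; passing to N /
(ker ev) N preserves this.

Part (b) is Frobenius reciprocity: a nonzero map from N to the i-eigenspace of X_{n+1} in M is the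
same as a nonzero map from Ind(N ⊠ iJ_1) to M, and the first embeds N as the socle while the second
exhibits M as the simple quotient. Finite-dimensionality of simple affine modules comes from the
Nullstellensatz, the algebra being finite over its commutative Laurent subalgebra. The crystal in
(d) is then formal, since (b) itself makes the operators well defined on classes. -/

theorem commute_aeval {A : Type*} [Ring A] [Algebra R A] {a b : A} (h : Commute a b)
    (p : Polynomial R) : Commute a (Polynomial.aeval b p) := by
  induction p using Polynomial.induction_on' with
  | add p p' hp hp' => rw [map_add]; exact hp.add_right hp'
  | monomial k c =>
    rw [Polynomial.aeval_monomial]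
    exact (Algebra.commute_algebraMap_right c _).mul_right (h.pow_right k)

/-- Vectors annihilated by each of the commuting operators `D r` modulo a stable subspace lift to
vectors on which each `D r` is nilpotent. -/
theorem exists_nilpotent_lift [FiniteDimensional R V] (D : ι → Module.End R V)
    (hD : ∀ r r', Commute (D r) (D r')) (W : Submodule R V) (s : Finset ι)
    (hW : ∀ r ∈ s, ∀ v ∈ W, D r v ∈ W) (v : V) (hv : ∀ r ∈ s, D r v ∈ W) :
    ∃ w, v - w ∈ W ∧ ∀ r ∈ s, ∃ k, (D r ^ k) w = 0 := by
  classical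
  induction s using Finset.induction_on with
  | empty => exact ⟨v, by simp, by simp⟩
  | insert a s ha ih =>
    obtain ⟨w, hw, hn⟩ := ih (fun r hr => hW r (Finset.mem_insert_of_mem hr))
      (fun r hr => hv r (Finset.mem_insert_of_mem hr))
    have hpow : ∀ (p : Polynomial R) (u : V), u ∈ W → Polynomial.aeval (D a) p u ∈ W := by
      intro p u hu
      induction p using Polynomial.induction_on' with
      | add p p' hp hp' => rw [map_add]; exact W.add_mem hp hp'
      | monomial k c =>
        rw [Polynomial.aeval_monomial]
        have : (D a ^ k) u ∈ W := by
          induction k with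
          | zero => exact hu
          | succ k ihk => rw [pow_succ']; exact hW a (Finset.mem_insert_self _ _) _ ihk
        simpa [Module.algebraMap_end_apply] using W.smul_mem c this
    have hDw : D a w ∈ W := by
      have h1 := hW a (Finset.mem_insert_self _ _) _ hw
      have h2 := hv a (Finset.mem_insert_self _ _)
      rw [map_sub] at h1
      simpa using W.sub_mem h2 h1
    -- Fitting decomposition for D_a: with m = X^j g and c = g(0) ≠ 0, the operator c⁻¹ g(D_a) maps
    -- into the kernel of D_a^j. It fixes w modulo W since D_a w lies in W, and it commutes with the
    -- other operators, so the nilpotency already obtained survives.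
    set m := minpoly R (D a)
    have hm0 : m ≠ 0 := minpoly.ne_zero (Algebra.IsIntegral.isIntegral (D a))
    obtain ⟨g, hg, hg'⟩ := Polynomial.exists_eq_pow_rootMultiplicity_mul_and_not_dvd m hm0 0
    rw [map_zero, sub_zero] at hg hg'
    rw [Polynomial.X_dvd_iff] at hg'
    set c := g.coeff 0
    refine ⟨c⁻¹ • Polynomial.aeval (D a) g w, ?_, ?_⟩
    · have h1 : Polynomial.aeval (D a) g w = Polynomial.aeval (D a) g.divX (D a w) + c • w := by
        conv_lhs => rw [← Polynomial.divX_mul_X_add g]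
        simp [c, Module.algebraMap_end_apply]
      have h2 : v - c⁻¹ • Polynomial.aeval (D a) g w =
          (v - w) - c⁻¹ • Polynomial.aeval (D a) g.divX (D a w) := by
        rw [h1, smul_add, smul_smul, inv_mul_cancel₀ hg', one_smul]; abel
      rw [h2]
      exact W.sub_mem hw (W.smul_mem _ (hpow _ _ hDw))
    · intro r hr
      rcases Finset.mem_insert.mp hr with rfl | hr
      · refine ⟨m.rootMultiplicity 0, ?_⟩
        have h3 : Polynomial.aeval (D r) m = 0 := minpoly.aeval R (D r)
        rw [hg, map_mul, map_pow, Polynomial.aeval_X] at h3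
        rw [map_smul, ← Module.End.mul_apply, h3]
        simp
      · obtain ⟨k, hk⟩ := hn r hr
        refine ⟨k, ?_⟩
        have hc : Commute (D r ^ k) (Polynomial.aeval (D a) g) :=
          (commute_aeval (hD r a) g).pow_left k
        rw [map_smul, ← Module.End.mul_apply, hc.eq, Module.End.mul_apply, hk, map_zero, smul_zero]

/-- If commuting operators are nilpotent on a nonzero vector, then they have a common nonzero
vector in their kernels. -/
theorem exists_common_kernel (D : ι → Module.End R V) (hD : ∀ r r', Commute (D r) (D r'))
    (s : Finset ι) (w : V) (hw : w ≠ 0) (hn : ∀ r ∈ s, ∃ k, (D r ^ k) w = 0) :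
    ∃ w', w' ≠ 0 ∧ ∀ r ∈ s, D r w' = 0 := by
  classical
  -- The extra clause keeps kernels already reached: an operator that kills w must still kill the
  -- vector produced by the later steps.
  suffices ∃ w', w' ≠ 0 ∧ (∀ r ∈ s, D r w' = 0) ∧ ∀ r, D r w = 0 → D r w' = 0 by
    obtain ⟨w', h1, h2, -⟩ := this
    exact ⟨w', h1, h2⟩
  induction s using Finset.induction_on generalizing w with
  | empty => exact ⟨w, hw, by simp, fun r h => h⟩
  | insert a s ha ih =>
    have hex := hn a (Finset.mem_insert_self _ _)
    have h0 := Nat.find_spec hex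
    set k := Nat.find hex with hk
    have hk0 : k ≠ 0 := by
      intro h
      rw [h] at h0
      exact hw h0
    -- The last nonzero power of D_a applied to w is killed by D_a; commutation carries over all the
    -- other annihilation conditions.
    have h1 : (D a ^ (k - 1)) w ≠ 0 := Nat.find_min hex (by omega)
    have h2 : D a ((D a ^ (k - 1)) w) = 0 := by
      rw [← Module.End.mul_apply, ← pow_succ', Nat.sub_add_cancel (by omega)]
      exact h0
    have hc : ∀ r j, (D r ^ j) w = 0 → (D r ^ j) ((D a ^ (k - 1)) w) = 0 := by
      intro r j h
      rw [← Module.End.mul_apply, ((hD r a).pow_pow j (k - 1)).eq, Module.End.mul_apply, h,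
        map_zero]
    obtain ⟨w', hw', hs, ht⟩ := ih _ h1 fun r hr => by
      obtain ⟨j, hj⟩ := hn r (Finset.mem_insert_of_mem hr)
      exact ⟨j, hc r j hj⟩
    refine ⟨w', hw', fun r hr => ?_, fun r hr => ht r ?_⟩
    · rcases Finset.mem_insert.mp hr with rfl | hr
      · exact ht _ h2
      · exact hs r hr
    · simpa using hc r 1 (by simpa using hr)

end Commuting

/-! ### Modules generated by an eigenspace of the last polynomial generator -/

section Abstract

set_option linter.unusedSectionVars false

variable {R A : Type*} [Field R] [Ring A] [Algebra R A]

/-- The relations of the affine Hecke algebra of rank `n + 1` for elements `t 0, …, t (n - 1)` and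
`x 0, …, x n` of an algebra. -/
structure AffineRelations (q : Rˣ) (n : ℕ) (t x : ℕ → A) : Prop where
  braid : ∀ i, i + 1 < n → t i * t (i + 1) * t i = t (i + 1) * t i * t (i + 1)
  far : ∀ i j, i + 1 < j → j < n → Commute (t i) (t j)
  quad : ∀ i, i < n → t i * t i = ((q : R) - 1) • t i + (q : R) • 1
  txt : ∀ i, i < n → t i * x i * t i = (q : R) • x (i + 1)
  t_comm_x : ∀ i j, i < n → j ≤ n → j ≠ i → j ≠ i + 1 → Commute (t i) (x j)
  x_comm : ∀ i j, i ≤ n → j ≤ n → Commute (x i) (x j)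

namespace AffineRelations

variable {q : Rˣ} {n : ℕ} {t x : ℕ → A} (h : AffineRelations q n t x)

include h

/-- Multiply t_i x_i t_i = q x_{i+1} by t_i on the right and use the quadratic relation, then cancel
q. The mirror image `x_mul_t` comes from multiplying on the left. -/
theorem x_succ_mul_t (i : ℕ) (hi : i < n) :
    x (i + 1) * t i = t i * x i + ((q : R) - 1) • x (i + 1) := by
  have h1 : (q : R) • (x (i + 1) * t i) =
      (q : R) • (t i * x i + ((q : R) - 1) • x (i + 1)) := by
    rw [← smul_mul_assoc, ← h.txt i hi, mul_assoc, h.quad i hi, mul_add, mul_smul_comm,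
      mul_smul_comm, mul_one, h.txt i hi, smul_add, smul_comm, add_comm]
  have := congrArg (fun y => ((q⁻¹ : Rˣ) : R) • y) h1
  simpa only [smul_smul, Units.inv_mul, one_smul] using this

theorem x_mul_t (i : ℕ) (hi : i < n) :
    x i * t i = t i * x (i + 1) - ((q : R) - 1) • x (i + 1) := by
  have h1 : (q : R) • (x i * t i) =
      (q : R) • (t i * x (i + 1) - ((q : R) - 1) • x (i + 1)) := by
    rw [smul_sub, ← mul_smul_comm (q : R) (t i) (x (i + 1)), ← h.txt i hi, mul_assoc (t i),
      ← mul_assoc (t i) (t i),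
      h.quad i hi, add_mul, smul_mul_assoc, smul_mul_assoc, one_mul, ← mul_assoc, h.txt i hi,
      smul_comm, add_sub_cancel_left]
  have := congrArg (fun y => ((q⁻¹ : Rˣ) : R) • y) h1
  simpa only [smul_smul, Units.inv_mul, one_smul] using this

end AffineRelations

/-- The product `t l * t (l + 1) * ⋯ * t (l + m - 1)`. -/
def chain (t : ℕ → A) : ℕ → ℕ → A
  | _, 0 => 1
  | l, m + 1 => t l * chain t (l + 1) m

/-- The product `t l * t (l + 1) * ⋯ * t (n - 1)`. -/
def cyc (t : ℕ → A) (n l : ℕ) : A := chain t l (n - l)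

theorem cyc_self (t : ℕ → A) (n : ℕ) : cyc t n n = 1 := by
  rw [cyc, Nat.sub_self, chain]

theorem cyc_of_lt (t : ℕ → A) {n l : ℕ} (h : l < n) : cyc t n l = t l * cyc t n (l + 1) := by
  rw [cyc, show n - l = (n - (l + 1)) + 1 by omega, chain, cyc]

theorem commute_cyc {t : ℕ → A} {n : ℕ} {a : A} (l : ℕ) (hl : l ≤ n)
    (h : ∀ r, l ≤ r → r < n → Commute a (t r)) : Commute a (cyc t n l) := by
  induction hl using Nat.decreasingInduction with
  | self => rw [cyc_self]; exact Commute.one_right a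
  | of_succ l hl ih =>
    rw [cyc_of_lt t hl]
    exact (h l le_rfl hl).mul_right (ih fun r hr => h r (by omega))

/-- Conjugation by the Coxeter-type product c_l shifts indices: t_{i+1} c_l = c_l t_i. The braid
relation at l = i is the base, and the factors further to the left commute with t_{i+1}. -/
theorem mul_cyc {t : ℕ → A} {n : ℕ}
    (braid : ∀ i, i + 1 < n → t i * t (i + 1) * t i = t (i + 1) * t i * t (i + 1))
    (far : ∀ i j, i + 1 < j → j < n → Commute (t i) (t j)) (i : ℕ) (hi : i + 1 < n) (l : ℕ)
    (hl : l ≤ i) : t (i + 1) * cyc t n l = cyc t n l * t i := by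
  induction hl using Nat.decreasingInduction with
  | self =>
    have hc : Commute (t i) (cyc t n (i + 2)) :=
      commute_cyc _ (by omega) fun r hr hr' => far i r (by omega) hr'
    rw [cyc_of_lt t (by omega : i < n), cyc_of_lt t hi, ← mul_assoc, ← mul_assoc, ← braid i hi]
    simp only [mul_assoc]
    rw [hc.eq]
  | of_succ l hl ih =>
    rw [cyc_of_lt t (by omega : l < n), ← mul_assoc, ← (far l (i + 1) (by omega) hi).eq, mul_assoc,
      ih, mul_assoc]

variable {Q : Type*} [AddCommGroup Q] [Module R Q] [Module A Q] [IsScalarTower R A Q]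

/-- A subspace stable under the generators of rank `n` on which `x n` acts by the scalar `a`. -/
structure IsEigenStable (n : ℕ) (t x : ℕ → A) (a : R) (N : Submodule R Q) : Prop where
  t_mem : ∀ i, i + 1 < n → ∀ u ∈ N, t i • u ∈ N
  x_mem : ∀ j, j < n → ∀ u ∈ N, x j • u ∈ N
  x_last : ∀ u ∈ N, x n • u = a • u

/-- The subspace `∑_{l ≤ m ≤ n} t_m ⋯ t_{n-1} N`. -/
def tail (n : ℕ) (t : ℕ → A) (N : Submodule R Q) (l : ℕ) : Submodule R Q :=
  Submodule.span R {y | ∃ m u, l ≤ m ∧ m ≤ n ∧ u ∈ N ∧ y = cyc t n m • u}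

/-! ### The filtration of the module generated by N and the triangular action of the polynomial
generators -/

section Tail

variable {n : ℕ} {t x : ℕ → A} {a : R} {N : Submodule R Q}

theorem cyc_smul_mem_tail {l m : ℕ} (hl : l ≤ m) (hm : m ≤ n) {u : Q} (hu : u ∈ N) :
    cyc t n m • u ∈ tail n t N l :=
  Submodule.subset_span ⟨m, u, hl, hm, hu, rfl⟩

theorem tail_le {l : ℕ} {P : Submodule R Q}
    (h : ∀ m u, l ≤ m → m ≤ n → u ∈ N → cyc t n m • u ∈ P) : tail n t N l ≤ P := by
  refine Submodule.span_le.mpr ?_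
  rintro _ ⟨m, u, h1, h2, h3, rfl⟩
  exact h m u h1 h2 h3

theorem tail_mono {l l' : ℕ} (h : l ≤ l') : tail n t N l' ≤ tail n t N l :=
  tail_le fun _ _ h1 h2 h3 => cyc_smul_mem_tail (h.trans h1) h2 h3

theorem tail_eq_bot {l : ℕ} (h : n < l) : tail n t N l = ⊥ :=
  le_bot_iff.mp <| tail_le fun m u h1 h2 _ => by omega

theorem tail_self : tail n t N n = N := by
  refine le_antisymm (tail_le fun m u h1 h2 h3 => ?_) fun u hu => ?_
  · obtain rfl : m = n := by omega
    rwa [cyc_self, one_smul]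
  · simpa [cyc_self] using cyc_smul_mem_tail (t := t) le_rfl (le_refl n) hu

theorem exists_sub_mem_tail {l : ℕ} {v : Q} (hv : v ∈ tail n t N l) :
    ∃ u ∈ N, v - cyc t n l • u ∈ tail n t N (l + 1) := by
  induction hv using Submodule.span_induction with
  | mem y hy =>
    obtain ⟨m, u, h1, h2, h3, rfl⟩ := hy
    rcases h1.eq_or_lt with rfl | h1
    · exact ⟨u, h3, by rw [sub_self]; exact zero_mem _⟩
    · exact ⟨0, N.zero_mem, by rw [smul_zero, sub_zero]; exact cyc_smul_mem_tail h1 h2 h3⟩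
  | zero => exact ⟨0, N.zero_mem, by simp⟩
  | add y z _ _ hy hz =>
    obtain ⟨u, hu, hu'⟩ := hy
    obtain ⟨w, hw, hw'⟩ := hz
    refine ⟨u + w, N.add_mem hu hw, ?_⟩
    have := add_mem hu' hw'
    rwa [sub_add_sub_comm, ← smul_add] at this
  | smul c y _ hy =>
    obtain ⟨u, hu, hu'⟩ := hy
    refine ⟨c • u, N.smul_mem c hu, ?_⟩
    rw [smul_algebra_smul_comm, ← smul_sub]
    exact Submodule.smul_mem _ c hu'

theorem smul_mem_of_mem_tail {l : ℕ} {P : Submodule R Q} (b : A)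
    (h : ∀ m u, l ≤ m → m ≤ n → u ∈ N → b • cyc t n m • u ∈ P) {v : Q}
    (hv : v ∈ tail n t N l) : b • v ∈ P :=
  tail_le (P := P.comap (Algebra.lsmul R R Q b)) h hv

theorem finiteDimensional_tail [FiniteDimensional R N] (l : ℕ) :
    FiniteDimensional R (tail n t N l) := by
  have : tail n t N l ≤ ⨆ m : Fin (n + 1), N.map (Algebra.lsmul R R Q (cyc t n m)) :=
    tail_le fun m u _ h2 h3 =>
      (le_iSup (fun m : Fin (n + 1) => N.map (Algebra.lsmul R R Q (cyc t n m)))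
        ⟨m, by omega⟩) (Submodule.mem_map_of_mem h3)
  exact Submodule.finiteDimensional_of_le this

variable {q : Rˣ} (h : AffineRelations q n t x) (hN : IsEigenStable n t x a N)

include h

theorem x_smul_cyc_smul (l : ℕ) (hl : l < n) (u : Q) :
    x l • cyc t n l • u = t l • x (l + 1) • cyc t n (l + 1) • u -
      ((q : R) - 1) • x (l + 1) • cyc t n (l + 1) • u := by
  rw [cyc_of_lt t hl, ← mul_smul, ← mul_assoc, h.x_mul_t l hl, sub_mul, sub_smul, mul_assoc,
    smul_mul_assoc, smul_assoc, mul_smul, mul_smul]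

theorem x_succ_smul_cyc_smul (l : ℕ) (hl : l < n) (u : Q) :
    x (l + 1) • cyc t n l • u = cyc t n l • x l • u +
      ((q : R) - 1) • x (l + 1) • cyc t n (l + 1) • u := by
  have hc : Commute (x l) (cyc t n (l + 1)) :=
    commute_cyc _ hl fun r hr hr' => (h.t_comm_x r l hr' hl.le (by omega) (by omega)).symm
  rw [cyc_of_lt t hl, ← mul_smul, ← mul_assoc, h.x_succ_mul_t l hl, add_mul, add_smul, mul_assoc,
    hc.eq, smul_mul_assoc, smul_assoc, mul_smul, mul_smul, mul_smul, mul_smul]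

include hN

theorem t_smul_mem_tail (l : ℕ) {v : Q} (hv : v ∈ tail n t N (l + 2)) :
    t l • v ∈ tail n t N (l + 2) := by
  refine smul_mem_of_mem_tail _ (fun m u h1 h2 h3 => ?_) hv
  have hc : Commute (t l) (cyc t n m) :=
    commute_cyc _ h2 fun r hr hr' => h.far l r (by omega) hr'
  rw [← mul_smul, hc.eq, mul_smul]
  exact cyc_smul_mem_tail h1 h2 (hN.t_mem l (by omega) u h3)

/-- Moving x_l through t_l turns it into x_{l+1}, up to a term in F_{l+1}; by downward induction
this reaches x_n, which acts on N by a. The errors made on the way lie in F_{l+2}, which t_l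
preserves. -/
theorem x_cyc_smul_sub_mem (l : ℕ) (hl : l ≤ n) : ∀ u ∈ N,
    x l • cyc t n l • u - a • cyc t n l • u ∈ tail n t N (l + 1) := by
  induction hl using Nat.decreasingInduction with
  | self => intro u hu; rw [cyc_self, one_smul, hN.x_last u hu, sub_self]; exact zero_mem _
  | of_succ l hl ih =>
    intro u hu
    have h1 := ih u hu
    have h2 := t_smul_mem_tail h hN l h1
    have h3 : x (l + 1) • cyc t n (l + 1) • u ∈ tail n t N (l + 1) := by
      rw [← sub_add_cancel (x (l + 1) • cyc t n (l + 1) • u) (a • cyc t n (l + 1) • u)]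
      exact add_mem (tail_mono (Nat.le_succ _) h1)
        (Submodule.smul_mem _ _ (cyc_smul_mem_tail le_rfl hl hu))
    have h4 : x l • cyc t n l • u - a • cyc t n l • u =
        t l • (x (l + 1) • cyc t n (l + 1) • u - a • cyc t n (l + 1) • u) -
          ((q : R) - 1) • x (l + 1) • cyc t n (l + 1) • u := by
      rw [x_smul_cyc_smul h l hl, smul_sub, smul_algebra_smul_comm a, ← mul_smul (t l) (cyc _ _ _),
        ← cyc_of_lt t hl]
      abel
    rw [h4]
    exact sub_mem (tail_mono (Nat.le_succ _) h2) (Submodule.smul_mem _ _ h3)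

/-- For l ≤ r, x_{r+1} passes through c_l as x_r: it commutes with t_l, …, t_{r-1}, and crossing t_r
lowers its index at the cost of a term (q - 1) x_{r+1} c_{r+1} u lying deeper in the filtration. -/
theorem x_succ_cyc_smul_sub_mem (r : ℕ) (hr : r < n) (l : ℕ) (hl : l ≤ r) : ∀ u ∈ N,
    x (r + 1) • cyc t n l • u - cyc t n l • x r • u ∈ tail n t N (l + 1) := by
  induction hl using Nat.decreasingInduction with
  | self =>
    intro u hu
    rw [x_succ_smul_cyc_smul h r hr, add_sub_cancel_left]
    refine Submodule.smul_mem _ _ ?_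
    rw [← sub_add_cancel (x (r + 1) • cyc t n (r + 1) • u) (a • cyc t n (r + 1) • u)]
    exact add_mem (tail_mono (Nat.le_succ _) (x_cyc_smul_sub_mem h hN _ hr u hu))
        (Submodule.smul_mem _ _ (cyc_smul_mem_tail le_rfl hr hu))
  | of_succ l hl ih =>
    intro u hu
    have hln : l < n := by omega
    have h1 := t_smul_mem_tail h hN l (ih u hu)
    have hc := h.t_comm_x l (r + 1) hln hr (by omega) (by omega)
    rw [cyc_of_lt t hln, ← mul_smul, ← mul_assoc, ← hc.eq, mul_smul, mul_smul, mul_smul,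
      ← smul_sub]
    exact tail_mono (Nat.le_succ _) h1

theorem x_smul_mem_tail (j : ℕ) (hj : j ≤ n) (l : ℕ) {v : Q} (hv : v ∈ tail n t N l) :
    x j • v ∈ tail n t N l := by
  refine smul_mem_of_mem_tail _ (fun m u h1 h2 h3 => ?_) hv
  rcases lt_trichotomy j m with hjm | rfl | hjm
  · have hc : Commute (x j) (cyc t n m) :=
      commute_cyc _ h2 fun r hr hr' => (h.t_comm_x r j hr' hj (by omega) (by omega)).symm
    rw [← mul_smul, hc.eq, mul_smul]
    exact cyc_smul_mem_tail h1 h2 (hN.x_mem j (by omega) u h3)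
  · rw [← sub_add_cancel (x j • cyc t n j • u) (a • cyc t n j • u)]
    exact add_mem (tail_mono (by omega) (x_cyc_smul_sub_mem h hN _ h2 u h3))
      (Submodule.smul_mem _ _ (cyc_smul_mem_tail h1 h2 h3))
  · obtain ⟨r, rfl⟩ : ∃ r, j = r + 1 := ⟨j - 1, by omega⟩
    rw [← sub_add_cancel (x (r + 1) • cyc t n m • u) (cyc t n m • x r • u)]
    exact add_mem (tail_mono (by omega) (x_succ_cyc_smul_sub_mem h hN r hj m (by omega) u h3))
      (cyc_smul_mem_tail h1 h2 (hN.x_mem r hj u h3))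

theorem t_smul_mem_tail_zero (i : ℕ) (hi : i < n) {v : Q} (hv : v ∈ tail n t N 0) :
    t i • v ∈ tail n t N 0 := by
  refine smul_mem_of_mem_tail _ (fun m u h1 h2 h3 => ?_) hv
  -- Four positions of i relative to m: i + 1 < m, where t_i commutes with c_m; i + 1 = m, where it
  -- extends c_m to c_i; i = m, where the quadratic relation applies; i > m, where `mul_cyc` shifts
  -- it to t_{i-1}.
  rcases lt_or_ge (i + 1) m with hm | hm
  · have hc : Commute (t i) (cyc t n m) :=
      commute_cyc _ h2 fun r hr hr' => h.far i r (by omega) hr'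
    rw [← mul_smul, hc.eq, mul_smul]
    exact cyc_smul_mem_tail h1 h2 (hN.t_mem i (by omega) u h3)
  rcases hm.eq_or_lt with rfl | hm
  · rw [← mul_smul, ← cyc_of_lt t hi]
    exact cyc_smul_mem_tail (Nat.zero_le _) hi.le h3
  rcases (Nat.lt_succ_iff.mp hm).eq_or_lt with rfl | hm
  · rw [← mul_smul, cyc_of_lt t hi, ← mul_assoc, h.quad m hi, add_mul, smul_mul_assoc,
      smul_mul_assoc, one_mul, ← cyc_of_lt t hi, add_smul, smul_assoc, smul_assoc]
    exact add_mem (Submodule.smul_mem _ _ (cyc_smul_mem_tail h1 h2 h3))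
      (Submodule.smul_mem _ _ (cyc_smul_mem_tail (Nat.zero_le _) hi h3))
  · obtain ⟨r, rfl⟩ : ∃ r, i = r + 1 := ⟨i - 1, by omega⟩
    rw [← mul_smul, mul_cyc h.braid h.far r hi m (by omega), mul_smul]
    exact cyc_smul_mem_tail h1 h2 (hN.t_mem r hi u h3)

theorem x_smul_sub_mem_tail (l : ℕ) (hl : l ≤ n) {v : Q} (hv : v ∈ tail n t N l) :
    x l • v - a • v ∈ tail n t N (l + 1) := by
  obtain ⟨u, hu, hv'⟩ := exists_sub_mem_tail hv
  have h1 := sub_mem (x_smul_mem_tail h hN l hl (l + 1) hv') (Submodule.smul_mem _ a hv')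
  have h2 := add_mem h1 (x_cyc_smul_sub_mem h hN l hl u hu)
  have h3 : x l • (v - cyc t n l • u) - a • (v - cyc t n l • u) +
      (x l • cyc t n l • u - a • cyc t n l • u) = x l • v - a • v := by
    rw [smul_sub, smul_sub]; abel
  rwa [h3] at h2

/-- The second-order refinement: one step further down the filtration, the diagonal behaviour of
x_{l+1} on c_l u acquires the term (q - 1) a c_{l+1} u. Its coefficient is nonzero when q ≠ 1 and a
≠ 0, and this is where these two conditions enter. -/
theorem x_succ_cyc_smul_sub_mem' (l : ℕ) (hl : l < n) (u : Q) (hu : u ∈ N) :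
    x (l + 1) • cyc t n l • u - a • cyc t n l • u - (cyc t n l • (x l • u - a • u) +
      (((q : R) - 1) * a) • cyc t n (l + 1) • u) ∈ tail n t N (l + 2) := by
  have h1 := Submodule.smul_mem _ ((q : R) - 1) (x_cyc_smul_sub_mem h hN (l + 1) hl u hu)
  rw [x_succ_smul_cyc_smul h l hl]
  convert h1 using 1
  rw [smul_sub, smul_sub, mul_smul, smul_algebra_smul_comm a (cyc t n l)]
  abel

/-- The action of x_r on N is seen modulo F_{l+1} through c_l as the action of x_{r'}, where r' = r
if r < l and r' = r + 1 otherwise. The index l is skipped, since x_l acts there by a. -/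
theorem exists_shift (r : ℕ) (hr : r < n) (l : ℕ) (hl : l ≤ n) :
    ∃ r', r ≤ r' ∧ r' ≤ r + 1 ∧ (l ≤ r → r' = r + 1) ∧
      ∀ u ∈ N, x r' • cyc t n l • u - cyc t n l • x r • u ∈ tail n t N (l + 1) := by
  rcases lt_or_ge r l with hrl | hrl
  · refine ⟨r, le_rfl, Nat.le_succ r, by omega, fun u _ => ?_⟩
    have hc : Commute (x r) (cyc t n l) :=
      commute_cyc _ hl fun i hi hi' => (h.t_comm_x i r hi' hr.le (by omega) (by omega)).symm
    rw [← mul_smul, hc.eq, mul_smul, sub_self]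
    exact zero_mem _
  · exact ⟨r + 1, Nat.le_succ r, le_rfl, fun _ => rfl, x_succ_cyc_smul_sub_mem h hN r hr l hrl⟩

theorem cyc_x_smul_mem (r : ℕ) (hr : r < n) (l : ℕ) (hl : l ≤ n) (u : Q) (hu : u ∈ N)
    (hm : cyc t n l • u ∈ tail n t N (l + 1)) : cyc t n l • x r • u ∈ tail n t N (l + 1) := by
  obtain ⟨r', h1, h2, -, h3⟩ := exists_shift h hN r hr l hl
  have := sub_mem (x_smul_mem_tail h hN r' (by omega) _ hm) (h3 u hu)
  rwa [sub_sub_cancel] at this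

/-- On vectors u where the relevant x_r - a are nilpotent, c_l u cannot fall into F_{l+1} unless u =
0. Downward induction on l, and inside it induction on the nilpotency order of x_l - a at u. As
elsewhere in this section, `n ≤ r + k` with `r < n` is the window r ≥ n - k, written without
truncated subtraction. -/
theorem eq_zero_of_cyc_smul_mem (hq : (q : R) ≠ 1) (ha : a ≠ 0) (k l : ℕ) (hl : l ≤ n) :
    n ≤ l + k → ∀ u ∈ N,
      (∀ r, r < n → n ≤ r + k → ∃ s, ((x r - algebraMap R A a) ^ s) • u = 0) →
      cyc t n l • u ∈ tail n t N (l + 1) → u = 0 := by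
  induction hl using Nat.decreasingInduction with
  | self =>
    intro _ u _ _ hu
    rwa [cyc_self, one_smul, tail_eq_bot (Nat.lt_succ_self n), Submodule.mem_bot] at hu
  | of_succ l hl ih =>
    intro hk
    suffices ∀ s, ∀ u ∈ N,
        (∀ r, r < n → n ≤ r + k → ∃ s, ((x r - algebraMap R A a) ^ s) • u = 0) →
        cyc t n l • u ∈ tail n t N (l + 1) → ((x l - algebraMap R A a) ^ s) • u = 0 → u = 0 by
      intro u hu hn hm
      obtain ⟨s, hs⟩ := hn l hl hk
      exact this s u hu hn hm hs
    intro s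
    induction s with
    | zero => intro u _ _ _ hs; simpa using hs
    | succ s ihs =>
      intro u hu hn hm hs
      have hD : (x l - algebraMap R A a) • u = x l • u - a • u := by
        rw [sub_smul, algebraMap_smul]
      have hDN : x l • u - a • u ∈ N := sub_mem (hN.x_mem l hl u hu) (N.smul_mem a hu)
      have key := x_succ_cyc_smul_sub_mem' h hN l hl u hu
      -- x_{l+1} - a maps F_{l+1} into F_{l+2}. Applied to c_l u this gives c_l (x_l - a) u + (q -
      -- 1) a c_{l+1} u ∈ F_{l+2}.
      have key2 := sub_mem (x_smul_sub_mem_tail h hN (l + 1) hl hm) key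
      rw [sub_sub_cancel] at key2
      have h3 : cyc t n (l + 1) • u ∈ tail n t N (l + 1) := cyc_smul_mem_tail le_rfl hl hu
      have h4 : cyc t n l • (x l • u - a • u) ∈ tail n t N (l + 1) := by
        have := sub_mem (tail_mono (Nat.le_succ _) key2)
          (Submodule.smul_mem _ (((q : R) - 1) * a) h3)
        rwa [add_sub_cancel_right] at this
      -- (x_l - a) u satisfies the same hypotheses with smaller nilpotency order, so it vanishes.
      -- What remains is (q - 1) a c_{l+1} u ∈ F_{l+2}, to which the outer induction applies.
      have h5 : x l • u - a • u = 0 := by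
        refine ihs _ hDN (fun r hr hrk => ?_) h4 ?_
        · obtain ⟨s', hs'⟩ := hn r hr hrk
          refine ⟨s', ?_⟩
          have hc : Commute ((x r - algebraMap R A a) ^ s') (x l - algebraMap R A a) := by
            refine Commute.pow_left ?_ _
            exact ((h.x_comm r l hr.le hl.le).sub_right (Algebra.commute_algebraMap_right _ _)).sub_left
              (Algebra.commute_algebraMap_left _ _)
          rw [← hD, ← mul_smul, hc.eq, mul_smul, hs', smul_zero]
        · rw [← hD, ← mul_smul, ← pow_succ]; exact hs
      rw [h5, smul_zero, zero_add] at key2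
      refine ih (by omega) u hu hn ?_
      have hne : ((q : R) - 1) * a ≠ 0 := mul_ne_zero (sub_ne_zero.mpr hq) ha
      exact (Submodule.smul_mem_iff _ hne).mp key2

/-- Combines `exists_nilpotent_lift` and `exists_common_kernel` for the operators x_r - a on N with
n - k ≤ r < n: an eigenvector modulo W lifts to a generalized eigenvector w, and if w ≠ 0 there is a
genuine eigenvector in N. -/
theorem exists_nilpotent_lift_of_stable [FiniteDimensional R N] (k : ℕ) (W : Submodule R Q)
    (hW : ∀ r, r < n → n ≤ r + k → ∀ u ∈ N, u ∈ W → x r • u - a • u ∈ W) (u : Q) (hu : u ∈ N)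
    (huW : ∀ r, r < n → n ≤ r + k → x r • u - a • u ∈ W) :
    ∃ w ∈ N, u - w ∈ W ∧
      (∀ r, r < n → n ≤ r + k → ∃ s, ((x r - algebraMap R A a) ^ s) • w = 0) ∧
      (w ≠ 0 → ∃ w' ∈ N, w' ≠ 0 ∧ ∀ r, r < n → n ≤ r + k → x r • w' = a • w') := by
  have hst : ∀ r : Fin n, ∀ v ∈ N, Algebra.lsmul R R Q (x r - algebraMap R A a) v ∈ N := by
    intro r v hv
    change (x r - algebraMap R A a) • v ∈ N
    rw [sub_smul, algebraMap_smul]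
    exact sub_mem (hN.x_mem r r.2 v hv) (N.smul_mem a hv)
  let D : Fin n → Module.End R N := fun r =>
    (Algebra.lsmul R R Q (x r - algebraMap R A a)).restrict (hst r)
  have hDv : ∀ r (v : N), ((D r v : N) : Q) = x r • (v : Q) - a • (v : Q) := by
    intro r v
    change (x r - algebraMap R A a) • (v : Q) = _
    rw [sub_smul, algebraMap_smul]
  have hDp : ∀ r s (v : N), (((D r ^ s) v : N) : Q) = ((x r - algebraMap R A a) ^ s) • (v : Q) := by
    intro r s v
    induction s with
    | zero => simp
    | succ s ih =>
      rw [pow_succ', pow_succ', Module.End.mul_apply, mul_smul, ← ih]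
      rfl
  have hD : ∀ r r', Commute (D r) (D r') := by
    intro r r'
    refine LinearMap.ext fun v => Subtype.ext ?_
    change (x r - algebraMap R A a) • (x r' - algebraMap R A a) • (v : Q) =
      (x r' - algebraMap R A a) • (x r - algebraMap R A a) • (v : Q)
    have hc : Commute (x r - algebraMap R A a) (x r' - algebraMap R A a) :=
      ((h.x_comm r r' r.2.le r'.2.le).sub_right (Algebra.commute_algebraMap_right _ _)).sub_left
        (Algebra.commute_algebraMap_left _ _)
    rw [← mul_smul, ← mul_smul, hc.eq]
  let S : Finset (Fin n) := Finset.univ.filter fun r => n ≤ r + k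
  have hS : ∀ r : Fin n, r ∈ S ↔ n ≤ r + k := by simp [S]
  obtain ⟨w, hw, hn⟩ := exists_nilpotent_lift D hD (W.comap N.subtype) S
    (fun r hr v hv => by
      change ((D r v : N) : Q) ∈ W
      rw [hDv]
      exact hW r r.2 ((hS r).mp hr) v v.2 hv)
    ⟨u, hu⟩
    (fun r hr => by
      change ((D r _ : N) : Q) ∈ W
      rw [hDv]
      exact huW r r.2 ((hS r).mp hr))
  refine ⟨w, w.2, hw, fun r hr hrk => ?_, fun hw0 => ?_⟩
  · obtain ⟨s, hs⟩ := hn ⟨r, hr⟩ ((hS _).mpr hrk)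
    exact ⟨s, by simpa [hDp] using congrArg (Subtype.val) hs⟩
  · obtain ⟨w', hw', hk⟩ := exists_common_kernel D hD S w (fun h0 => hw0 (by rw [h0]; rfl)) hn
    refine ⟨w', w'.2, fun h0 => hw' (Subtype.ext h0), fun r hr hrk => ?_⟩
    have := congrArg Subtype.val (hk ⟨r, hr⟩ ((hS _).mpr hrk))
    rw [hDv] at this
    exact sub_eq_zero.mp this

/-- If `Q` is generated by `N`, then the simultaneous eigenvectors in `Q` of the last `k + 1`
polynomial generators lie in `N`, provided that `N` has no simultaneous eigenvector of
`x (n - 1), …, x (n - 1 - k)`. -/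
theorem mem_of_forall_eigen [FiniteDimensional R N] (hq : (q : R) ≠ 1) (ha : a ≠ 0) (k : ℕ)
    (hk : k < n → ∀ u ∈ N, (∀ r, r < n → n ≤ r + (k + 1) → x r • u = a • u) → u = 0) (v : Q)
    (hv : v ∈ tail n t N 0) (hvx : ∀ r, r ≤ n → n ≤ r + k → x r • v = a • v) : v ∈ N := by
  suffices ∀ l, l ≤ n → v ∈ tail n t N l by
    have := this n le_rfl
    rwa [tail_self] at this
  intro l
  induction l with
  | zero => exact fun _ => hv
  | succ l ih =>
    intro hl
    have hvl := ih (by omega)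
    obtain ⟨u, hu, huv⟩ := exists_sub_mem_tail hvl
    -- v is congruent to c_l u modulo F_{l+1}, but u is determined only up to W, the vectors that
    -- c_l sends into F_{l+1}. The eigenvalue conditions on v become eigenvalue conditions on u
    -- modulo W.
    let W : Submodule R Q := (tail n t N (l + 1)).comap (Algebra.lsmul R R Q (cyc t n l))
    have hmW : ∀ w, w ∈ W ↔ cyc t n l • w ∈ tail n t N (l + 1) := fun w => Iff.rfl
    have hWst : ∀ r, r < n → ∀ u ∈ N, u ∈ W → x r • u - a • u ∈ W := fun r hr u hu huW =>
      sub_mem (cyc_x_smul_mem h hN r hr l (by omega) u hu huW) (W.smul_mem a huW)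
    have hvr : ∀ r' u, u ∈ N → v - cyc t n l • u ∈ tail n t N (l + 1) → r' ≤ n → n ≤ r' + k →
        x r' • cyc t n l • u - a • cyc t n l • u ∈ tail n t N (l + 1) := by
      intro r' u hu huv h1 h2
      have := sub_mem (Submodule.smul_mem _ a huv) (x_smul_mem_tail h hN r' h1 _ huv)
      rw [smul_sub, smul_sub, hvx r' h1 h2, sub_sub_sub_cancel_left] at this
      exact this
    -- The index shift through c_l gains one generator: for r ≥ l the operator x_r on u is x_{r+1}
    -- on v, so the window may start one lower, at r = n - k - 1.
    have huW : ∀ r, r < n → ((n ≤ r + k) ∨ (l ≤ r ∧ n ≤ r + (k + 1))) → x r • u - a • u ∈ W := by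
      intro r hr hrk
      obtain ⟨r', h1, h2, h3, h4⟩ := exists_shift h hN r hr l (by omega)
      have h5 := hvr r' u hu huv (by omega) (by omega)
      have h6 := sub_mem h5 (h4 u hu)
      rw [hmW, smul_sub, smul_algebra_smul_comm a]
      convert h6 using 1
      abel
    -- If l ≤ n - k - 1, all k + 1 operators x_{n-k-1}, …, x_{n-1} act on u modulo W by a. A nonzero
    -- generalized eigenvector lifting u would yield an eigenvector in N excluded by `hk`, so the
    -- lift is 0 and u ∈ W. If l ≥ n - k, the gained operator is not available, and the off-diagonal
    -- term is used instead.
    rcases lt_or_ge (l + k) n with hlk | hlk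
    · obtain ⟨w, hw, hwW, -, hw0⟩ := exists_nilpotent_lift_of_stable h hN (k + 1) W
        (fun r hr _ => hWst r hr) u hu (fun r hr hrk => huW r hr (Or.inr ⟨by omega, hrk⟩))
      have : w = 0 := by
        by_contra hne
        obtain ⟨w', hw', hne', hx⟩ := hw0 hne
        exact hne' (hk (by omega) w' hw' hx)
      rw [this, sub_zero, hmW] at hwW
      have := add_mem huv hwW
      rwa [sub_add_cancel] at this
    · obtain ⟨w, hw, hwW, hnil, -⟩ := exists_nilpotent_lift_of_stable h hN k W
        (fun r hr _ => hWst r hr) u hu (fun r hr hrk => huW r hr (Or.inl hrk))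
      have hwv : v - cyc t n l • w ∈ tail n t N (l + 1) := by
        have := add_mem huv ((hmW _).mp hwW)
        rwa [smul_sub, sub_add_sub_cancel] at this
      -- l lies in the window, so c_l (x_l - a) w ∈ F_{l+1} with (x_l - a) w generalized eigen, and
      -- `eq_zero_of_cyc_smul_mem` kills it.
      have hxw : x l • w - a • w = 0 := by
        have hD : (x l - algebraMap R A a) • w = x l • w - a • w := by
          rw [sub_smul, algebraMap_smul]
        refine eq_zero_of_cyc_smul_mem h hN hq ha k l (by omega) hlk _
          (sub_mem (hN.x_mem l hl w hw) (N.smul_mem a hw)) (fun r hr hrk => ?_) ?_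
        · obtain ⟨s, hs⟩ := hnil r hr hrk
          refine ⟨s, ?_⟩
          have hc : Commute ((x r - algebraMap R A a) ^ s) (x l - algebraMap R A a) := by
            refine Commute.pow_left ?_ _
            exact ((h.x_comm r l hr.le (by omega)).sub_right
              (Algebra.commute_algebraMap_right _ _)).sub_left (Algebra.commute_algebraMap_left _ _)
          rw [← hD, ← mul_smul, hc.eq, mul_smul, hs, smul_zero]
        · have h1 : x l • u - a • u ∈ W := huW l (by omega) (Or.inl hlk)
          have h2 := hWst l hl _ (sub_mem hu hw) hwW
          have h3 := sub_mem h1 h2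
          rw [smul_sub, smul_sub, sub_sub_sub_comm, sub_sub_cancel, sub_sub_cancel] at h3
          exact h3
      have key := x_succ_cyc_smul_sub_mem' h hN l hl w hw
      rw [hxw, smul_zero, zero_add] at key
      -- x_{l+1} is one of the generators acting on v by a, so (x_{l+1} - a) c_l w = -(x_{l+1} -
      -- a)(v - c_l w), which lies in F_{l+2}. Comparison with `key` leaves (q - 1) a c_{l+1} w ∈
      -- F_{l+2}, so w = 0 and v ∈ F_{l+1}.
      have h7 : x (l + 1) • cyc t n l • w - a • cyc t n l • w ∈ tail n t N (l + 2) := by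
        have := x_smul_sub_mem_tail h hN (l + 1) hl hwv
        rw [smul_sub, smul_sub, hvx (l + 1) hl (by omega), sub_sub_sub_cancel_left,
          ← neg_sub] at this
        exact neg_mem_iff.mp this
      have key2 := sub_mem h7 key
      rw [sub_sub_cancel] at key2
      have hne : ((q : R) - 1) * a ≠ 0 := mul_ne_zero (sub_ne_zero.mpr hq) ha
      have hw0 : w = 0 := eq_zero_of_cyc_smul_mem h hN hq ha k (l + 1) hl (by omega) w hw hnil
        ((Submodule.smul_mem_iff _ hne).mp key2)
      rwa [hw0, smul_zero, sub_zero] at hwv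

end Tail

end Abstract

/-! ### Simple modules over algebras that are finite over a finitely generated commutative ring -/

section FiniteSimple

variable {R : Type*} [Field R]

/-- Zariski's lemma: V is S modulo a maximal ideal, a field of finite type over R. -/
theorem finite_of_isSimpleModule_of_finiteType {S V : Type*} [CommRing S] [Algebra R S]
    [Algebra.FiniteType R S] [AddCommGroup V] [Module S V] [Module R V] [IsScalarTower R S V]
    [IsSimpleModule S V] : Module.Finite R V := by
  obtain ⟨I, hI, ⟨e⟩⟩ := isSimpleModule_iff_quot_maximal.mp (inferInstance : IsSimpleModule S V)
  let : Field (S ⧸ I) := Ideal.Quotient.field I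
  have : Module.Finite R (S ⧸ I) := finite_of_finite_type_of_isJacobsonRing R (S ⧸ I)
  exact Module.Finite.equiv (e.restrictScalars R).symm

/-- M is finitely generated over S, so it has a maximal S-submodule U, and M / U is finite over R.
The largest A-submodule contained in U is proper, hence 0, and it is cut out by the finitely many
conditions f m ∈ U for f ∈ F; so M embeds in a finite power of M / U. -/
theorem finite_of_isSimpleModule_of_span {S A M : Type*} [CommRing S] [Algebra R S]
    [Algebra.FiniteType R S] [Ring A] [Algebra R A] (φ : S →ₐ[R] A) (F : Finset A)
    (hF : ∀ a : A, ∃ c : A → S, a = ∑ f ∈ F, φ (c f) * f)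
    [AddCommGroup M] [Module A M] [Module R M] [IsScalarTower R A M] [IsSimpleModule A M] :
    Module.Finite R M := by
  let : Module S M := Module.compHom M φ.toRingHom
  have hs : ∀ (s : S) (m : M), s • m = φ s • m := fun _ _ => rfl
  have : IsScalarTower R S M := ⟨fun r s m => by rw [hs, hs, map_smul, smul_assoc]⟩
  have hsp : ∀ (a : A) (U : Submodule S M) (m : M), (∀ f ∈ F, f • m ∈ U) → a • m ∈ U := by
    intro a U m h
    obtain ⟨c, rfl⟩ := hF a
    rw [Finset.sum_smul]
    refine sum_mem fun f hf => ?_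
    rw [mul_smul, ← hs]
    exact U.smul_mem _ (h f hf)
  have : Nontrivial M := IsSimpleModule.nontrivial A M
  obtain ⟨m₀, hm₀⟩ := exists_ne (0 : M)
  have : Module.Finite S M := by
    classical
    refine ⟨⟨F.image (fun f => f • m₀), ?_⟩⟩
    rw [eq_top_iff]
    intro m _
    obtain ⟨a, rfl⟩ := IsSimpleModule.toSpanSingleton_surjective A hm₀ m
    exact hsp a _ m₀ fun f hf => Submodule.subset_span (by
      simpa using ⟨f, hf, rfl⟩)
  obtain ⟨U, hU, -⟩ := (eq_top_or_exists_le_coatom (⊥ : Submodule S M)).resolve_left bot_ne_top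
  have : IsSimpleModule S (M ⧸ U) := (isSimpleModule_iff_isCoatom).mpr hU
  have : Module.Finite R (M ⧸ U) := finite_of_isSimpleModule_of_finiteType (S := S)
  let K : Submodule A M :=
    { carrier := {m | ∀ a : A, a • m ∈ U}
      add_mem' := fun h h' a => by rw [smul_add]; exact U.add_mem (h a) (h' a)
      zero_mem' := fun a => by rw [smul_zero]; exact U.zero_mem
      smul_mem' := fun b m h a => by rw [← mul_smul]; exact h _ }
  have hK : K = ⊥ := (eq_bot_or_eq_top K).resolve_right fun h => hU.1 <| by
    rw [eq_top_iff]
    intro m _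
    have : m ∈ K := h ▸ Submodule.mem_top
    simpa using this 1
  let ψ : M →ₗ[R] (F → M ⧸ U) :=
    LinearMap.pi fun f => (U.mkQ.restrictScalars R).comp (Algebra.lsmul R R M (f : A))
  refine Module.Finite.of_injective ψ ((injective_iff_map_eq_zero ψ).mpr fun m hm => ?_)
  have : m ∈ K := fun a => hsp a U m fun f hf => by
    have := congrFun hm ⟨f, hf⟩
    exact (Submodule.Quotient.mk_eq_zero U).mp this
  rwa [hK, Submodule.mem_bot] at this

theorem adjoin_le_of_mul_mem {A : Type*} [Ring A] [Algebra R A] {s : Set A} {P : Submodule R A}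
    (h1 : (1 : A) ∈ P) (h : ∀ a ∈ s, ∀ b ∈ P, a * b ∈ P) :
    Subalgebra.toSubmodule (Algebra.adjoin R s) ≤ P := by
  intro a ha
  have : ∀ b ∈ P, a * b ∈ P := by
    induction ha using Algebra.adjoin_induction with
    | mem a ha => exact h a ha
    | algebraMap r => intro b hb; rw [← Algebra.smul_def]; exact P.smul_mem r hb
    | add a a' _ _ h h' => intro b hb; rw [add_mul]; exact P.add_mem (h b hb) (h' b hb)
    | mul a a' _ _ h h' => intro b hb; rw [mul_assoc]; exact h _ (h' b hb)
  simpa using this 1 h1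

end FiniteSimple

/-! ### The affine Hecke algebra over its polynomial subalgebra -/

namespace AffineRelations

variable {R A : Type*} [Field R] [Ring A] [Algebra R A] {q : Rˣ} {n : ℕ} {t x : ℕ → A}
  (h : AffineRelations q n t x)

include h

/-- Finite-dimensionality of the subalgebra generated by the t_i, by induction on rank. The affine
relations involving x hold trivially for x = 0, so the filtration lemmas apply to the algebra acting
on itself, with N the subalgebra of the previous rank and a = 0. -/
theorem finiteDimensional_adjoin_t (k : ℕ) (hk : k ≤ n) :
    FiniteDimensional R (Subalgebra.toSubmodule (Algebra.adjoin R {a | ∃ i < k, a = t i})) := by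
  induction k with
  | zero =>
    have : {a : A | ∃ i < 0, a = t i} = ∅ := by ext; simp
    rw [this, Algebra.adjoin_empty]
    exact inferInstanceAs (Module.Finite R (⊥ : Subalgebra R A))
  | succ k ih =>
    have := ih (by omega)
    have h0 : AffineRelations q (k + 1) t (0 : ℕ → A) :=
      { braid := fun i hi => h.braid i (by omega)
        far := fun i j hij hj => h.far i j hij (by omega)
        quad := fun i hi => h.quad i (by omega)
        txt := fun i hi => by simp
        t_comm_x := fun i j _ _ _ _ => Commute.zero_right _
        x_comm := fun i j _ _ => Commute.zero_right _ }
    set N := Subalgebra.toSubmodule (Algebra.adjoin R {a | ∃ i < k, a = t i})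
    have hN : IsEigenStable (k + 1) t (0 : ℕ → A) (0 : R) N :=
      { t_mem := fun i hi u hu =>
          Subalgebra.mul_mem _ (Algebra.subset_adjoin ⟨i, by omega, rfl⟩) hu
        x_mem := fun j _ u _ => by simp
        x_last := fun u _ => by simp }
    have := finiteDimensional_tail (n := k + 1) (t := t) (N := N) 0
    refine Submodule.finiteDimensional_of_le (S₂ := tail (k + 1) t N 0) (adjoin_le_of_mul_mem ?_ ?_)
    · have : cyc t (k + 1) (k + 1) • (1 : A) ∈ tail (k + 1) t N 0 :=
        cyc_smul_mem_tail (Nat.zero_le _) le_rfl (Subalgebra.one_mem _)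
      simpa [cyc_self] using this
    · rintro _ ⟨i, hi, rfl⟩ b hb
      exact t_smul_mem_tail_zero h0 hN i hi hb

variable {x' : ℕ → A} (hx : ∀ j, j ≤ n → x j * x' j = 1) (hx' : ∀ j, j ≤ n → x' j * x j = 1)

include hx hx'

theorem t_mul_adjoin (i : ℕ) (hi : i < n) (p : A)
    (hp : p ∈ Algebra.adjoin R {a | ∃ j ≤ n, a = x j ∨ a = x' j}) :
    ∃ p₁ ∈ Algebra.adjoin R {a | ∃ j ≤ n, a = x j ∨ a = x' j},
      ∃ p₂ ∈ Algebra.adjoin R {a | ∃ j ≤ n, a = x j ∨ a = x' j}, t i * p = p₁ * t i + p₂ := by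
  set P := Algebra.adjoin R {a | ∃ j ≤ n, a = x j ∨ a = x' j}
  have hxP : ∀ j, j ≤ n → x j ∈ P := fun j hj => Algebra.subset_adjoin ⟨j, hj, Or.inl rfl⟩
  have hxP' : ∀ j, j ≤ n → x' j ∈ P := fun j hj => Algebra.subset_adjoin ⟨j, hj, Or.inr rfl⟩
  have hgen : ∀ j, j ≤ n → ∃ k ≤ n, ∃ p₂ ∈ P, t i * x j = x k * t i + p₂ := by
    intro j hj
    by_cases h1 : j = i
    · subst h1
      refine ⟨j + 1, hi, -(((q : R) - 1) • x (j + 1)),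
        P.neg_mem (P.smul_mem (hxP _ hi) _), ?_⟩
      rw [h.x_succ_mul_t j hi, add_neg_cancel_right]
    by_cases h2 : j = i + 1
    · subst h2
      refine ⟨i, hi.le, ((q : R) - 1) • x (i + 1), P.smul_mem (hxP _ hi) _, ?_⟩
      rw [h.x_mul_t i hi, sub_add_cancel]
    · exact ⟨j, hj, 0, P.zero_mem, by rw [(h.t_comm_x i j hi hj h1 h2).eq, add_zero]⟩
  induction hp using Algebra.adjoin_induction with
  | mem p hp =>
    obtain ⟨j, hj, hp⟩ := hp
    obtain ⟨k, hk, p₂, hp₂, he⟩ := hgen j hj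
    rcases hp with rfl | rfl
    · exact ⟨_, hxP k hk, p₂, hp₂, he⟩
    · refine ⟨_, hxP' k hk, -(x' k * p₂ * x' j),
        P.neg_mem (P.mul_mem (P.mul_mem (hxP' k hk) hp₂) (hxP' j hj)), ?_⟩
      -- The rule for x_j⁻¹ is obtained from t_i x_j = x_k t_i + p₂ by multiplying with x_k⁻¹ on the
      -- left and x_j⁻¹ on the right.
      have h1 : x' k * (t i * x j) * x' j = x' k * (x k * t i + p₂) * x' j := by rw [he]
      have h2 : x' k * (t i * x j) * x' j = x' k * t i := by
        rw [← mul_assoc, mul_assoc, hx j hj, mul_one]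
      have h3 : x' k * (x k * t i + p₂) * x' j = t i * x' j + x' k * p₂ * x' j := by
        rw [mul_add, ← mul_assoc, hx' k hk, one_mul, add_mul]
      rw [h2, h3] at h1
      rw [h1, add_neg_cancel_right]
  | algebraMap r =>
    exact ⟨_, P.algebraMap_mem r, 0, P.zero_mem, by rw [add_zero, Algebra.commutes]⟩
  | add p p' _ _ hp hp' =>
    obtain ⟨a, ha, b, hb, he⟩ := hp
    obtain ⟨a', ha', b', hb', he'⟩ := hp'
    refine ⟨_, P.add_mem ha ha', _, P.add_mem hb hb', ?_⟩
    rw [mul_add, he, he', add_mul]; abel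
  | mul p p' _ hpP hp hp' =>
    obtain ⟨a, ha, b, hb, he⟩ := hp
    obtain ⟨a', ha', b', hb', he'⟩ := hp'
    refine ⟨_, P.mul_mem ha ha', _, P.add_mem (P.mul_mem ha hb') (P.mul_mem hb hpP), ?_⟩
    rw [← mul_assoc, he, add_mul, mul_assoc, he', mul_add, mul_assoc, add_assoc]

open scoped IsMulCommutative in
theorem finite_of_isSimpleModule
    (htop : ∀ S : Subalgebra R A, (∀ i, i < n → t i ∈ S) → (∀ j, j ≤ n → x j ∈ S) →
      (∀ j, j ≤ n → x' j ∈ S) → S = ⊤)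
    {M : Type*} [AddCommGroup M] [Module A M] [Module R M] [IsScalarTower R A M]
    [IsSimpleModule A M] : Module.Finite R M := by
  classical
  let G : Set A := {a | ∃ j ≤ n, a = x j ∨ a = x' j}
  have hcomm : ∀ a ∈ G, ∀ b ∈ G, a * b = b * a := by
    have h1 : ∀ j k, j ≤ n → k ≤ n → Commute (x j) (x' k) := fun j k hj hk =>
      AffHecke.commute_of_inv (h.x_comm j k hj hk) (hx k hk) (hx' k hk)
    rintro a ⟨j, hj, ha⟩ b ⟨k, hk, hb⟩
    rcases ha with rfl | rfl <;> rcases hb with rfl | rfl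
    · exact h.x_comm j k hj hk
    · exact h1 j k hj hk
    · exact (h1 k j hk hj).symm
    · exact AffHecke.commute_of_inv (h1 k j hk hj).symm (hx k hk) (hx' k hk)
  have hfin : G.Finite := by
    have : G ⊆ ((Finset.range (n + 1)).image x ∪ (Finset.range (n + 1)).image x' : Finset A) := by
      rintro a ⟨j, hj, rfl | rfl⟩
      · simp only [Finset.coe_union, Finset.coe_image, Set.mem_union, Set.mem_image]
        exact Or.inl ⟨j, by simpa using Nat.lt_succ_of_le hj, rfl⟩
      · simp only [Finset.coe_union, Finset.coe_image, Set.mem_union, Set.mem_image]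
        exact Or.inr ⟨j, by simpa using Nat.lt_succ_of_le hj, rfl⟩
    exact (Finset.finite_toSet _).subset this
  have := Algebra.isMulCommutative_adjoin R hcomm
  have : Algebra.FiniteType R (Algebra.adjoin R G) := by
    rw [← Subalgebra.fg_iff_finiteType]
    exact Subalgebra.fg_def.mpr ⟨G, hfin, rfl⟩
  set P := Algebra.adjoin R G with hP
  set T := Algebra.adjoin R {a | ∃ i < n, a = t i} with hT
  have := h.finiteDimensional_adjoin_t n le_rfl
  obtain ⟨F, hF⟩ : (Subalgebra.toSubmodule T).FG := (Submodule.fg_top _).mp Module.Finite.fg_top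
  -- A = P T, with P the Laurent subalgebra and T the one generated by the t_i: the product contains
  -- 1 and is stable under left multiplication by generators, thanks to t_i P ⊆ P t_i + P.
  have hmul : ∀ a : A, a ∈ Subalgebra.toSubmodule P * Subalgebra.toSubmodule T := by
    intro a
    have hall : Algebra.adjoin R ({a | ∃ i < n, a = t i} ∪ G) = ⊤ :=
      htop _ (fun i hi => Algebra.subset_adjoin (Or.inl ⟨i, hi, rfl⟩))
        (fun j hj => Algebra.subset_adjoin (Or.inr ⟨j, hj, Or.inl rfl⟩))
        (fun j hj => Algebra.subset_adjoin (Or.inr ⟨j, hj, Or.inr rfl⟩))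
    have hle := adjoin_le_of_mul_mem (s := {a | ∃ i < n, a = t i} ∪ G)
      (P := Subalgebra.toSubmodule P * Subalgebra.toSubmodule T) (R := R) ?_ ?_
    · exact hle (by rw [hall]; trivial)
    · simpa using Submodule.mul_mem_mul (M := Subalgebra.toSubmodule P)
        (N := Subalgebra.toSubmodule T) P.one_mem T.one_mem
    · rintro a (⟨i, hi, rfl⟩ | ha) b hb
      · induction hb using Submodule.mul_induction_on' with
        | mem_mul_mem p hp f hf =>
          obtain ⟨p₁, h1, p₂, h2, he⟩ := h.t_mul_adjoin hx hx' i hi p hp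
          rw [← mul_assoc, he, add_mul, mul_assoc]
          exact add_mem (Submodule.mul_mem_mul h1
            (T.mul_mem (Algebra.subset_adjoin ⟨i, hi, rfl⟩) hf)) (Submodule.mul_mem_mul h2 hf)
        | add p _ p' _ hp hp' => rw [mul_add]; exact add_mem hp hp'
      · induction hb using Submodule.mul_induction_on' with
        | mem_mul_mem p hp f hf =>
          rw [← mul_assoc]
          exact Submodule.mul_mem_mul (P.mul_mem (Algebra.subset_adjoin ha) hp) hf
        | add p _ p' _ hp hp' => rw [mul_add]; exact add_mem hp hp'
  refine finite_of_isSimpleModule_of_span (S := P) P.val F (A := A) fun a => ?_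
  induction hmul a using Submodule.mul_induction_on' with
  | mem_mul_mem p hp f hf =>
    have hf' : f ∈ Submodule.span R (F : Set A) := hF ▸ hf
    obtain ⟨c, -, rfl⟩ := Submodule.mem_span_finset.mp hf'
    refine ⟨fun g => c g • ⟨p, hp⟩, ?_⟩
    rw [Finset.mul_sum]
    refine Finset.sum_congr rfl fun g _ => ?_
    rw [map_smul, smul_mul_assoc, mul_smul_comm]
    rfl
  | add p _ p' _ hp hp' =>
    obtain ⟨c, rfl⟩ := hp
    obtain ⟨c', rfl⟩ := hp'
    refine ⟨c + c', ?_⟩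
    rw [← Finset.sum_add_distrib]
    refine Finset.sum_congr rfl fun g _ => ?_
    rw [Pi.add_apply, map_add, add_mul]

end AffineRelations

/-! ### Eigenspaces of the last generators over the affine Hecke algebra -/

namespace AffHecke

variable {R : Type u} [Field R] (q : Rˣ)

/-- The generator `T i` of the affine Hecke algebra, with the value `0` out of range. -/
def tGen (n i : ℕ) : AffHecke q n := if h : i + 1 < n then gen q (.T i h) else 0

/-- The generator `X j` of the affine Hecke algebra, with the value `0` out of range. -/
def xGen (n j : ℕ) : AffHecke q n := if h : j < n then gen q (.X j h) else 0

/-- The generator `Xinv j` of the affine Hecke algebra, with the value `0` out of range. -/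
def xInv (n j : ℕ) : AffHecke q n := if h : j < n then gen q (.Xinv j h) else 0

variable {q} {n : ℕ}

theorem tGen_of_lt {i : ℕ} (h : i + 1 < n) : tGen q n i = gen q (.T i h) := dif_pos h

theorem xGen_of_lt {j : ℕ} (h : j < n) : xGen q n j = gen q (.X j h) := dif_pos h

theorem xInv_of_lt {j : ℕ} (h : j < n) : xInv q n j = gen q (.Xinv j h) := dif_pos h

theorem xGen_mul_xInv {j : ℕ} (h : j < n) : xGen q n j * xInv q n j = 1 := by
  rw [xGen_of_lt h, xInv_of_lt h]
  simpa [gen] using mk_rel q (AffRel.mul_inv j h)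

theorem xInv_mul_xGen {j : ℕ} (h : j < n) : xInv q n j * xGen q n j = 1 := by
  rw [xGen_of_lt h, xInv_of_lt h]
  simpa [gen] using mk_rel q (AffRel.inv_mul j h)

variable (q n) in
theorem affineRelations : AffineRelations q n (tGen q (n + 1)) (xGen q (n + 1)) where
  braid i hi := by
    rw [tGen_of_lt (by omega : i + 1 < n + 1), tGen_of_lt (by omega : i + 1 + 1 < n + 1)]
    simpa [gen] using mk_rel q (AffRel.braid (n := n + 1) i (by omega) (by omega))
  far i j hij hj := by
    rw [tGen_of_lt (by omega : i + 1 < n + 1), tGen_of_lt (by omega : j + 1 < n + 1)]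
    simpa [gen, Commute, SemiconjBy] using mk_rel q (AffRel.far (n := n + 1) i j (by omega) (by omega) hij)
  quad i hi := by
    rw [tGen_of_lt (by omega : i + 1 < n + 1)]
    have := mk_rel q (AffRel.quad (n := n + 1) i (by omega))
    rw [map_mul, map_add, map_sub, map_one, map_zero, AlgHom.commutes] at this
    change (gen q _ + 1) * (gen q _ - _) = 0 at this
    rw [add_mul, mul_sub, one_mul, ← Algebra.commutes, ← Algebra.smul_def,
      Algebra.algebraMap_eq_smul_one] at this
    rw [sub_smul, one_smul, ← sub_eq_zero, ← this]
    abel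
  txt i hi := by
    rw [tGen_of_lt (by omega : i + 1 < n + 1), xGen_of_lt (by omega : i < n + 1),
      xGen_of_lt (by omega : i + 1 < n + 1)]
    simpa [gen] using mk_rel q (AffRel.TXT (n := n + 1) i (by omega) (by omega))
  t_comm_x i j hi hj h h' := by
    rw [tGen_of_lt (by omega : i + 1 < n + 1), xGen_of_lt (by omega : j < n + 1)]
    simpa [gen, Commute, SemiconjBy] using mk_rel q (AffRel.TX (n := n + 1) i j (by omega) (by omega) h h')
  x_comm i j hi hj := by
    rw [xGen_of_lt (by omega : i < n + 1), xGen_of_lt (by omega : j < n + 1)]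
    simpa [gen, Commute, SemiconjBy] using mk_rel q (AffRel.comm (n := n + 1) i j (by omega) (by omega))

theorem eq_top_of_mem (S : Subalgebra R (AffHecke q n)) (ht : ∀ i, i + 1 < n → tGen q n i ∈ S)
    (hx : ∀ j, j < n → xGen q n j ∈ S) (hx' : ∀ j, j < n → xInv q n j ∈ S) : S = ⊤ := by
  refine eq_top q S fun g => ?_
  cases g with
  | T i h => simpa [tGen_of_lt h] using ht i h
  | X j h => simpa [xGen_of_lt h] using hx j h
  | Xinv j h => simpa [xInv_of_lt h] using hx' j h

theorem finite_of_isSimpleModule {M : Type*} [AddCommGroup M] [Module (AffHecke q n) M]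
    [Module R M] [IsScalarTower R (AffHecke q n) M] [IsSimpleModule (AffHecke q n) M] :
    Module.Finite R M := by
  cases n with
  | zero =>
    have htop : (⊥ : Subalgebra R (AffHecke q 0)) = ⊤ := eq_top q _ fun g => by
      cases g <;> omega
    have : Nontrivial M := IsSimpleModule.nontrivial (AffHecke q 0) M
    obtain ⟨m, hm⟩ := exists_ne (0 : M)
    refine Module.Finite.of_surjective (LinearMap.toSpanSingleton R M m) fun v => ?_
    obtain ⟨a, rfl⟩ := IsSimpleModule.toSpanSingleton_surjective (AffHecke q 0) hm v
    obtain ⟨r, rfl⟩ := Algebra.mem_bot.mp (htop ▸ (Algebra.mem_top : a ∈ ⊤))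
    exact ⟨r, by simp⟩
  | succ n =>
    exact (affineRelations q n).finite_of_isSimpleModule (x' := xInv q (n + 1))
      (fun j hj => xGen_mul_xInv (by omega)) (fun j hj => xInv_mul_xGen (by omega))
      (fun S ht hx hx' => eq_top_of_mem S (fun i hi => ht i (by omega))
        (fun j hj => hx j (by omega)) (fun j hj => hx' j (by omega)))

theorem incl_tGen {i : ℕ} (h : i + 1 < n) : incl q n (tGen q n i) = tGen q (n + 1) i := by
  rw [tGen_of_lt h, tGen_of_lt (h.trans n.lt_succ_self), incl, lift_gen]

theorem incl_xGen {j : ℕ} (h : j < n) : incl q n (xGen q n j) = xGen q (n + 1) j := by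
  rw [xGen_of_lt h, xGen_of_lt (h.trans n.lt_succ_self), incl, lift_gen]

/-! ### Eigenspaces of the last generator in modules over the affine Hecke algebra -/

section Module

set_option linter.unusedSectionVars false

variable {Q : Type*} [AddCommGroup Q] [Module R Q] [Module (AffHecke q (n + 1)) Q]
  [IsScalarTower R (AffHecke q (n + 1)) Q]

/-- An `H_n^aff`-stable subspace of an `H_{n+1}^aff`-module on which the last polynomial generator
acts by the scalar `a`. -/
structure IsLastEigen (a : R) (N : Submodule R Q) : Prop where
  incl_mem : ∀ (b : AffHecke q n), ∀ u ∈ N, incl q n b • u ∈ N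
  last_smul : ∀ u ∈ N, xGen q (n + 1) n • u = a • u

variable {a : R} {N : Submodule R Q}

theorem IsLastEigen.isEigenStable (h : IsLastEigen (q := q) (n := n) a N) :
    IsEigenStable n (tGen q (n + 1)) (xGen q (n + 1)) a N where
  t_mem i hi u hu := by
    have := h.incl_mem (tGen q n i) u hu
    rwa [incl_tGen hi] at this
  x_mem j hj u hu := by
    have := h.incl_mem (xGen q n j) u hu
    rwa [incl_xGen hj] at this
  x_last := h.last_smul

/-- F_0 contains N and is stable under every generator, so it is all of Q. -/
theorem IsLastEigen.mem_tail [FiniteDimensional R N] (h : IsLastEigen (q := q) (n := n) a N)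
    (htop : Submodule.span (AffHecke q (n + 1)) (N : Set Q) = ⊤) (v : Q) :
    v ∈ tail n (tGen q (n + 1)) N 0 := by
  have hr := affineRelations q n
  have hN := h.isEigenStable
  have hfin := finiteDimensional_tail (n := n) (t := tGen q (n + 1)) (N := N) 0
  set W := tail n (tGen q (n + 1)) N 0
  let S : Subalgebra R (AffHecke q (n + 1)) :=
    { carrier := {b | ∀ w ∈ W, b • w ∈ W}
      mul_mem' := fun hb hc w hw => by rw [mul_smul]; exact hb _ (hc w hw)
      add_mem' := fun hb hc w hw => by rw [add_smul]; exact W.add_mem (hb w hw) (hc w hw)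
      algebraMap_mem' := fun r w hw => by rw [algebraMap_smul]; exact W.smul_mem r hw }
  have hS : S = ⊤ := by
    refine eq_top_of_mem S (fun i hi w hw => t_smul_mem_tail_zero hr hN i (by omega) hw)
      (fun j hj w hw => x_smul_mem_tail hr hN j (by omega) 0 hw) fun j hj w hw => ?_
    -- Stability under x_j⁻¹: x_j acts injectively on the finite-dimensional F_0, hence
    -- surjectively.
    let f : Module.End R W := (Algebra.lsmul R R Q (xGen q (n + 1) j)).restrict
      fun w hw => x_smul_mem_tail hr hN j (by omega) 0 hw
    have hf : Function.Injective f := by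
      refine (injective_iff_map_eq_zero f).mpr fun w hw => Subtype.ext ?_
      have h1 : xGen q (n + 1) j • (w : Q) = 0 := congrArg Subtype.val hw
      have h2 := congrArg (fun y => xInv q (n + 1) j • y) h1
      simpa [← mul_smul, xInv_mul_xGen hj] using h2
    obtain ⟨w', hw'⟩ := (LinearMap.injective_iff_surjective.mp hf) ⟨w, hw⟩
    have h3 : xGen q (n + 1) j • (w' : Q) = w := congrArg Subtype.val hw'
    rw [← h3, ← mul_smul, xInv_mul_xGen hj, one_smul]
    exact w'.2
  let W' : Submodule (AffHecke q (n + 1)) Q :=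
    { carrier := W
      add_mem' := W.add_mem
      zero_mem' := W.zero_mem
      smul_mem' := fun b w hw => by
        have : b ∈ S := hS ▸ Algebra.mem_top
        exact this w hw }
  have hle : Submodule.span (AffHecke q (n + 1)) (N : Set Q) ≤ W' := by
    refine Submodule.span_le.mpr fun u hu => ?_
    have : u ∈ tail n (tGen q (n + 1)) N n := by rwa [tail_self]
    exact tail_mono (Nat.zero_le n) this
  exact hle (htop ▸ Submodule.mem_top)

theorem IsLastEigen.mem_of_forall_eigen [FiniteDimensional R N]
    (h : IsLastEigen (q := q) (n := n) a N) (hq : q ≠ 1) (ha : a ≠ 0)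
    (htop : Submodule.span (AffHecke q (n + 1)) (N : Set Q) = ⊤) (k : ℕ)
    (hk : k < n → ∀ u ∈ N, (∀ r, r < n → n ≤ r + (k + 1) → xGen q (n + 1) r • u = a • u) → u = 0)
    (v : Q) (hvx : ∀ r, r ≤ n → n ≤ r + k → xGen q (n + 1) r • v = a • v) : v ∈ N :=
  HeckeCrystal.mem_of_forall_eigen (affineRelations q n) h.isEigenStable
    (fun h1 => hq (Units.ext h1)) ha k hk v (h.mem_tail htop v) hvx

/-- Picks the longest run of generators below x_n that, together with x_n, has a common
a-eigenvector in N. The run k = 0 imposes no condition, so it is available as soon as N ≠ 0. -/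
theorem exists_maximal_eigen (hN : N ≠ ⊥) : ∃ k, (∃ u ∈ N, u ≠ 0 ∧
      ∀ r, r < n → n ≤ r + k → xGen q (n + 1) r • u = a • u) ∧
    (k < n → ∀ u ∈ N, (∀ r, r < n → n ≤ r + (k + 1) → xGen q (n + 1) r • u = a • u) → u = 0) := by
  classical
  let p : ℕ → Prop := fun k => ∃ u ∈ N, u ≠ 0 ∧
      ∀ r, r < n → n ≤ r + k → xGen q (n + 1) r • u = a • u
  have h0 : p 0 := by
    obtain ⟨u, hu, hu0⟩ := N.ne_bot_iff.mp hN
    exact ⟨u, hu, hu0, fun r _ _ => by omega⟩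
  refine ⟨Nat.findGreatest p n, Nat.findGreatest_spec (Nat.zero_le n) h0, fun hlt u hu hx => ?_⟩
  by_contra hne
  exact Nat.findGreatest_is_greatest (Nat.lt_succ_self _) hlt ⟨u, hu, hne, hx⟩

/-- In a simple module, two nonzero `H_n^aff`-stable subspaces of an eigenspace of the last
polynomial generator meet. -/
theorem exists_mem_inf_of_isSimpleModule [IsSimpleModule (AffHecke q (n + 1)) Q] (hq : q ≠ 1)
    (ha : a ≠ 0) {N₁ N₂ : Submodule R Q} (h₁ : IsLastEigen (q := q) (n := n) a N₁)
    (h₂ : IsLastEigen (q := q) (n := n) a N₂) (hN₁ : N₁ ≠ ⊥) (hN₂ : N₂ ≠ ⊥) :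
    ∃ u ∈ N₁, u ∈ N₂ ∧ u ≠ 0 := by
  have hfin : Module.Finite R Q := finite_of_isSimpleModule (q := q) (n := n + 1)
  have htop : ∀ {N : Submodule R Q}, N ≠ ⊥ →
      Submodule.span (AffHecke q (n + 1)) (N : Set Q) = ⊤ := by
    intro N hN
    refine (eq_bot_or_eq_top _).resolve_left fun hb => ?_
    obtain ⟨u, hu, hu0⟩ := N.ne_bot_iff.mp hN
    exact hu0 ((Submodule.span_eq_bot.mp hb) u hu)
  obtain ⟨k₁, ⟨u₁, hu₁, hu₁0, hux₁⟩, hk₁⟩ := exists_maximal_eigen (q := q) (n := n) (a := a) hN₁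
  obtain ⟨k₂, ⟨u₂, hu₂, hu₂0, hux₂⟩, hk₂⟩ := exists_maximal_eigen (q := q) (n := n) (a := a) hN₂
  have hx : ∀ {N : Submodule R Q}, IsLastEigen (q := q) (n := n) a N → ∀ {k u}, u ∈ N →
      (∀ r, r < n → n ≤ r + k → xGen q (n + 1) r • u = a • u) →
      ∀ r, r ≤ n → n ≤ r + k → xGen q (n + 1) r • u = a • u := by
    intro N h k u hu hx r hr hrk
    rcases hr.eq_or_lt with rfl | hr
    · exact h.last_smul u hu
    · exact hx r hr hrk
  -- The subspace with the shorter run has no eigenvector for any longer run, so the criterion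
  -- applied to it captures the extremal eigenvector of the other.
  rcases le_total k₁ k₂ with hk | hk
  · exact ⟨u₂, h₁.mem_of_forall_eigen hq ha (htop hN₁) k₂
      (fun hlt u hu hux => hk₁ (by omega) u hu fun r hr hrk => hux r hr (by omega)) u₂
      (hx h₂ hu₂ hux₂), hu₂, hu₂0⟩
  · exact ⟨u₁, hu₁, h₂.mem_of_forall_eigen hq ha (htop hN₂) k₁
      (fun hlt u hu hux => hk₂ (by omega) u hu fun r hr hrk => hux r hr (by omega)) u₁
      (hx h₁ hu₁ hux₁), hu₁0⟩

/-- A module generated by an `H_n^aff`-stable subspace of an eigenspace of the last polynomial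
generator that meets no proper submodule has at most one maximal submodule. -/
theorem IsLastEigen.eq_of_isCoatom [FiniteDimensional R N]
    (h : IsLastEigen (q := q) (n := n) a N) (hq : q ≠ 1) (ha : a ≠ 0)
    (htop : Submodule.span (AffHecke q (n + 1)) (N : Set Q) = ⊤)
    (hdisj : ∀ U : Submodule (AffHecke q (n + 1)) Q, U ≠ ⊤ → ∀ u ∈ N, u ∈ U → u = 0)
    {U₁ U₂ : Submodule (AffHecke q (n + 1)) Q} (hU₁ : IsCoatom U₁) (hU₂ : IsCoatom U₂) :
    U₁ = U₂ := by
  by_contra hne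
  have hN0 : N ≠ ⊥ := by
    rintro rfl
    refine hU₁.1 (eq_top_iff.mpr ?_)
    rw [← htop, Submodule.span_le]
    intro u hu
    rw [(Submodule.mem_bot R).mp hu]
    exact U₁.zero_mem
  obtain ⟨k, ⟨u, hu, hu0, hux⟩, hk⟩ := exists_maximal_eigen (q := q) (n := n) (a := a) hN0
  -- Split the extremal eigenvector u of N as b + c along the two maximal submodules, and work
  -- modulo U = U₁ ⊓ U₂.
  have hsup : U₁ ⊔ U₂ = ⊤ := hU₁.sup_eq_top_of_ne hU₂ hne
  obtain ⟨b, hb, c, hc, hbc⟩ := Submodule.mem_sup.mp (hsup ▸ (Submodule.mem_top : u ∈ ⊤))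
  set U := U₁ ⊓ U₂
  have hU : U ≠ ⊤ := fun hU => hU₁.1 (eq_top_iff.mpr (hU ▸ inf_le_left))
  let π : Q →ₗ[R] (Q ⧸ U) := U.mkQ.restrictScalars R
  have hπ : ∀ (d : AffHecke q (n + 1)) v, π (d • v) = d • π v := fun d v => U.mkQ.map_smul d v
  have hπ0 : ∀ v, π v = 0 ↔ v ∈ U := fun v => Submodule.Quotient.mk_eq_zero U
  have hN' : IsLastEigen (q := q) (n := n) a (N.map π) := by
    constructor
    · rintro d _ ⟨v, hv, rfl⟩
      rw [← hπ]
      exact Submodule.mem_map_of_mem (h.incl_mem d v hv)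
    · rintro _ ⟨v, hv, rfl⟩
      rw [← hπ, h.last_smul v hv, map_smul]
  have htop' : Submodule.span (AffHecke q (n + 1)) (N.map π : Set (Q ⧸ U)) = ⊤ := by
    have : (N.map π : Set (Q ⧸ U)) = U.mkQ '' N := rfl
    rw [this, Submodule.span_image, htop, Submodule.map_top, Submodule.range_mkQ]
  have hmem : π c ∈ N.map π := by
    refine hN'.mem_of_forall_eigen hq ha htop' k ?_ (π c) ?_
    · rintro hlt _ ⟨v, hv, rfl⟩ hvx
      -- N meets U trivially, so an eigenvector in the image of N in Q / U comes from an eigenvector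
      -- in N, and maximality of k carries over to the quotient.
      have : v = 0 := hk hlt v hv fun r hr hrk => by
        have h1 := hvx r hr hrk
        rw [← hπ, ← map_smul, ← sub_eq_zero, ← map_sub, hπ0] at h1
        exact sub_eq_zero.mp (hdisj U hU _
          (N.sub_mem (h.isEigenStable.x_mem r hr v hv) (N.smul_mem a hv)) h1)
      rw [this, map_zero]
    · intro r hr hrk
      have h1 : xGen q (n + 1) r • u = a • u := by
        rcases hr.eq_or_lt with rfl | hr
        · exact h.last_smul u hu
        · exact hux r hr hrk
      rw [← hπ, ← map_smul, ← sub_eq_zero, ← map_sub, hπ0]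
      -- Since b + c is an eigenvector, (x_r - a) c = -(x_r - a) b lies both in U₂ and in U₁. So c
      -- is an eigenvector modulo U although it need not be one in Q.
      have h2 : xGen q (n + 1) r • c - a • c = -(xGen q (n + 1) r • b - a • b) := by
        rw [← hbc, smul_add, smul_add, ← sub_eq_zero] at h1
        rw [eq_neg_iff_add_eq_zero, ← h1]
        abel
      have hsub : ∀ (V : Submodule (AffHecke q (n + 1)) Q) (v : Q), v ∈ V →
          xGen q (n + 1) r • v - a • v ∈ V := fun V v hv =>
        V.sub_mem (V.smul_mem _ hv) (V.smul_of_tower_mem a hv)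
      exact ⟨h2 ▸ U₁.neg_mem (hsub U₁ b hb), hsub U₂ c hc⟩
  obtain ⟨v, hv, hvc⟩ := hmem
  have hvc' : v - c ∈ U := by rw [← hπ0, map_sub, hvc, sub_self]
  -- c is congruent modulo U to some v ∈ N; then v ∈ U₂, so v = 0 and c ∈ U. Hence u = b + c ∈ U₁,
  -- contradicting u ≠ 0.
  have hv0 : v = 0 := hdisj U₂ hU₂.1 v hv <| by
    have := U₂.add_mem hvc'.2 hc
    rwa [sub_add_cancel] at this
  rw [hv0, zero_sub] at hvc'
  have hc1 : c ∈ U₁ := by simpa using U₁.neg_mem hvc'.1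
  exact hu0 (hdisj U₁ hU₁.1 u hu (hbc ▸ U₁.add_mem hb hc1))

end Module

end AffHecke

/-! ### Socles, cosocles and quotients by kernels -/

section General

variable {A B : Type u} [Ring A] [Ring B]

/-- When nonzero submodules pairwise meet, two simple submodules must coincide, so the sum defining
the socle has a single term. -/
theorem soc_eq_of_isSimpleModule {M : Type u} [AddCommGroup M] [Module A M]
    (hM : ∀ S₁ S₂ : Submodule A M, S₁ ≠ ⊥ → S₂ ≠ ⊥ → S₁ ⊓ S₂ ≠ ⊥) {S : Submodule A M}
    (hS : IsSimpleModule A S) : soc A M = S := by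
  have hatom : ∀ T : Submodule A M, IsSimpleModule A T → IsAtom T := fun T hT =>
    isSimpleModule_iff_isAtom.mp hT
  refine le_antisymm (sSup_le fun T hT => ?_) (le_sSup hS)
  by_contra hle
  exact hM T S (hatom T hT).1 (hatom S hS).1
    (((hatom T hT).lt_iff.mp (inf_le_left.lt_of_ne fun h => hle (inf_eq_left.mp h))))

theorem isSimpleModule_soc_or_eq_bot {M : Type u} [AddCommGroup M] [Module A M]
    (hM : ∀ S₁ S₂ : Submodule A M, S₁ ≠ ⊥ → S₂ ≠ ⊥ → S₁ ⊓ S₂ ≠ ⊥) :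
    IsSimpleModule A (soc A M) ∨ soc A M = ⊥ := by
  by_cases h : ∃ S : Submodule A M, IsSimpleModule A S
  · obtain ⟨S, hS⟩ := h
    rw [soc_eq_of_isSimpleModule hM hS]
    exact Or.inl hS
  · right
    rw [soc, sSup_eq_bot]
    exact fun S hS => absurd ⟨S, hS⟩ h

/-- The radical is the unique maximal submodule if there is one, and the whole module otherwise. -/
theorem isSimpleModule_cosoc_or_subsingleton (M : ModuleCat.{u} A)
    (hM : ∀ U₁ U₂ : Submodule A M, IsCoatom U₁ → IsCoatom U₂ → U₁ = U₂) :
    IsSimpleModule A (cosoc M) ∨ Subsingleton (cosoc M) := by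
  by_cases h : ∃ U : Submodule A M, IsCoatom U
  · obtain ⟨U, hU⟩ := h
    have : Module.jacobson A M = U :=
      le_antisymm (sInf_le hU) (le_sInf fun U' hU' => (hM U U' hU hU').le)
    left
    change IsSimpleModule A (M ⧸ Module.jacobson A M)
    rw [this]
    exact isSimpleModule_iff_isCoatom.mpr hU
  · right
    have : Module.jacobson A M = ⊤ := by
      rw [Module.jacobson, sInf_eq_top]
      exact fun U hU => absurd ⟨U, hU⟩ h
    exact Submodule.Quotient.subsingleton_iff.mpr this

variable (f : A →+* B) (hf : Function.Surjective f) (N : ModuleCat.{u} A)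

/-- The quotient map `N → N / (ker f) N`, semilinear along `f`. -/
def modKerMk : N →ₛₗ[f] modKer f hf N where
  toFun x := (Submodule.Quotient.mk x : N ⧸ kerSMul f N)
  map_add' _ _ := rfl
  map_smul' a x := by
    have key : f.liftOfSurjective hf ⟨Module.toAddMonoidEnd A (N ⧸ kerSMul f N),
        ker_le_ker_toAddMonoidEnd f N⟩ (f a) = Module.toAddMonoidEnd A (N ⧸ kerSMul f N) a :=
      f.liftOfRightInverse_comp_apply _ (Function.rightInverse_surjInv hf) _ a
    exact (DFunLike.congr_fun key (Submodule.Quotient.mk x)).symm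

theorem modKerMk_surjective : Function.Surjective (modKerMk f hf N) :=
  Submodule.Quotient.mk_surjective _

theorem exists_modKer_lift {M : Type u} [AddCommGroup M] [Module B M] (g : N →ₛₗ[f] M) :
    ∃ g' : modKer f hf N →ₗ[B] M, ∀ x, g' (modKerMk f hf N x) = g x := by
  have hle : kerSMul f N ≤ LinearMap.ker g := by
    rw [kerSMul, Submodule.smul_le]
    intro a ha x _
    rw [LinearMap.mem_ker, map_smulₛₗ, (RingHom.mem_ker).mp ha, zero_smul]
  let g₀ : (N ⧸ kerSMul f N) →ₛₗ[f] M := (kerSMul f N).liftQ g hle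
  refine ⟨{ toFun := fun y => g₀ y, map_add' := fun y z => g₀.map_add y z, map_smul' := ?_ },
    fun x => rfl⟩
  intro b y
  obtain ⟨a, rfl⟩ := hf b
  obtain ⟨x, rfl⟩ := modKerMk_surjective f hf N y
  rw [← map_smulₛₗ]
  exact g.map_smulₛₗ a x

/-- In a simple module, (ker f) N is either 0 or N. -/
theorem isSimpleModule_modKer_or_subsingleton
    (hN : IsSimpleModule A N ∨ Subsingleton N) :
    IsSimpleModule B (modKer f hf N) ∨ Subsingleton (modKer f hf N) := by
  rcases hN with hN | hN
  · rcases eq_bot_or_eq_top (kerSMul f N) with h | h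
    · left
      have : RingHomSurjective f := ⟨hf⟩
      refine (LinearMap.isSimpleModule_iff_of_bijective (modKerMk f hf N)
        ⟨(injective_iff_map_eq_zero _).mpr fun x hx => ?_, modKerMk_surjective f hf N⟩).mp hN
      have : x ∈ kerSMul f N := (Submodule.Quotient.mk_eq_zero _).mp hx
      rwa [h, Submodule.mem_bot] at this
    · right
      exact Submodule.Quotient.subsingleton_iff.mpr h
  · right
    exact (modKerMk_surjective f hf N).subsingleton

end General

/-! ### Induction from the first places and an eigenvector on the last place -/

section Induction

open scoped ModuleCat

variable {R : Type u} [Field R] {q : Rˣ} {n : ℕ}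

/-- An element of the base field as a vector of `J1 q i`. -/
def J1.mk (i : Mu q) (r : R) : J1 q i := r

/-- A vector of `J1 q i` as an element of the base field. -/
def J1.val (i : Mu q) (r : J1 q i) : R := r

theorem J1.smul_mk (i : Mu q) (b : AffHecke q 1) (r : R) :
    b • J1.mk i r = J1.mk i (chi q i b * r) := rfl

theorem J1.val_add (i : Mu q) (r s : J1 q i) : J1.val i (r + s) = J1.val i r + J1.val i s := rfl

theorem J1.val_smul (i : Mu q) (r : R) (s : J1 q i) : J1.val i (r • s) = r * J1.val i s := by
  change chi q i (algebraMap R (AffHecke q 1) r) * J1.val i s = _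
  rw [AlgHom.commutes]; rfl

theorem J1.smul_mk_one (i : Mu q) (r : R) : r • J1.mk i 1 = J1.mk i r := by
  change algebraMap R (AffHecke q 1) r • J1.mk i 1 = _
  rw [J1.smul_mk, AlgHom.commutes]
  exact congrArg (J1.mk i) (mul_one r)

/-- An eigenvector of X_{n+1} is acted on by the whole of H_1^aff through the character: the
elements for which this holds form a subalgebra containing the generators. -/
theorem last_smul_eq (i : Mu q) {M : Type*} [AddCommGroup M] [Module (AffHecke q (n + 1)) M]
    {v : M} (hv : AffHecke.xGen q (n + 1) n • v =
      algebraMap R (AffHecke q (n + 1)) ((i : Rˣ) : R) • v) (b : AffHecke q 1) :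
    AffHecke.last q n b • v = algebraMap R (AffHecke q (n + 1)) (chi q i b) • v := by
  let S : Subalgebra R (AffHecke q 1) :=
    { carrier := {b | AffHecke.last q n b • v =
        algebraMap R (AffHecke q (n + 1)) (chi q i b) • v}
      mul_mem' := fun {b c} hb hc => by
        change _ = _
        rw [map_mul, mul_smul, show _ = _ from hc, ← mul_smul, ← Algebra.commutes, mul_smul,
          show _ = _ from hb, ← mul_smul, ← map_mul, map_mul (chi q i), mul_comm]
      add_mem' := fun {b c} hb hc => by
        change _ = _
        rw [map_add, add_smul, show _ = _ from hb, show _ = _ from hc, map_add, map_add, add_smul]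
      algebraMap_mem' := fun r => by
        change _ = _
        rw [AlgHom.commutes, AlgHom.commutes]
        rfl }
  have hS : S = ⊤ := by
    refine AffHecke.eq_top q S fun g => ?_
    have hl : ∀ g, chi q i (AffHecke.gen q g) = _ := fun g => AffHecke.lift_gen q _ _ g
    have hl' : ∀ g, AffHecke.last q n (AffHecke.gen q g) = _ := fun g => AffHecke.lift_gen q _ _ g
    change _ = _
    rw [hl, hl']
    cases g with
    | T i h => omega
    | X j h =>
      rw [AffHecke.xGen_of_lt n.lt_succ_self] at hv
      exact hv
    | Xinv j h =>
      have h1 := congrArg (fun y => algebraMap R (AffHecke q (n + 1)) (((i : Rˣ)⁻¹ : Rˣ) : R) •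
        AffHecke.xInv q (n + 1) n • y) hv
      simp only [← mul_smul] at h1
      rw [AffHecke.xInv_mul_xGen n.lt_succ_self, mul_one, ← Algebra.commutes, ← mul_assoc,
        ← map_mul, Units.inv_mul, map_one, one_mul,
        AffHecke.xInv_of_lt n.lt_succ_self] at h1
      exact h1.symm
  have : b ∈ S := hS ▸ Algebra.mem_top
  exact this

variable (V : ModuleCat.{u} (AffHecke q n)) (i : Mu q)

/-- The induced module `Ind (V ⊠ i J_1)`. -/
abbrev indBox : ModuleCat.{u} (AffHecke q (n + 1)) :=
  ind (AffHecke.levi q n).toRingHom (box R V (J1 q i))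

/-- The vector `v ⊗ 1` of `V ⊠ i J_1`. -/
def boxMk : V →+ box R V (J1 q i) where
  toFun v := (v ⊗ₜ[R] J1.mk i 1 : V ⊗[R] J1 q i)
  map_zero' := TensorProduct.zero_tmul _ _
  map_add' v w := TensorProduct.add_tmul v w _

/-- As iJ_1 is one-dimensional, V ⊠ iJ_1 is V itself, via v ↦ v ⊗ 1. -/
theorem boxMk_surjective : Function.Surjective (boxMk V i) := by
  intro y
  change V ⊗[R] J1 q i at y
  induction y using TensorProduct.induction_on with
  | zero => exact ⟨0, map_zero _⟩
  | tmul v r =>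
    refine ⟨J1.val i r • v, ?_⟩
    change (J1.val i r • v) ⊗ₜ[R] J1.mk i 1 = v ⊗ₜ[R] J1.mk i (J1.val i r)
    rw [TensorProduct.smul_tmul, J1.smul_mk_one]
  | add y z hy hz =>
    obtain ⟨v, hv⟩ := hy
    obtain ⟨w, hw⟩ := hz
    refine ⟨v + w, ?_⟩
    rw [map_add, hv, hw]
    rfl

theorem tmul_smul_boxMk (a : AffHecke q n) (b : AffHecke q 1) (v : V) :
    (a ⊗ₜ[R] b : AffHecke q n ⊗[R] AffHecke q 1) • boxMk V i v =
      boxMk V i (chi q i b • a • v) := by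
  change (a • v) ⊗ₜ[R] (b • J1.mk i 1) =
    ((chi q i b • a • v) ⊗ₜ[R] J1.mk i 1 : V ⊗[R] J1 q i)
  rw [TensorProduct.smul_tmul (chi q i b) (a • v), J1.smul_mk_one, J1.smul_mk, mul_one]

/-- The vector `1 ⊗ (v ⊗ 1)` of `Ind (V ⊠ i J_1)`. -/
def indMk : V →+ indBox V i where
  toFun v := Submodule.Quotient.mk (p := indRel _ _)
    ((1 : AffHecke q (n + 1)) ⊗ₜ[ℤ] boxMk V i v)
  map_zero' := by rw [map_zero, TensorProduct.tmul_zero]; rfl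
  map_add' v w := by rw [map_add, TensorProduct.tmul_add]; rfl

theorem levi_smul_indMk (a : AffHecke q n) (b : AffHecke q 1) (v : V) :
    AffHecke.levi q n (a ⊗ₜ b) • indMk V i v = indMk V i (chi q i b • a • v) := by
  have h : (AffHecke.levi q n (a ⊗ₜ b)) ⊗ₜ[ℤ] boxMk V i v - (1 : AffHecke q (n + 1)) ⊗ₜ[ℤ]
      ((a ⊗ₜ[R] b : AffHecke q n ⊗[R] AffHecke q 1) • boxMk V i v) ∈
        indRel (AffHecke.levi q n).toRingHom (box R V (J1 q i)) :=
    Submodule.subset_span ⟨1, a ⊗ₜ b, boxMk V i v, by rw [one_mul]; rfl⟩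
  rw [tmul_smul_boxMk] at h
  have h2 := (Submodule.Quotient.eq _).mpr h
  refine Eq.trans ?_ h2
  change Submodule.Quotient.mk (AffHecke.levi q n (a ⊗ₜ b) •
    ((1 : AffHecke q (n + 1)) ⊗ₜ[ℤ] boxMk V i v)) = _
  rw [TensorProduct.smul_tmul', smul_eq_mul, mul_one]

theorem incl_smul_indMk (a : AffHecke q n) (v : V) :
    AffHecke.incl q n a • indMk V i v = indMk V i (a • v) := by
  have := levi_smul_indMk V i a 1 v
  rwa [AffHecke.levi, Algebra.TensorProduct.lift_tmul, map_one, mul_one, map_one, one_smul] at this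

theorem last_smul_indMk (v : V) :
    AffHecke.xGen q (n + 1) n • indMk V i v = ((i : Rˣ) : R) • indMk V i v := by
  have hx : AffHecke.last q n (AffHecke.gen q (.X 0 Nat.one_pos)) = AffHecke.xGen q (n + 1) n := by
    rw [AffHecke.last, AffHecke.lift_gen, AffHecke.xGen_of_lt n.lt_succ_self]
  have hc : chi q i (AffHecke.gen q (.X 0 Nat.one_pos)) = ((i : Rˣ) : R) := AffHecke.lift_gen q _ _ _
  have := levi_smul_indMk V i 1 (AffHecke.gen q (.X 0 Nat.one_pos)) v
  rw [AffHecke.levi, Algebra.TensorProduct.lift_tmul, map_one, one_mul, one_smul, hx, hc] at this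
  rw [this]
  change indMk V i (algebraMap R (AffHecke q n) _ • v) =
    algebraMap R (AffHecke q (n + 1)) _ • indMk V i v
  rw [← incl_smul_indMk, AlgHom.commutes]

theorem span_range_indMk :
    Submodule.span (AffHecke q (n + 1)) (Set.range (indMk V i)) = ⊤ := by
  rw [eq_top_iff]
  intro y _
  obtain ⟨z, rfl⟩ := Submodule.Quotient.mk_surjective _ y
  induction z using TensorProduct.induction_on with
  | zero => exact Submodule.zero_mem _
  | tmul b w =>
    obtain ⟨v, rfl⟩ := boxMk_surjective V i w
    have : (Submodule.Quotient.mk (b ⊗ₜ[ℤ] boxMk V i v) : indBox V i) = b • indMk V i v := by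
      change _ = Submodule.Quotient.mk (b • ((1 : AffHecke q (n + 1)) ⊗ₜ[ℤ] boxMk V i v))
      rw [TensorProduct.smul_tmul', smul_eq_mul, mul_one]
    rw [this]
    exact Submodule.smul_mem _ _ (Submodule.subset_span ⟨v, rfl⟩)
  | add y z hy hz => exact Submodule.add_mem _ (hy trivial) (hz trivial)

/-- Frobenius reciprocity for the Levi embedding: an H_n^aff-map from V into the i-eigenspace of
X_{n+1} extends to the induced module. -/
theorem exists_hom_indBox {M : Type u} [AddCommGroup M] [Module (AffHecke q (n + 1)) M]
    (φ : V →+ M) (hφ : ∀ a v, φ (a • v) = AffHecke.incl q n a • φ v)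
    (hφ' : ∀ v, AffHecke.xGen q (n + 1) n • φ v =
      algebraMap R (AffHecke q (n + 1)) ((i : Rˣ) : R) • φ v) :
    ∃ ψ : indBox V i →ₗ[AffHecke q (n + 1)] M, ∀ v, ψ (indMk V i v) = φ v := by
  let : Module R M := Module.compHom M (algebraMap R (AffHecke q (n + 1)))
  have hR : ∀ (r : R) (m : M), r • m = algebraMap R (AffHecke q (n + 1)) r • m := fun _ _ => rfl
  have : IsScalarTower R (AffHecke q (n + 1)) M :=
    ⟨fun r b m => by rw [hR, Algebra.smul_def, mul_smul]⟩
  have hφR : ∀ (r : R) (v : V), φ (r • v) = r • φ v := fun r v => by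
    change φ (algebraMap R (AffHecke q n) r • v) = _
    rw [hφ, AlgHom.commutes, hR]
  let Φ : V ⊗[R] J1 q i →ₗ[R] M := TensorProduct.lift <|
    LinearMap.mk₂ R (fun v (s : J1 q i) => J1.val i s • φ v)
      (fun v w s => by rw [map_add, smul_add])
      (fun r v s => by rw [hφR, smul_comm])
      (fun v s s' => by rw [J1.val_add, add_smul])
      (fun r v s => by rw [J1.val_smul, mul_smul])
  have hΦ : ∀ v, Φ (boxMk V i v) = φ v := fun v => by
    change (1 : R) • φ v = φ v
    rw [one_smul]
  have hΦl : ∀ (z : AffHecke q n ⊗[R] AffHecke q 1) (y : box R V (J1 q i)),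
      Φ (z • y) = AffHecke.levi q n z • Φ y := by
    intro z y
    obtain ⟨v, rfl⟩ := boxMk_surjective V i y
    induction z using TensorProduct.induction_on with
    | zero => rw [zero_smul, map_zero, zero_smul]; exact map_zero Φ
    | tmul a b =>
      rw [tmul_smul_boxMk, hΦ, hΦ, hφR, hφ, AffHecke.levi, Algebra.TensorProduct.lift_tmul,
        mul_smul, last_smul_eq i (hφ' v), ← hR, smul_algebra_smul_comm]
    | add y z hy hz => rw [add_smul, map_add (AffHecke.levi q n), add_smul, ← hy, ← hz]; exact map_add Φ _ _
  let Ψ : AffHecke q (n + 1) ⊗[ℤ] (box R V (J1 q i)) →ₗ[AffHecke q (n + 1)] M :=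
    TensorProduct.AlgebraTensorModule.lift
      { toFun := fun b =>
          { toFun := fun y => b • Φ y
            map_add' := fun y z => by rw [← smul_add]; exact congrArg _ (map_add Φ y z)
            map_smul' := fun k y =>
              (congrArg (b • ·) (map_zsmul Φ k y)).trans (smul_comm b k (Φ y)) }
        map_add' := fun b c => LinearMap.ext fun y => add_smul b c (Φ y)
        map_smul' := fun b c => LinearMap.ext fun y => mul_smul b c (Φ y) }
  have hΨ : ∀ b y, Ψ (b ⊗ₜ y) = b • Φ y := fun _ _ => rfl
  have hle : indRel (AffHecke.levi q n).toRingHom (box R V (J1 q i)) ≤ LinearMap.ker Ψ := by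
    refine Submodule.span_le.mpr ?_
    rintro _ ⟨b, a, y, rfl⟩
    change Ψ _ = 0
    rw [map_sub, hΨ, hΨ, hΦl, mul_smul, sub_eq_zero]
    rfl
  refine ⟨(indRel _ _).liftQ Ψ hle, fun v => ?_⟩
  change Ψ ((1 : AffHecke q (n + 1)) ⊗ₜ[ℤ] boxMk V i v) = _
  rw [hΨ, one_smul, hΦ]

end Induction

/-! ### The operators `ẽ_i` and `f̃_i` on simple modules -/

section Operators

open scoped ModuleCat

variable {R : Type u} [Field R] {q : Rˣ} {n : ℕ}

/-- The image of `V` in `Ind (V ⊠ i J_1)`. -/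
def indRange (V : ModuleCat.{u} (AffHecke q n)) (i : Mu q) : Submodule R (indBox V i) where
  carrier := Set.range (indMk V i)
  add_mem' := by
    rintro _ _ ⟨v, rfl⟩ ⟨w, rfl⟩
    exact ⟨v + w, map_add _ _ _⟩
  zero_mem' := ⟨0, map_zero _⟩
  smul_mem' := by
    rintro r _ ⟨v, rfl⟩
    refine ⟨algebraMap R (AffHecke q n) r • v, ?_⟩
    rw [← incl_smul_indMk, AlgHom.commutes]
    rfl

theorem isLastEigen_indRange (V : ModuleCat.{u} (AffHecke q n)) (i : Mu q) :
    AffHecke.IsLastEigen (q := q) (n := n) ((i : Rˣ) : R) (indRange V i) where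
  incl_mem := by
    rintro b _ ⟨v, rfl⟩
    exact ⟨b • v, (incl_smul_indMk V i b v).symm⟩
  last_smul := by
    rintro _ ⟨v, rfl⟩
    exact last_smul_indMk V i v

theorem finiteDimensional_indRange (V : ModuleCat.{u} (AffHecke q n)) (i : Mu q)
    [Module.Finite R V] : FiniteDimensional R (indRange V i) := by
  let f : V →ₗ[R] indRange V i :=
    { toFun := fun v => ⟨indMk V i v, v, rfl⟩
      map_add' := fun v w => Subtype.ext (map_add (indMk V i) v w)
      map_smul' := fun r v => Subtype.ext (by
        change indMk V i (algebraMap R (AffHecke q n) r • v) = _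
        rw [← incl_smul_indMk, AlgHom.commutes]
        rfl) }
  exact Module.Finite.of_surjective f (by rintro ⟨_, v, rfl⟩; exact ⟨v, rfl⟩)

/-- The preimage in V of a proper submodule of the induced module is an H_n^aff-submodule, and not
all of V because the image of V generates; simplicity makes it 0. This is the disjointness needed
for uniqueness of the maximal submodule. -/
theorem indBox_eq_of_isCoatom (hq : q ≠ 1) (V : ModuleCat.{u} (AffHecke q n)) (i : Mu q)
    [IsSimpleModule (AffHecke q n) V] (U₁ U₂ : Submodule (AffHecke q (n + 1)) (indBox V i))
    (hU₁ : IsCoatom U₁) (hU₂ : IsCoatom U₂) : U₁ = U₂ := by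
  have : Module.Finite R V := AffHecke.finite_of_isSimpleModule (q := q) (n := n)
  have := finiteDimensional_indRange V i
  refine (isLastEigen_indRange V i).eq_of_isCoatom hq (Units.ne_zero _) (span_range_indMk V i)
    (fun U hU => ?_) hU₁ hU₂
  rintro _ ⟨v, rfl⟩ hv
  let K : Submodule (AffHecke q n) V :=
    { carrier := {v | indMk V i v ∈ U}
      add_mem' := fun {v w} hv hw => by
        change indMk V i (v + w) ∈ U
        rw [map_add]; exact U.add_mem hv hw
      zero_mem' := by
        change indMk V i 0 ∈ U
        rw [map_zero]; exact U.zero_mem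
      smul_mem' := fun a v hv => by
        change indMk V i (a • v) ∈ U
        rw [← incl_smul_indMk]; exact U.smul_mem _ hv }
  have hK : K = ⊥ := (eq_bot_or_eq_top K).resolve_right fun h => hU <| by
    rw [eq_top_iff, ← span_range_indMk, Submodule.span_le]
    rintro _ ⟨w, rfl⟩
    have : w ∈ K := h ▸ Submodule.mem_top
    exact this
  have : v ∈ K := hv
  rw [hK, Submodule.mem_bot] at this
  rw [this, map_zero]

variable {L : Level q}

/-- The identity of `M`, as a map from the pullback of `M` which is semilinear along `ev`. -/
def evPullId (M : ModuleCat.{u} (Hecke q L n)) :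
    evPull q L M →ₛₗ[(ev q L n).toRingHom] M where
  toFun m := m
  map_add' _ _ := rfl
  map_smul' _ _ := rfl

theorem isSimpleModule_evPull (M : ModuleCat.{u} (Hecke q L n))
    [hM : IsSimpleModule (Hecke q L n) M] : IsSimpleModule (AffHecke q n) (evPull q L M) := by
  have : RingHomSurjective (ev q L n).toRingHom := ⟨ev_surjective q L n⟩
  exact (LinearMap.isSimpleModule_iff_of_bijective (evPullId M) Function.bijective_id).mpr hM

theorem isSimpleModule_fTilde_or_subsingleton (hq : q ≠ 1) (M : ModuleCat.{u} (Hecke q L n))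
    (i : Mu q) [IsSimpleModule (Hecke q L n) M] :
    IsSimpleModule (Hecke q L (n + 1)) (fTilde q L i M) ∨ Subsingleton (fTilde q L i M) := by
  have := isSimpleModule_evPull M
  exact isSimpleModule_modKer_or_subsingleton _ _ _
    (isSimpleModule_cosoc_or_subsingleton _ (indBox_eq_of_isCoatom hq (evPull q L M) i))

/-- The quotient map `Ind (ev^* M ⊠ i J_1) → f̃_i M`. -/
def fTildeMk (M : ModuleCat.{u} (Hecke q L n)) (i : Mu q) :
    indBox (evPull q L M) i →ₛₗ[(ev q L (n + 1)).toRingHom] fTilde q L i M :=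
  (modKerMk (ev q L (n + 1)).toRingHom (ev_surjective q L (n + 1))
    (cosoc (indBox (evPull q L M) i))).comp (Module.jacobson _ (indBox (evPull q L M) i)).mkQ

theorem fTildeMk_surjective (M : ModuleCat.{u} (Hecke q L n)) (i : Mu q) :
    Function.Surjective (fTildeMk M i) :=
  (modKerMk_surjective _ _ _).comp (Submodule.mkQ_surjective _)

/-- By Frobenius reciprocity the given map yields a surjection from the induced module to M with
maximal kernel. It factors through the cosocle, and then through pr_λ because M is already an
H_n^λ-type module in rank n + 1. Its source f̃_i N is therefore nonzero, hence simple, and Schur's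
lemma finishes. -/
theorem nonempty_fTilde_equiv (hq : q ≠ 1) (N : ModuleCat.{u} (Hecke q L n))
    [IsSimpleModule (Hecke q L n) N] (M : ModuleCat.{u} (Hecke q L (n + 1)))
    [IsSimpleModule (Hecke q L (n + 1)) M] (i : Mu q) (φ : N →+ M)
    (hφ : ∀ a v, φ (a • v) = incl q L n a • φ v)
    (hφ' : ∀ v, ev q L (n + 1) (AffHecke.xGen q (n + 1) n) • φ v =
      algebraMap R (Hecke q L (n + 1)) ((i : Rˣ) : R) • φ v) (hφ0 : φ ≠ 0) :
    Nonempty (M ≃ₗ[Hecke q L (n + 1)] fTilde q L i N) := by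
  have := isSimpleModule_evPull M
  let φ' : evPull q L N →+ evPull q L M := φ
  obtain ⟨ψ, hψ⟩ := exists_hom_indBox (evPull q L N) i φ'
    (fun a v => (hφ (ev q L n a) v).trans (by rw [incl_ev]; rfl))
    (fun v => (hφ' v).trans (by
      rw [← AlgHom.commutes (ev q L (n + 1))]; rfl))
  have hψ0 : ψ ≠ 0 := by
    rintro rfl
    exact hφ0 (AddMonoidHom.ext fun v => (hψ v).symm)
  have hψs : Function.Surjective ψ := ψ.surjective_of_ne_zero hψ0
  have hker : IsCoatom (LinearMap.ker ψ) := by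
    rw [← isSimpleModule_iff_isCoatom]
    exact IsSimpleModule.congr (ψ.quotKerEquivOfSurjective hψs)
  let g : cosoc (indBox (evPull q L N) i) →ₗ[AffHecke q (n + 1)] evPull q L M :=
    (Module.jacobson _ (indBox (evPull q L N) i)).liftQ ψ (sInf_le hker)
  obtain ⟨g', hg'⟩ := exists_modKer_lift (ev q L (n + 1)).toRingHom (ev_surjective q L (n + 1))
    _ ((evPullId M).comp g)
  let g'' : fTilde q L i N →ₗ[Hecke q L (n + 1)] M := g'
  have hs : Function.Surjective g'' := by
    intro m
    obtain ⟨p, hp⟩ := hψs m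
    exact ⟨fTildeMk N i p, (hg' _).trans hp⟩
  have hnt : Nontrivial M := IsSimpleModule.nontrivial (Hecke q L (n + 1)) M
  have hsimple : IsSimpleModule (Hecke q L (n + 1)) (fTilde q L i N) :=
    (isSimpleModule_fTilde_or_subsingleton hq N i).resolve_right fun h =>
      not_subsingleton M hs.subsingleton
  have hg0 : g'' ≠ 0 := by
    intro h
    obtain ⟨m, hm⟩ := exists_ne (0 : M)
    obtain ⟨p, rfl⟩ := hs m
    exact hm (by rw [h]; rfl)
  exact ⟨(LinearEquiv.ofBijective g'' (LinearMap.bijective_of_ne_zero hg0)).symm⟩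

/-! #### The eigenspace `Hom (i J_1, Res M)` -/

/-- The module `Hom (i J_1, Res M)` whose socle is `ẽ_i M`. -/
abbrev EigenHom (L : Level q) (i : Mu q) (M : ModuleCat.{u} (Hecke q L (n + 1))) : Type u :=
  J1 q i →ₗ[AffHecke q 1] LastRes q L M

/-- Evaluation of `Hom (i J_1, Res M)` at the basis vector of `i J_1`. -/
def evalOne (L : Level q) (i : Mu q) (M : ModuleCat.{u} (Hecke q L (n + 1))) :
    EigenHom L i M →+ M where
  toFun f := f (J1.mk i 1)
  map_zero' := rfl
  map_add' _ _ := rfl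

variable {i : Mu q} {M : ModuleCat.{u} (Hecke q L (n + 1))}

theorem evalOne_smul (a : Hecke q L n) (f : EigenHom L i M) :
    evalOne L i M (a • f) = incl q L n a • evalOne L i M f := rfl

theorem evalOne_last (f : EigenHom L i M) (b : AffHecke q 1) :
    ev q L (n + 1) (AffHecke.last q n b) • evalOne L i M f =
      algebraMap R (Hecke q L (n + 1)) (chi q i b) • evalOne L i M f := by
  have h1 : b • J1.mk i 1 = algebraMap R (AffHecke q 1) (chi q i b) • J1.mk i 1 := by
    rw [J1.smul_mk, J1.smul_mk, AlgHom.commutes]; rfl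
  have h2 := congrArg f h1
  rw [map_smul, map_smul] at h2
  refine Eq.trans h2 ?_
  change ev q L (n + 1) (AffHecke.last q n _) • evalOne L i M f = _
  rw [AlgHom.commutes, AlgHom.commutes]

theorem last_gen_X : AffHecke.last q n (AffHecke.gen q (.X 0 Nat.one_pos)) =
    AffHecke.xGen q (n + 1) n := by
  rw [AffHecke.last, AffHecke.lift_gen, AffHecke.xGen_of_lt n.lt_succ_self]

theorem chi_gen_X : chi q i (AffHecke.gen q (.X 0 Nat.one_pos)) = ((i : Rˣ) : R) :=
  AffHecke.lift_gen q _ _ _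

theorem evalOne_xGen (f : EigenHom L i M) :
    ev q L (n + 1) (AffHecke.xGen q (n + 1) n) • evalOne L i M f =
      algebraMap R (Hecke q L (n + 1)) ((i : Rˣ) : R) • evalOne L i M f := by
  rw [← last_gen_X, evalOne_last, chi_gen_X]

theorem evalOne_injective : Function.Injective (evalOne L i M) := by
  refine (injective_iff_map_eq_zero _).mpr fun f hf => LinearMap.ext fun r => ?_
  have h1 : r = algebraMap R (AffHecke q 1) (J1.val i r) • J1.mk i 1 := (J1.smul_mk_one i r).symm
  have h2 : f (J1.mk i 1) = 0 := hf
  rw [h1, map_smul, h2, smul_zero]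
  rfl

/-- With `evalOne_injective` and `evalOne_xGen`, this identifies Hom(iJ_1, Res M) with the
i-eigenspace of X_{n+1} in M. -/
theorem exists_evalOne_eq {v : M} (hv : ev q L (n + 1) (AffHecke.xGen q (n + 1) n) • v =
    algebraMap R (Hecke q L (n + 1)) ((i : Rˣ) : R) • v) : ∃ f, evalOne L i M f = v := by
  have hv' : ∀ b : AffHecke q 1, ev q L (n + 1) (AffHecke.last q n b) • v =
      algebraMap R (Hecke q L (n + 1)) (chi q i b) • v := by
    intro b
    have := @last_smul_eq R _ q n i (evPull q L M) _ _ v (by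
      refine Eq.trans (b := (algebraMap R (Hecke q L (n + 1)) ((i : Rˣ) : R) • v : M)) hv ?_
      rw [← AlgHom.commutes (ev q L (n + 1))]; rfl) b
    refine Eq.trans this ?_
    rw [← AlgHom.commutes (ev q L (n + 1))]; rfl
  refine ⟨{ toFun := fun r => (algebraMap R (Hecke q L (n + 1)) (J1.val i r) • v : M)
            map_add' := fun r s => by
              rw [J1.val_add, map_add, add_smul]; rfl
            map_smul' := fun b r => ?_ }, ?_⟩
  · change (algebraMap R (Hecke q L (n + 1)) (chi q i b * J1.val i r) • v : M) =
      ev q L (n + 1) (AffHecke.last q n b) • (algebraMap R (Hecke q L (n + 1)) (J1.val i r) • v : M)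
    rw [← mul_smul, ← Algebra.commutes, mul_smul, hv', ← mul_smul, ← map_mul, mul_comm]
  · change (algebraMap R (Hecke q L (n + 1)) 1 • v : M) = v
    rw [map_one, one_smul]

/-- The image of a submodule of `Hom (i J_1, Res M)` under evaluation. -/
def evalRange (S : Submodule (Hecke q L n) (EigenHom L i M)) : Submodule R (evPull q L M) where
  carrier := {m | ∃ f ∈ S, evalOne L i M f = m}
  add_mem' := by
    rintro _ _ ⟨f, hf, rfl⟩ ⟨g, hg, rfl⟩
    exact ⟨f + g, S.add_mem hf hg, map_add _ _ _⟩
  zero_mem' := ⟨0, S.zero_mem, map_zero _⟩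
  smul_mem' := by
    rintro r _ ⟨f, hf, rfl⟩
    refine ⟨algebraMap R (Hecke q L n) r • f, S.smul_mem _ hf, ?_⟩
    rw [evalOne_smul, AlgHom.commutes, ← AlgHom.commutes (ev q L (n + 1))]
    rfl

theorem isLastEigen_evalRange (S : Submodule (Hecke q L n) (EigenHom L i M)) :
    AffHecke.IsLastEigen (q := q) (n := n) ((i : Rˣ) : R) (evalRange S) where
  incl_mem := by
    rintro b _ ⟨f, hf, rfl⟩
    refine ⟨ev q L n b • f, S.smul_mem _ hf, ?_⟩
    rw [evalOne_smul, incl_ev]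
    rfl
  last_smul := by
    rintro _ ⟨f, hf, rfl⟩
    refine (evalOne_xGen f).trans ?_
    rw [← AlgHom.commutes (ev q L (n + 1))]
    rfl

theorem evalRange_ne_bot {S : Submodule (Hecke q L n) (EigenHom L i M)} (hS : S ≠ ⊥) :
    evalRange S ≠ ⊥ := by
  obtain ⟨f, hf, hf0⟩ := S.ne_bot_iff.mp hS
  exact (Submodule.ne_bot_iff _).mpr ⟨evalOne L i M f, ⟨f, hf, rfl⟩, fun h =>
    hf0 (evalOne_injective (h.trans (map_zero _).symm))⟩

/-- Evaluation carries submodules of Hom(iJ_1, Res M) to H_n^aff-stable subspaces of the eigenspace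
in the simple module ev^* M, where nonzero ones meet. -/
theorem inf_ne_bot_of_isSimpleModule (hq : q ≠ 1) [IsSimpleModule (Hecke q L (n + 1)) M]
    (S₁ S₂ : Submodule (Hecke q L n) (EigenHom L i M)) (h₁ : S₁ ≠ ⊥) (h₂ : S₂ ≠ ⊥) :
    S₁ ⊓ S₂ ≠ ⊥ := by
  have := isSimpleModule_evPull M
  obtain ⟨m, ⟨f, hf, hfm⟩, ⟨g, hg, hgm⟩, hm⟩ := AffHecke.exists_mem_inf_of_isSimpleModule hq
    (Units.ne_zero _) (isLastEigen_evalRange S₁) (isLastEigen_evalRange S₂)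
    (evalRange_ne_bot h₁) (evalRange_ne_bot h₂)
  have hfg : f = g := evalOne_injective (hfm.trans hgm.symm)
  refine (Submodule.ne_bot_iff _).mpr ⟨f, ⟨hf, hfg ▸ hg⟩, fun h0 => hm ?_⟩
  rw [← hfm, h0, map_zero]
  rfl

theorem isSimpleModule_eTilde_or_subsingleton (hq : q ≠ 1)
    [IsSimpleModule (Hecke q L (n + 1)) M] :
    IsSimpleModule (Hecke q L n) (eTilde q L i M) ∨ Subsingleton (eTilde q L i M) :=
  (isSimpleModule_soc_or_eq_bot (inf_ne_bot_of_isSimpleModule hq)).imp_right fun h => by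
    change Subsingleton (soc (Hecke q L n) (EigenHom L i M))
    rw [h]
    infer_instance

theorem eTilde_equiv_iff (hq : q ≠ 1) [IsSimpleModule (Hecke q L (n + 1)) M]
    (N : ModuleCat.{u} (Hecke q L n)) [IsSimpleModule (Hecke q L n) N] :
    Nonempty (eTilde q L i M ≃ₗ[Hecke q L n] N) ↔
      Nonempty (M ≃ₗ[Hecke q L (n + 1)] fTilde q L i N) := by
  have hntN : Nontrivial N := IsSimpleModule.nontrivial (Hecke q L n) N
  have hntM : Nontrivial M := IsSimpleModule.nontrivial (Hecke q L (n + 1)) M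
  constructor
  · rintro ⟨e⟩
    -- Forward direction: N embeds in the eigenspace as its socle.
    let θ : N →ₗ[Hecke q L n] EigenHom L i M := (Submodule.subtype _).comp e.symm.toLinearMap
    have hθ : Function.Injective θ := (Submodule.subtype_injective _).comp e.symm.injective
    refine nonempty_fTilde_equiv hq N M i ((evalOne L i M).comp θ.toAddMonoidHom) (fun a v => ?_)
      (fun v => evalOne_xGen (θ v)) fun h0 => ?_
    · change evalOne L i M (θ (a • v)) = _
      rw [map_smul, evalOne_smul]
      rfl
    · obtain ⟨v, hv⟩ := exists_ne (0 : N)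
      refine hv (hθ (evalOne_injective ?_))
      rw [map_zero, map_zero]
      exact DFunLike.congr_fun h0 v
  · rintro ⟨e⟩
    -- Backward direction: the composite of N → Ind(N ⊠ iJ_1), the quotient map to f̃_i N, and the
    -- isomorphism with M lands in the i-eigenspace.
    let φ : evPull q L N → M := fun v => e.symm (fTildeMk N i (indMk (evPull q L N) i v))
    have hφlin : ∀ (b : AffHecke q (n + 1)) (p : indBox (evPull q L N) i),
        e.symm (fTildeMk N i (b • p)) = ev q L (n + 1) b • e.symm (fTildeMk N i p) := by
      intro b p
      rw [map_smulₛₗ, map_smul]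
      rfl
    have hφx : ∀ v, ev q L (n + 1) (AffHecke.xGen q (n + 1) n) • φ v =
        algebraMap R (Hecke q L (n + 1)) ((i : Rˣ) : R) • φ v := by
      intro v
      rw [← hφlin, last_smul_indMk, ← AlgHom.commutes (ev q L (n + 1)), ← hφlin]
      rfl
    have hφi : ∀ (a : Hecke q L n) (v : N), φ (a • v : N) = incl q L n a • φ v := by
      intro a v
      obtain ⟨a, rfl⟩ := ev_surjective q L n a
      have h1 := hφlin (AffHecke.incl q n a) (indMk (evPull q L N) i v)
      have h2 := incl_smul_indMk (evPull q L N) i a v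
      rw [h2] at h1
      rw [incl_ev]
      exact h1
    have hφa : ∀ v w, φ (v + w) = φ v + φ w := fun v w => by
      change e.symm (fTildeMk N i (indMk (evPull q L N) i (v + w))) = _
      rw [map_add, map_add, map_add]
    choose θ₀ hθ₀ using fun v => exists_evalOne_eq (hφx v)
    have hθa : ∀ v w, θ₀ (v + w) = θ₀ v + θ₀ w := fun v w =>
      evalOne_injective (by rw [map_add, hθ₀, hθ₀, hθ₀, hφa])
    have hθs : ∀ (a : Hecke q L n) (v : N), θ₀ (a • v : N) = a • θ₀ v := fun a v =>
      evalOne_injective ((hθ₀ _).trans ((hφi a v).trans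
        (congrArg (incl q L n a • ·) (hθ₀ v).symm)))
    let θ : N →ₗ[Hecke q L n] EigenHom L i M := { toFun := θ₀, map_add' := hθa, map_smul' := hθs }
    -- If θ were 0, the surjection onto f̃_i N ≅ M would kill the image of N, which generates the
    -- induced module, so M would be 0.
    have hθ0 : θ ≠ 0 := by
      intro h0
      have hφ0 : ∀ v, φ v = 0 := fun v => by
        rw [← hθ₀]
        change evalOne L i M (θ v) = 0
        rw [h0]
        rfl
      obtain ⟨m, hm⟩ := exists_ne (0 : M)
      obtain ⟨p, hp⟩ := fTildeMk_surjective N i (e m)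
      have hle : Submodule.span (AffHecke q (n + 1)) (Set.range (indMk (evPull q L N) i)) ≤
          LinearMap.ker (fTildeMk N i) := by
        rw [Submodule.span_le]
        rintro _ ⟨v, rfl⟩
        have := hφ0 v
        exact (e.symm.map_eq_zero_iff).mp this
      have hp0 : fTildeMk N i p = 0 := hle (by rw [span_range_indMk]; trivial)
      rw [hp0] at hp
      exact hm ((e.map_eq_zero_iff).mp hp.symm)
    have hθi : Function.Injective θ := θ.injective_of_ne_zero hθ0
    let e' := LinearEquiv.ofInjective θ hθi
    have hS : IsSimpleModule (Hecke q L n) (LinearMap.range θ) := IsSimpleModule.congr e'.symm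
    have hsoc := soc_eq_of_isSimpleModule (inf_ne_bot_of_isSimpleModule hq) hS
    exact ⟨(LinearEquiv.ofEq _ _ hsoc).trans e'.symm⟩

end Operators

/-! ### The operators preserve `q`-integral modules -/

section RepQ

open scoped ModuleCat

variable {R : Type u} [Field R] {q : Rˣ} {n : ℕ}

theorem cycPoly_add_single (lam : Mu q →₀ ℕ) (i : Mu q) :
    cycPoly q (lam + Finsupp.single i 1) =
      cycPoly q lam * (Polynomial.X - Polynomial.C ((i : Rˣ) : R)) := by
  classical
  rw [cycPoly, Finsupp.prod_add_index' (fun _ => pow_zero _) (fun _ _ _ => pow_add _ _ _)]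
  exact congrArg (_ * ·) ((Finsupp.prod_single_index
    (h := fun (a : Mu q) k => (Polynomial.X - Polynomial.C ((a : Rˣ) : R)) ^ k)
    (pow_zero _)).trans (pow_one _))

theorem mem_tail_indRange (V : ModuleCat.{u} (AffHecke q n)) (i : Mu q) [Module.Finite R V]
    (p : indBox V i) : p ∈ tail n (AffHecke.tGen q (n + 1)) (indRange V i) 0 := by
  have := finiteDimensional_indRange V i
  exact (isLastEigen_indRange V i).mem_tail (span_range_indMk V i) p

theorem finite_indBox (V : ModuleCat.{u} (AffHecke q n)) (i : Mu q) [Module.Finite R V] :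
    Module.Finite R (indBox V i) := by
  have := finiteDimensional_indRange V i
  have h1 := finiteDimensional_tail (n := n) (t := AffHecke.tGen q (n + 1)) (N := indRange V i) 0
  have h2 : tail n (AffHecke.tGen q (n + 1)) (indRange V i) 0 = ⊤ :=
    eq_top_iff.mpr fun p _ => mem_tail_indRange V i p
  rw [h2] at h1
  exact Module.Finite.of_surjective (Submodule.subtype (⊤ : Submodule R (indBox V i)))
    fun p => ⟨⟨p, trivial⟩, rfl⟩

/-- X_1 - i maps F_0 into F_1. The products c_m with m ≥ 1 do not involve t_0 and commute with X_1,
so on F_1 the polynomial that annihilates V suffices; one extra factor X_1 - i is therefore enough.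
-/
theorem aeval_cycPoly_smul_indBox (V : ModuleCat.{u} (AffHecke q n)) (i : Mu q)
    [Module.Finite R V] (lam : Mu q →₀ ℕ)
    (hlam : ∀ (h : 0 < n) (v : V), Polynomial.aeval (AffHecke.X q 0 h) (cycPoly q lam) • v = 0)
    (p : indBox V i) :
    Polynomial.aeval (AffHecke.xGen q (n + 1) 0) (cycPoly q (lam + Finsupp.single i 1)) • p =
      0 := by
  have hr := AffHecke.affineRelations q n
  rw [cycPoly_add_single, map_mul, map_sub, Polynomial.aeval_X, Polynomial.aeval_C, mul_smul,
    sub_smul, algebraMap_smul]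
  have h1 := x_smul_sub_mem_tail hr (isLastEigen_indRange V i).isEigenStable 0
    (Nat.zero_le n) (mem_tail_indRange V i p)
  refine (Submodule.mem_bot R).mp (smul_mem_of_mem_tail _ (fun m u hm hmn hu => ?_) h1)
  obtain ⟨v, rfl⟩ := hu
  -- For n = 0 there is no index m with 1 ≤ m ≤ n, which is why no condition on X_1 is needed for V
  -- in rank 0.
  have hn : 0 < n := by omega
  have hc : Commute (cyc (AffHecke.tGen q (n + 1)) n m) (Polynomial.aeval
      (AffHecke.xGen q (n + 1) 0) (cycPoly q lam)) :=
    commute_aeval (commute_cyc m hmn fun r hmr hrn =>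
      (hr.t_comm_x r 0 hrn (Nat.zero_le n) (by omega) (by omega)).symm).symm _
  rw [← mul_smul, ← hc.eq, mul_smul, ← AffHecke.incl_xGen hn, Polynomial.aeval_algHom_apply,
    incl_smul_indMk, AffHecke.xGen_of_lt hn, hlam hn v, map_zero, smul_zero]
  exact zero_mem _

variable {L : Level q}

theorem inRepQ_fTilde (M : ModuleCat.{u} (Hecke q L n)) (i : Mu q)
    (h : InRepQ q (evPull q L M)) : InRepQ q (evPull q L (fTilde q L i M)) := by
  obtain ⟨hfin, lam, hlam⟩ := h
  have : Module.Finite R (evPull q L M) := hfin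
  have hlin : ∀ (b : AffHecke q (n + 1)) (p : indBox (evPull q L M) i),
      (b • (show evPull q L (fTilde q L i M) from fTildeMk M i p) :
        evPull q L (fTilde q L i M)) = fTildeMk M i (b • p) := fun b p =>
    ((fTildeMk M i).map_smulₛₗ b p).symm
  refine ⟨?_, lam + Finsupp.single i 1, fun h m => ?_⟩
  · have := finite_indBox (evPull q L M) i
    let g : indBox (evPull q L M) i →ₗ[R] evPull q L (fTilde q L i M) :=
      { toFun := fun p => fTildeMk M i p
        map_add' := fun p p' => map_add (fTildeMk M i) p p'
        map_smul' := fun r p => (hlin (algebraMap R _ r) p).symm }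
    exact Module.Finite.of_surjective g (fTildeMk_surjective M i)
  · obtain ⟨p, rfl⟩ := fTildeMk_surjective M i m
    refine (hlin _ p).trans ?_
    have := aeval_cycPoly_smul_indBox (evPull q L M) i lam hlam p
    rw [AffHecke.xGen_of_lt h] at this
    rw [this, map_zero]
    rfl

/-- Evaluation embeds ẽ_i M into M compatibly with H_n^aff, so finiteness and the annihilating
polynomial are inherited. -/
theorem inRepQ_eTilde (M : ModuleCat.{u} (Hecke q L (n + 1))) (i : Mu q)
    (h : InRepQ q (evPull q L M)) : InRepQ q (evPull q L (eTilde q L i M)) := by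
  obtain ⟨hfin, lam, hlam⟩ := h
  have : Module.Finite R (evPull q L M) := hfin
  let ε : evPull q L (eTilde q L i M) →+ evPull q L M :=
    (evalOne L i M).comp (soc (Hecke q L n) (EigenHom L i M)).subtype.toAddMonoidHom
  have hε : Function.Injective ε := evalOne_injective.comp (Submodule.subtype_injective _)
  have hlin : ∀ (b : AffHecke q n) m, ε (b • m) = AffHecke.incl q n b • ε m := by
    intro b m
    exact congrArg (fun c : Hecke q L (n + 1) => c • (show M from ε m)) (incl_ev q L n b)
  refine ⟨?_, lam, fun h m => hε ?_⟩
  · let g : evPull q L (eTilde q L i M) →ₗ[R] evPull q L M :=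
      { toFun := ε
        map_add' := fun p p' => map_add ε p p'
        map_smul' := fun r p => (hlin (algebraMap R _ r) p).trans (by
          rw [AlgHom.commutes]
          rfl) }
    exact Module.Finite.of_injective g hε
  · have h1 := hlam (Nat.succ_pos n) (ε m)
    rw [hlin, map_zero, ← Polynomial.aeval_algHom_apply]
    have h2 : AffHecke.incl q n (AffHecke.X q 0 h) = AffHecke.X q 0 (Nat.succ_pos n) :=
      AffHecke.lift_gen q _ _ _
    rw [h2]
    exact h1

end RepQ

/-! ### The crystal graph -/

section Graph

variable {R : Type u} [Field R] {q : Rˣ} {L : Level q}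

theorem cls_eq_of_mk_eq {n : ℕ} {M N : Irr q L n}
    (h : Quotient.mk (irrSetoid q L n) M = Quotient.mk _ N) : cls q L M = cls q L N :=
  congrArg (fun x => (⟨n, x⟩ : B q L)) h

theorem cls_eq_iff {n : ℕ} {M N : Irr q L n} :
    cls q L M = cls q L N ↔ Nonempty (M.1 ≃ₗ[Hecke q L n] N.1) := by
  constructor
  · intro h
    exact Quotient.exact (eq_of_heq (Sigma.mk.inj h).2)
  · intro h
    exact cls_eq_of_mk_eq (Quotient.sound h)

theorem exists_cls (b : B q L) : ∃ (n : ℕ) (M : Irr q L n), cls q L M = b := by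
  obtain ⟨n, x⟩ := b
  obtain ⟨M, rfl⟩ := Quotient.exists_rep x
  exact ⟨n, M, rfl⟩

theorem IsClass.eq {n : ℕ} {X : ModuleCat.{u} (Hecke q L n)} {b b' : Option (B q L)}
    (h : IsClass q L X b) (h' : IsClass q L X b') : b = b' := by
  rcases h with ⟨h1, rfl⟩ | ⟨h1, rfl⟩ <;> rcases h' with ⟨h2, rfl⟩ | ⟨h2, rfl⟩
  · rfl
  · have := IsSimpleModule.nontrivial (Hecke q L n) X
    exact absurd h1 (not_subsingleton X)
  · have := IsSimpleModule.nontrivial (Hecke q L n) X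
    exact absurd h2 (not_subsingleton X)
  · rfl

theorem exists_isClass {n : ℕ} (X : ModuleCat.{u} (Hecke q L n))
    (h : IsSimpleModule (Hecke q L n) X ∨ Subsingleton X) : ∃ b, IsClass q L X b := by
  rcases h with h | h
  · exact ⟨_, Or.inr ⟨h, rfl⟩⟩
  · exact ⟨none, Or.inl ⟨h, rfl⟩⟩

theorem isClass_some_cls_iff {n : ℕ} {X : ModuleCat.{u} (Hecke q L n)} {N : Irr q L n} :
    IsClass q L X (some (cls q L N)) ↔ Nonempty (X ≃ₗ[Hecke q L n] N.1) := by
  constructor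
  · rintro (⟨-, h⟩ | ⟨hX, h⟩)
    · exact absurd h (by simp)
    · exact cls_eq_iff.mp (Option.some.inj h).symm
  · rintro ⟨e⟩
    have := N.2
    have hX : IsSimpleModule (Hecke q L n) X := IsSimpleModule.congr e
    exact Or.inr ⟨hX, congrArg some (cls_eq_iff.mpr ⟨e.symm⟩)⟩

theorem IsClass.exists_of_some {n : ℕ} {X : ModuleCat.{u} (Hecke q L n)} {b : B q L}
    (h : IsClass q L X (some b)) : ∃ N : Irr q L n, b = cls q L N := by
  rcases h with ⟨-, h⟩ | ⟨hX, h⟩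
  · exact absurd h (by simp)
  · exact ⟨_, Option.some.inj h⟩

end Graph

/-- An operator on isomorphism classes of simple modules, given by a relation that is determined by
its values `some b`, is well defined. -/
theorem exists_operator {X Y Z : Type*} (π : X → Y) (hπ : Function.Surjective π)
    (r : X → Option Z → Prop) (hex : ∀ x, ∃ z, r x z) (huniq : ∀ x z z', r x z → r x z' → z = z')
    (hr : ∀ x x', π x = π x' → ∀ z, r x (some z) → r x' (some z)) :
    ∃ f : Y → Option Z, ∀ x, r x (f (π x)) := by
  choose g hg using hex
  refine ⟨fun y => g (Function.surjInv hπ y), fun x => ?_⟩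
  have hx := Function.surjInv_eq hπ (π x)
  change r x (g (Function.surjInv hπ (π x)))
  cases h : g (Function.surjInv hπ (π x)) with
  | some z => exact hr _ _ hx z (h ▸ hg _)
  | none =>
    cases h' : g x with
    | none => exact h' ▸ hg x
    | some z =>
      -- A value `some z` at one representative transports to every other, so it cannot coexist with
      -- `none`.
      have h1 := hr _ _ hx.symm z (h' ▸ hg x)
      rw [huniq _ _ _ (hg _) h1] at h
      cases h

/-! ### The operators on isomorphism classes and the crystal -/

section Graph

variable {R : Type u} [Field R] {q : Rˣ} {L : Level q}

theorem eTilde_isClass_iff (hq : q ≠ 1) (i : Mu q) {n : ℕ} (M : Irr q L (n + 1)) (N : Irr q L n) :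
    IsClass q L (eTilde q L i M.1) (some (cls q L N)) ↔
      IsClass q L (fTilde q L i N.1) (some (cls q L M)) := by
  have := M.2
  have := N.2
  rw [isClass_some_cls_iff, isClass_some_cls_iff, eTilde_equiv_iff hq]
  exact ⟨fun ⟨e⟩ => ⟨e.symm⟩, fun ⟨e⟩ => ⟨e.symm⟩⟩

theorem exists_eOperator (hq : q ≠ 1) (i : Mu q) : ∃ e : B q L → Option (B q L),
    (∀ M : Irr q L 0, e (cls q L M) = none) ∧
      ∀ (n : ℕ) (M : Irr q L (n + 1)), IsClass q L (eTilde q L i M.1) (e (cls q L M)) := by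
  have key : ∀ n, ∃ e : Quotient (irrSetoid q L (n + 1)) → Option (B q L), ∀ M : Irr q L (n + 1),
      IsClass q L (eTilde q L i M.1) (e (Quotient.mk _ M)) := by
    intro n
    refine exists_operator (Quotient.mk _) Quotient.mk_surjective
      (fun (M : Irr q L (n + 1)) b => IsClass q L (eTilde q L i M.1) b) (fun M => ?_)
      (fun _ _ _ => IsClass.eq) fun M M' h b hb => ?_
    · have := M.2
      exact exists_isClass _ (isSimpleModule_eTilde_or_subsingleton hq)
    · obtain ⟨N, rfl⟩ := hb.exists_of_some
      -- After passing to the equivalent statement about f̃_i N, the module M enters only through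
      -- its class. So independence of the representative follows from part (b), with no need for
      -- functoriality of ẽ_i.
      rw [eTilde_isClass_iff hq] at hb ⊢
      rwa [← show cls q L M = cls q L M' from cls_eq_of_mk_eq h]
  choose e he using key
  exact ⟨fun b => match b with
    | ⟨0, _⟩ => none
    | ⟨n + 1, x⟩ => e n x, fun _ => rfl, he⟩

theorem exists_fOperator (hq : q ≠ 1) (i : Mu q) : ∃ f : B q L → Option (B q L),
    ∀ (n : ℕ) (M : Irr q L n), IsClass q L (fTilde q L i M.1) (f (cls q L M)) := by
  have key : ∀ n, ∃ f : Quotient (irrSetoid q L n) → Option (B q L), ∀ M : Irr q L n,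
      IsClass q L (fTilde q L i M.1) (f (Quotient.mk _ M)) := by
    intro n
    refine exists_operator (Quotient.mk _) Quotient.mk_surjective
      (fun (M : Irr q L n) b => IsClass q L (fTilde q L i M.1) b) (fun M => ?_)
      (fun _ _ _ => IsClass.eq) fun M M' h b hb => ?_
    · have := M.2
      exact exists_isClass _ (isSimpleModule_fTilde_or_subsingleton hq M.1 i)
    · obtain ⟨N, rfl⟩ := hb.exists_of_some
      rw [← eTilde_isClass_iff hq] at hb ⊢
      rwa [← show cls q L M = cls q L M' from cls_eq_of_mk_eq h]
  choose f hf using key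
  exact ⟨fun b => f b.1 b.2, hf⟩

/-- The edge axiom is part (b) read on classes. Uniqueness holds because every vertex is the class
of a module and a module has at most one class; rank 0 is covered by the separate condition that ẽ_i
vanishes there. -/
theorem existsUnique_crystalGraph (hq : q ≠ 1) :
    ∃! C : CrystalGraph (Mu q) (B q L),
      (∀ (i : Mu q) (M : Irr q L 0), C.e i (cls q L M) = none) ∧
      (∀ (i : Mu q) (n : ℕ) (M : Irr q L (n + 1)),
        IsClass q L (eTilde q L i M.1) (C.e i (cls q L M))) ∧
      (∀ (i : Mu q) (n : ℕ) (M : Irr q L n),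
        IsClass q L (fTilde q L i M.1) (C.f i (cls q L M))) := by
  choose e he0 he using exists_eOperator (L := L) hq
  choose f hf using exists_fOperator (L := L) hq
  refine ⟨⟨e, f, fun i b b' => ⟨fun h => ?_, fun h => ?_⟩⟩, ⟨he0, he, hf⟩, ?_⟩
  · obtain ⟨n, M, rfl⟩ := exists_cls b
    cases n with
    | zero => rw [he0] at h; cases h
    | succ n =>
      have h1 := he i n M
      rw [h] at h1
      obtain ⟨N, rfl⟩ := h1.exists_of_some
      exact (hf i n N).eq ((eTilde_isClass_iff hq i M N).mp h1)
  · obtain ⟨n, N, rfl⟩ := exists_cls b'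
    have h1 := hf i n N
    rw [h] at h1
    obtain ⟨M, rfl⟩ := h1.exists_of_some
    exact (he i n M).eq ((eTilde_isClass_iff hq i M N).mpr h1)
  · rintro C ⟨h0, h1, h2⟩
    ext1
    · funext i b
      obtain ⟨n, M, rfl⟩ := exists_cls b
      cases n with
      | zero => exact (h0 i M).trans (he0 i M).symm
      | succ n => exact (h1 i n M).eq (he i n M)
    · funext i b
      obtain ⟨n, M, rfl⟩ := exists_cls b
      exact (h2 i n M).eq (hf i n M)

end Graph

end HeckeCrystal

end

theorem mainTheorem4 {R : Type u} [Field R] (q : Rˣ) (hq : q ≠ 1) (L : HeckeCrystal.Level q) :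
    -- `f̃_i M` is irreducible or zero
    (∀ (n : ℕ) (M : ModuleCat.{u} (HeckeCrystal.Hecke q L n)) (i : HeckeCrystal.Mu q),
      IsSimpleModule (HeckeCrystal.Hecke q L n) M →
        IsSimpleModule (HeckeCrystal.Hecke q L (n + 1)) (HeckeCrystal.fTilde q L i M) ∨
          Subsingleton (HeckeCrystal.fTilde q L i M)) ∧
    -- `ẽ_i M` is irreducible or zero
    (∀ (n : ℕ) (M : ModuleCat.{u} (HeckeCrystal.Hecke q L (n + 1))) (i : HeckeCrystal.Mu q),
      IsSimpleModule (HeckeCrystal.Hecke q L (n + 1)) M →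
        IsSimpleModule (HeckeCrystal.Hecke q L n) (HeckeCrystal.eTilde q L i M) ∨
          Subsingleton (HeckeCrystal.eTilde q L i M)) ∧
    -- `ẽ_i M = N` if and only if `M = f̃_i N`
    (∀ (n : ℕ) (M : ModuleCat.{u} (HeckeCrystal.Hecke q L (n + 1)))
      (N : ModuleCat.{u} (HeckeCrystal.Hecke q L n)) (i : HeckeCrystal.Mu q),
      IsSimpleModule (HeckeCrystal.Hecke q L (n + 1)) M →
      IsSimpleModule (HeckeCrystal.Hecke q L n) N →
        (Nonempty (HeckeCrystal.eTilde q L i M ≃ₗ[HeckeCrystal.Hecke q L n] N) ↔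
          Nonempty (M ≃ₗ[HeckeCrystal.Hecke q L (n + 1)] HeckeCrystal.fTilde q L i N))) ∧
    -- `ẽ_i` and `f̃_i` preserve `Rep_q`
    (∀ (n : ℕ) (M : ModuleCat.{u} (HeckeCrystal.Hecke q L n)) (i : HeckeCrystal.Mu q),
      IsSimpleModule (HeckeCrystal.Hecke q L n) M →
      HeckeCrystal.InRepQ q (HeckeCrystal.evPull q L M) →
        HeckeCrystal.InRepQ q (HeckeCrystal.evPull q L (HeckeCrystal.fTilde q L i M))) ∧
    (∀ (n : ℕ) (M : ModuleCat.{u} (HeckeCrystal.Hecke q L (n + 1))) (i : HeckeCrystal.Mu q),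
      IsSimpleModule (HeckeCrystal.Hecke q L (n + 1)) M →
      HeckeCrystal.InRepQ q (HeckeCrystal.evPull q L M) →
        HeckeCrystal.InRepQ q (HeckeCrystal.evPull q L (HeckeCrystal.eTilde q L i M))) ∧
    -- `(B_λ, ẽ_i, f̃_i)` is a well-defined crystal graph
    (∃! C : HeckeCrystal.CrystalGraph (HeckeCrystal.Mu q) (HeckeCrystal.B q L),
      (∀ (i : HeckeCrystal.Mu q) (M : HeckeCrystal.Irr q L 0),
        C.e i (HeckeCrystal.cls q L M) = none) ∧
      (∀ (i : HeckeCrystal.Mu q) (n : ℕ) (M : HeckeCrystal.Irr q L (n + 1)),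
        HeckeCrystal.IsClass q L (HeckeCrystal.eTilde q L i M.1)
          (C.e i (HeckeCrystal.cls q L M))) ∧
      (∀ (i : HeckeCrystal.Mu q) (n : ℕ) (M : HeckeCrystal.Irr q L n),
        HeckeCrystal.IsClass q L (HeckeCrystal.fTilde q L i M.1)
          (C.f i (HeckeCrystal.cls q L M)))) := by
  refine ⟨fun n M i hM => HeckeCrystal.isSimpleModule_fTilde_or_subsingleton hq M i,
    fun n M i hM => HeckeCrystal.isSimpleModule_eTilde_or_subsingleton hq,
    fun n M N i hM hN => HeckeCrystal.eTilde_equiv_iff hq N,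
    fun n M i _ => HeckeCrystal.inRepQ_fTilde M i,
    fun n M i _ => HeckeCrystal.inRepQ_eTilde M i,
    HeckeCrystal.existsUnique_crystalGraph hq⟩
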